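/- Let $C$ be a field, $G$ a monoid, and $D^1$ a pointed irreducible cocommutative Hopf algebra over $C$ of Birkhoff–Witt type, i.e. as a coalgebra $D^1\cong B(U)$, the cofree pointed irreducible cocommutative coalgebra on a $C$-vector space $U$ (so $D^1$ has a $C$-basis $(b_\alpha)$, $\alpha$ running through the finitely supported multi-indices on a set, with $\Delta b_\alpha=\sum_{\beta+\gamma=\alpha}b_\beta\otimes b_\gamma$ and $\varepsilon(b_\alpha)=\delta_{\alpha,0}$). Let $G$ act on $D^1$ by bialgebra endomorphisms and let $D=D^1\# CG$ be the smash product, with $(d\# g)(e\# h)=d\,g(e)\# gh$ and the tensor product coalgebra structure. Let $L$ be a commutative $D$-module algebra and $K\subseteq L$ a $D$-module subalgebra such that both are Artinian rings and simple (non-zero, with no $D$-stable ideals other than $0$ and the whole ring), and such that every $g\in G$ acts injectively on $L$. Assume that for every minimal prime ideal $Q$ of $L$ the field extension $L/Q$ of $K/(K\cap Q)$ is finitely generated, and let $u=(u_1,\dots,u_n)\in L^n$ be such that for every such $Q$ the classes of $u_1,\dots,u_n$ in $L/Q$ form a separating transcendence basis of $L/Q$ over $K/(K\cap Q)$. Then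 there is a unique $n$-variate iterative derivation $\theta_u\colon L\to L[[w]]=L[[w_1,\dots,w_n]]$ with $\theta_u(a)=a$ for all $a\in K$ and $\theta_u(u_i)=u_i+w_i$ for all $i$. Here an $n$-variate iterative derivation is a ring homomorphism $\theta=\sum_k\theta^{(k)}w^k$ with $\theta^{(0)}=\mathrm{id}$ and $\theta^{(m)}\theta^{(k)}=\binom{m+k}{k}\theta^{(m+k)}$. On the convolution algebra $\mathrm{Hom}_C(D,L)$ let $\rho_0(a)(d)=\varepsilon(d)a$ and $\rho(a)(d)=d.a$ for $a\in L$, let $D$ act by $(d.f)(e)=f(ed)$, and let $\theta_u$ act by composition, $f\mapsto\theta_u^{(k)}\circ f$. Let $\mathcal L=\rho_0(L)\{\rho(L)\}_{\theta_u}$ be the smallest subalgebra containing $\rho_0(L)$ and $\rho(L)$ that is stable under all $\theta_u^{(k)}$, and let $\mathcal K=\rho_0(L)[\rho(K)]$. For a commutative $L$-algebra $A$ with nilradical $N(A)$ regard $A[[w]]$ as an $L$-algebra through $\theta_u$, and let $\hat\otimes_L$ denote the $(w)$-adic completion of the tensor product over $L$, where $\mathcal L$ and $\mathcal K$ are $L$-algebras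 through $\rho_0$. Let $\mathcal L\hat\otimes_LA[[w]]$ carry the action of $D$ that extends the one on $\mathcal L$ and is trivial on $A[[w]]$, and the iterative derivation $\theta_u\hat\otimes\theta_w$, where $\theta_w$ is the iterative derivation of $A[[w]]$ over $A$ with respect to the variables $w$. Let $\mathrm{Ume}(L|K)(A)$ be the group of all automorphisms $\varphi$ of the algebra $\mathcal L\hat\otimes_LA[[w]]$ that commute with the action of $D$ and with the iterative derivation, that fix the image of $\mathcal K\hat\otimes_LA[[w]]$ elementwise, and whose composition with the natural map $\mathcal L\hat\otimes_LA[[w]]\to\mathcal L\hat\otimes_L(A/N(A))[[w]]$ equals this map. A homomorphism $A\to B$ of commutative $L$-algebras induces $\mathrm{Ume}(L|K)(A)\to\mathrm{Ume}(L|K)(B)$, $\varphi\mapsto\varphi\,\hat\otimes_{A[[w]]}\mathrm{id}_{B[[w]]}$. Then the group functor $\mathrm{Ume}(L|K)$ on commutative $L$-algebras is a formal group scheme over $L$: there is a weakly admissible topological $L$-algebra $R$ (linearly topologized, complete and separated, with an open ideal consisting of topologically nilpotent elements) such that the underlying set-valued functor of $\mathrm{Ume}(L|K)$ is isomorphic to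 $\mathrm{Spf}\,R$, that is, there are bijections $$\mathrm{Ume}(L|K)(A)\;\cong\;\{f\colon R\to A \mid f \text{ is a homomorphism of } L\text{-algebras with open kernel}\},$$ natural in the commutative $L$-algebra $A$. -/

import Mathlib

open scoped TensorProduct

noncomputable section

namespace Umemura

section Completion

variable {R R' R'' : Type*} [CommRing R] [CommRing R'] [CommRing R'']
  {I : Ideal R} {J : Ideal R'}

/-- An element of the `J`-adic completion from a compatible family of residue classes. -/
def ofFamily (y : ∀ m, R' ⧸ J ^ m)
    (hy : ∀ {m n : ℕ} (h : m ≤ n), Ideal.Quotient.factorPow J h (y n) = y m) :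
    AdicCompletion J R' :=
  ⟨fun m => Ideal.Quotient.factor (le_of_eq (Ideal.mul_top _).symm) (y m), fun {m n} h => by
    obtain ⟨t, ht⟩ := Ideal.Quotient.mk_surjective (y n)
    change AdicCompletion.transitionMap J R' h (Ideal.Quotient.factor _ (y n)) =
      Ideal.Quotient.factor _ (y m)
    rw [← hy h, ← ht]
    rfl⟩

theorem evalₐ_ofFamily (y : ∀ m, R' ⧸ J ^ m)
    (hy : ∀ {m n : ℕ} (h : m ≤ n), Ideal.Quotient.factorPow J h (y n) = y m) (m : ℕ) :
    AdicCompletion.evalₐ J m (ofFamily y hy) = y m := by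
  obtain ⟨t, ht⟩ := Ideal.Quotient.mk_surjective (y m)
  rw [← AdicCompletion.factor_eval_eq_evalₐ J _ (le_of_eq (Ideal.mul_top _))]
  have : AdicCompletion.eval J R' m (ofFamily y hy) =
    Ideal.Quotient.factor (le_of_eq (Ideal.mul_top _).symm) (y m) := rfl
  rw [this, ← ht]
  rfl

theorem factorPow_evalₐ {m n : ℕ} (h : m ≤ n) (x : AdicCompletion J R') :
    Ideal.Quotient.factorPow J h (AdicCompletion.evalₐ J n x) = AdicCompletion.evalₐ J m x := by
  obtain ⟨a, rfl⟩ := AdicCompletion.mk_surjective J R' x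
  rw [AdicCompletion.evalₐ_mk, AdicCompletion.evalₐ_mk]
  have := AdicCompletion.Ideal.mk_eq_mk J h a
  simpa using this

/-- The value at level `m` of the extension of `f`. -/
def shiftLevel (c : ℕ) (f : R →+ R') (hf : ∀ m, ∀ x ∈ I ^ (m + c), f x ∈ J ^ m) (m : ℕ) :
    (R ⧸ I ^ (m + c)) →+ R' ⧸ J ^ m :=
  QuotientAddGroup.lift (I ^ (m + c)).toAddSubgroup
    ((Ideal.Quotient.mk (J ^ m)).toAddMonoidHom.comp f)
    (fun x hx => Ideal.Quotient.eq_zero_iff_mem.2 (hf m x hx))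

theorem shiftLevel_mk (c : ℕ) (f : R →+ R') (hf : ∀ m, ∀ x ∈ I ^ (m + c), f x ∈ J ^ m) (m : ℕ)
    (t : R) : shiftLevel c f hf m (Ideal.Quotient.mk _ t) = Ideal.Quotient.mk _ (f t) := rfl

theorem shiftLevel_compat (c : ℕ) (f : R →+ R') (hf : ∀ m, ∀ x ∈ I ^ (m + c), f x ∈ J ^ m)
    (x : AdicCompletion I R) {m n : ℕ} (h : m ≤ n) :
    Ideal.Quotient.factorPow J h (shiftLevel c f hf n (AdicCompletion.evalₐ I (n + c) x)) =
      shiftLevel c f hf m (AdicCompletion.evalₐ I (m + c) x) := by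
  obtain ⟨t, ht⟩ := Ideal.Quotient.mk_surjective (AdicCompletion.evalₐ I (n + c) x)
  rw [← factorPow_evalₐ (Nat.add_le_add_right h c), ← ht]
  rfl

/-- The continuous extension to adic completions of an additive map `f` with
`f (I ^ (m + c)) ⊆ J ^ m` for all `m`. -/
def extendAdd (c : ℕ) (f : R →+ R') (hf : ∀ m, ∀ x ∈ I ^ (m + c), f x ∈ J ^ m) :
    AdicCompletion I R →+ AdicCompletion J R' where
  toFun x := ofFamily (fun m => shiftLevel c f hf m (AdicCompletion.evalₐ I (m + c) x))
    (shiftLevel_compat c f hf x)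
  map_zero' := AdicCompletion.ext_evalₐ fun m => by
    rw [evalₐ_ofFamily, map_zero, map_zero, map_zero]
  map_add' x y := AdicCompletion.ext_evalₐ fun m => by
    rw [map_add, evalₐ_ofFamily, evalₐ_ofFamily, evalₐ_ofFamily, map_add, map_add]

theorem evalₐ_extendAdd (c : ℕ) (f : R →+ R') (hf : ∀ m, ∀ x ∈ I ^ (m + c), f x ∈ J ^ m)
    (m : ℕ) (x : AdicCompletion I R) :
    AdicCompletion.evalₐ J m (extendAdd c f hf x) =
      shiftLevel c f hf m (AdicCompletion.evalₐ I (m + c) x) :=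
  evalₐ_ofFamily _ (shiftLevel_compat c f hf x) m

theorem extendAdd_of (c : ℕ) (f : R →+ R') (hf : ∀ m, ∀ x ∈ I ^ (m + c), f x ∈ J ^ m) (t : R) :
    extendAdd c f hf (AdicCompletion.of I R t) = AdicCompletion.of J R' (f t) :=
  AdicCompletion.ext_evalₐ fun m => by
    rw [evalₐ_extendAdd, AdicCompletion.evalₐ_of, AdicCompletion.evalₐ_of, shiftLevel_mk]

/-- The value at level `m` of the extension of `g`. -/
def homLevel (g : R →+* AdicCompletion J R')
    (hg : ∀ m, ∀ x ∈ I ^ m, AdicCompletion.evalₐ J m (g x) = 0) (m : ℕ) :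
    AdicCompletion I R →+* R' ⧸ J ^ m :=
  (Ideal.Quotient.lift (I ^ m)
      ((AdicCompletion.evalₐ J m : AdicCompletion J R' →+* R' ⧸ J ^ m).comp g) (hg m)).comp
      (AdicCompletion.evalₐ I m : AdicCompletion I R →+* R ⧸ I ^ m)

theorem homLevel_eq (g : R →+* AdicCompletion J R')
    (hg : ∀ m, ∀ x ∈ I ^ m, AdicCompletion.evalₐ J m (g x) = 0) (m : ℕ) (x : AdicCompletion I R)
    (t : R) (ht : AdicCompletion.evalₐ I m x = Ideal.Quotient.mk _ t) :
    homLevel g hg m x = AdicCompletion.evalₐ J m (g t) := by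
  have : homLevel g hg m x = Ideal.Quotient.lift (I ^ m)
      ((AdicCompletion.evalₐ J m : AdicCompletion J R' →+* R' ⧸ J ^ m).comp g) (hg m)
      (AdicCompletion.evalₐ I m x) := rfl
  rw [this, ht]
  rfl

theorem homLevel_compat (g : R →+* AdicCompletion J R')
    (hg : ∀ m, ∀ x ∈ I ^ m, AdicCompletion.evalₐ J m (g x) = 0) {m n : ℕ} (h : m ≤ n) :
    (Ideal.Quotient.factorPow J h).comp (homLevel g hg n) = homLevel g hg m := by
  ext x
  obtain ⟨t, ht⟩ := Ideal.Quotient.mk_surjective (AdicCompletion.evalₐ I n x)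
  have h2 : AdicCompletion.evalₐ I m x = Ideal.Quotient.mk _ t := by
    rw [← factorPow_evalₐ h, ← ht]; rfl
  rw [RingHom.comp_apply, homLevel_eq g hg n x t ht.symm, homLevel_eq g hg m x t h2]
  exact factorPow_evalₐ h _

/-- The continuous extension to the completion of a ring homomorphism `g` into a completion. -/
def extendHom (g : R →+* AdicCompletion J R')
    (hg : ∀ m, ∀ x ∈ I ^ m, AdicCompletion.evalₐ J m (g x) = 0) :
    AdicCompletion I R →+* AdicCompletion J R' :=
  AdicCompletion.liftRingHom J (homLevel g hg) (homLevel_compat g hg)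

theorem evalₐ_extendHom (g : R →+* AdicCompletion J R')
    (hg : ∀ m, ∀ x ∈ I ^ m, AdicCompletion.evalₐ J m (g x) = 0) (m : ℕ) (x : AdicCompletion I R)
    (t : R) (ht : AdicCompletion.evalₐ I m x = Ideal.Quotient.mk _ t) :
    AdicCompletion.evalₐ J m (extendHom g hg x) = AdicCompletion.evalₐ J m (g t) :=
  (AdicCompletion.evalₐ_liftRingHom J (homLevel g hg) (homLevel_compat g hg) m x).trans
    (homLevel_eq g hg m x t ht)

theorem extendHom_of (g : R →+* AdicCompletion J R')
    (hg : ∀ m, ∀ x ∈ I ^ m, AdicCompletion.evalₐ J m (g x) = 0) (t : R) :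
    extendHom g hg (AdicCompletion.of I R t) = g t :=
  AdicCompletion.ext_evalₐ fun m => evalₐ_extendHom g hg m _ t (AdicCompletion.evalₐ_of I m t)

/-- Two additive maps of completions, continuous with shift `c`, that agree on the uncompleted ring
are equal. -/
theorem eq_of_eq_on_of (c : ℕ) (f g : AdicCompletion I R →+ AdicCompletion J R')
    (hf : ∀ m x, AdicCompletion.evalₐ I (m + c) x = 0 → AdicCompletion.evalₐ J m (f x) = 0)
    (hg : ∀ m x, AdicCompletion.evalₐ I (m + c) x = 0 → AdicCompletion.evalₐ J m (g x) = 0)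
    (h : ∀ t, f (AdicCompletion.of I R t) = g (AdicCompletion.of I R t)) : f = g := by
  ext1 x
  refine AdicCompletion.ext_evalₐ fun m => ?_
  obtain ⟨t, ht⟩ := Ideal.Quotient.mk_surjective (AdicCompletion.evalₐ I (m + c) x)
  have hx : AdicCompletion.evalₐ I (m + c) (x - AdicCompletion.of I R t) = 0 := by
    rw [map_sub, AdicCompletion.evalₐ_of, ht, sub_self]
  have h1 := hf m _ hx
  have h2 := hg m _ hx
  rw [map_sub, map_sub, sub_eq_zero] at h1 h2
  rw [h1, h2, h]

theorem extendAdd_cont (c : ℕ) (f : R →+ R') (hf : ∀ m, ∀ x ∈ I ^ (m + c), f x ∈ J ^ m)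
    (m : ℕ) (x : AdicCompletion I R) (hx : AdicCompletion.evalₐ I (m + c) x = 0) :
    AdicCompletion.evalₐ J m (extendAdd c f hf x) = 0 := by
  rw [evalₐ_extendAdd, hx, map_zero]

theorem evalₐ_eq_zero_of_mem_map (m : ℕ) (y : AdicCompletion J R')
    (hy : y ∈ J.map (algebraMap R' (AdicCompletion J R')) ^ m) :
    AdicCompletion.evalₐ J m y = 0 := by
  have hle : (J ^ m).map (algebraMap R' (AdicCompletion J R')) ≤
      RingHom.ker (AdicCompletion.evalₐ J m : AdicCompletion J R' →+* R' ⧸ J ^ m) := by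
    rw [Ideal.map_le_iff_le_comap]
    intro t ht
    rw [Ideal.mem_comap, RingHom.mem_ker]
    exact (AdicCompletion.evalₐ_of J m t).trans (Ideal.Quotient.eq_zero_iff_mem.2 ht)
  rw [← Ideal.map_pow] at hy
  exact hle hy

/-- A ring homomorphism into a completion that maps an ideal into the ideal of definition is
continuous. -/
theorem evalₐ_eq_zero_of_mem_pow (g : R →+* AdicCompletion J R')
    (hg : ∀ t ∈ I, g t ∈ J.map (algebraMap R' (AdicCompletion J R')))
    (m : ℕ) (x : R) (hx : x ∈ I ^ m) : AdicCompletion.evalₐ J m (g x) = 0 := by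
  refine evalₐ_eq_zero_of_mem_map m _ ?_
  have h1 : I.map g ≤ J.map (algebraMap R' (AdicCompletion J R')) := by
    rw [Ideal.map_le_iff_le_comap]
    exact fun t ht => hg t ht
  refine Ideal.pow_right_mono h1 m ?_
  rw [← Ideal.map_pow]
  exact Ideal.mem_map_of_mem g hx

/-- A ring homomorphism of completions that maps a finitely generated ideal of definition into an
ideal of definition is continuous. -/
theorem evalₐ_eq_zero_of_map_le (hI : I.FG) (f : AdicCompletion I R →+* AdicCompletion J R')
    (hf : ∀ t ∈ I, f (AdicCompletion.of I R t) ∈ J.map (algebraMap R' (AdicCompletion J R')))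
    (m : ℕ) (x : AdicCompletion I R) (hx : AdicCompletion.evalₐ I m x = 0) :
    AdicCompletion.evalₐ J m (f x) = 0 := by
  have hx' : AdicCompletion.eval I R m x = 0 := by
    rw [← AdicCompletion.factor_evalₐ_eq_eval I x (le_of_eq (Ideal.mul_top _).symm), hx, map_zero]
  have hx2 : x ∈ (I ^ m • ⊤ : Submodule R (AdicCompletion I R)) := by
    rw [AdicCompletion.pow_smul_top_eq_ker_eval hI]; exact hx'
  change x ∈ RingHom.ker ((AdicCompletion.evalₐ J m : AdicCompletion J R' →+* R' ⧸ J ^ m).comp f)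
  refine Submodule.smul_induction_on hx2 (fun r hr y _ => ?_) (fun x y hx hy => add_mem hx hy)
  rw [Algebra.smul_def]
  refine Ideal.mul_mem_right _ _ ?_
  exact evalₐ_eq_zero_of_mem_pow (f.comp (algebraMap R (AdicCompletion I R))) hf m r hr

end Completion

/-! ### Multivariate iterative derivations -/

/-- The multi-index binomial coefficient `∏ i, (m i + k i choose k i)`. -/
def multichoose {n : ℕ} (m k : Fin n →₀ ℕ) : ℕ := ∏ i, (m i + k i).choose (k i)

/-- An `n`-variate iterative derivation on `R`: a ring homomorphism `θ : R → R⟦t₁, …, tₙ⟧`,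
`θ a = ∑ θ^(k) a • t^k`, with `θ^(0) = id` and `θ^(m) ∘ θ^(k) = (m + k choose k) • θ^(m + k)`. -/
structure IterDer (n : ℕ) (R : Type*) [CommRing R] where
  toHom : R →+* MvPowerSeries (Fin n) R
  coeff_zero : ∀ a, MvPowerSeries.coeff 0 (toHom a) = a
  iter : ∀ m k a, MvPowerSeries.coeff m (toHom (MvPowerSeries.coeff k (toHom a))) =
    multichoose m k • MvPowerSeries.coeff (m + k) (toHom a)

/-- The component `θ^(k)` of an iterative derivation. -/
def IterDer.comp {n : ℕ} {R : Type*} [CommRing R] (θ : IterDer n R) (k : Fin n →₀ ℕ) : R →+ R :=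
  (MvPowerSeries.coeff k).toAddMonoidHom.comp θ.toHom.toAddMonoidHom

section Hasse

variable {n : ℕ}

theorem vandermonde (p q k : Fin n →₀ ℕ) :
    ∑ x ∈ Finset.HasAntidiagonal.antidiagonal k, (∏ i, (p i).choose (x.1 i)) * ∏ i, (q i).choose (x.2 i) =
      ∏ i, (p i + q i).choose (k i) := by
  classical
  simp_rw [Nat.add_choose_eq]
  rw [Finset.prod_univ_sum]
  refine Finset.sum_bij' (fun x _ i => (x.1 i, x.2 i))
    (fun y _ => (Finsupp.equivFunOnFinite.symm fun i => (y i).1,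
      Finsupp.equivFunOnFinite.symm fun i => (y i).2)) ?_ ?_ ?_ ?_ ?_
  · intro x hx
    rw [Finset.HasAntidiagonal.mem_antidiagonal] at hx
    simp [Fintype.mem_piFinset, ← hx]
  · intro y hy
    rw [Fintype.mem_piFinset] at hy
    rw [Finset.HasAntidiagonal.mem_antidiagonal]
    ext i
    simpa using hy i
  · intro x hx
    ext <;> simp
  · intro y hy
    ext <;> simp
  · intro x hx
    rw [← Finset.prod_mul_distrib]

variable {A : Type*} [CommRing A]

/-- The iterative derivation `θ_w` on `A⟦w⟧` with respect to the variables, `w_i ↦ w_i + t_i`, as an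
additive map. -/
def hasseAdd : MvPowerSeries (Fin n) A →+ MvPowerSeries (Fin n) (MvPowerSeries (Fin n) A) where
  toFun f k m := multichoose m k • MvPowerSeries.coeff (m + k) f
  map_zero' := by
    ext k m
    change multichoose m k • MvPowerSeries.coeff (m + k) (0 : MvPowerSeries (Fin n) A) = 0
    rw [map_zero, smul_zero]
  map_add' f g := by
    ext k m
    change multichoose m k • MvPowerSeries.coeff (m + k) (f + g) =
      multichoose m k • MvPowerSeries.coeff (m + k) f +
      multichoose m k • MvPowerSeries.coeff (m + k) g
    rw [map_add, smul_add]

theorem coeff_coeff_hasseAdd (f : MvPowerSeries (Fin n) A) (k m : Fin n →₀ ℕ) :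
    MvPowerSeries.coeff m (MvPowerSeries.coeff k (hasseAdd f)) =
      multichoose m k • MvPowerSeries.coeff (m + k) f := rfl

theorem hasseAdd_mul (f g : MvPowerSeries (Fin n) A) :
    hasseAdd (f * g) = hasseAdd f * hasseAdd g := by
  classical
  ext k m
  rw [coeff_coeff_hasseAdd, MvPowerSeries.coeff_mul, MvPowerSeries.coeff_mul, map_sum]
  simp_rw [MvPowerSeries.coeff_mul, coeff_coeff_hasseAdd]
  have hL : ∀ x ∈ Finset.HasAntidiagonal.antidiagonal (m + k), multichoose m k •
      (MvPowerSeries.coeff x.1 f * MvPowerSeries.coeff x.2 g) =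
      ∑ y ∈ Finset.HasAntidiagonal.antidiagonal k, ((∏ i, (x.1 i).choose (y.1 i)) * ∏ i, (x.2 i).choose (y.2 i)) •
      (MvPowerSeries.coeff x.1 f * MvPowerSeries.coeff x.2 g) := by
    intro x hx
    rw [← Finset.sum_smul, vandermonde]
    congr 1
    rw [Finset.HasAntidiagonal.mem_antidiagonal] at hx
    refine Finset.prod_congr rfl fun i _ => ?_
    have := DFunLike.congr_fun hx i
    simp only [Finsupp.add_apply] at this
    rw [this]
  rw [Finset.smul_sum, Finset.sum_congr rfl hL, Finset.sum_comm]
  refine Finset.sum_congr rfl fun y hy => ?_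
  rw [Finset.HasAntidiagonal.mem_antidiagonal] at hy
  symm
  refine Finset.sum_of_injOn (fun z => (z.1 + y.1, z.2 + y.2)) ?_ ?_ ?_ ?_
  · rintro ⟨a, b⟩ _ ⟨a', b'⟩ _ h
    simp only [Prod.mk.injEq, add_left_inj] at h
    exact Prod.ext h.1 h.2
  · intro z hz
    have hz := Finset.HasAntidiagonal.mem_antidiagonal.1 (Finset.mem_coe.1 hz)
    rw [Finset.mem_coe, Finset.HasAntidiagonal.mem_antidiagonal, ← hz, ← hy]
    exact add_add_add_comm _ _ _ _
  · rintro x hx hx2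
    rw [Finset.HasAntidiagonal.mem_antidiagonal] at hx
    by_contra hne
    have hne' : ((∏ i, (x.1 i).choose (y.1 i)) * ∏ i, (x.2 i).choose (y.2 i)) ≠ 0 := by
      intro h0
      rw [h0, zero_smul] at hne
      exact hne rfl
    have h1 := left_ne_zero_of_mul hne'
    have h2 := right_ne_zero_of_mul hne'
    rw [Finset.prod_ne_zero_iff] at h1 h2
    have h1' : y.1 ≤ x.1 := fun i => not_lt.1 fun h => h1 i (Finset.mem_univ i)
      (Nat.choose_eq_zero_of_lt h)
    have h2' : y.2 ≤ x.2 := fun i => not_lt.1 fun h => h2 i (Finset.mem_univ i)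
      (Nat.choose_eq_zero_of_lt h)
    refine hx2 ⟨(x.1 - y.1, x.2 - y.2), ?_, ?_⟩
    · rw [Finset.mem_coe, Finset.HasAntidiagonal.mem_antidiagonal]
      have e : (x.1 - y.1 + (x.2 - y.2)) + k = m + k := by
        rw [← hx, ← hy]
        calc _ = (x.1 - y.1 + y.1) + (x.2 - y.2 + y.2) := add_add_add_comm _ _ _ _
          _ = _ := by rw [tsub_add_cancel_of_le h1', tsub_add_cancel_of_le h2']
      exact add_right_cancel e
    · simp only [tsub_add_cancel_of_le h1', tsub_add_cancel_of_le h2']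
  · intro z hz
    simp only [multichoose, Finsupp.add_apply]
    rw [smul_mul_smul_comm]

/-- The iterative derivation `θ_w` on `A⟦w⟧` as a ring homomorphism `A⟦w⟧ → A⟦w⟧⟦t⟧`. -/
def hasse : MvPowerSeries (Fin n) A →+* MvPowerSeries (Fin n) (MvPowerSeries (Fin n) A) where
  __ := hasseAdd
  map_one' := by
    classical
    ext k m
    change multichoose m k • MvPowerSeries.coeff (m + k) (1 : MvPowerSeries (Fin n) A) = _
    rw [MvPowerSeries.coeff_one, MvPowerSeries.coeff_one]
    by_cases hk : k = 0
    · subst hk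
      simp [multichoose, MvPowerSeries.coeff_one]
    · have : m + k ≠ 0 := fun h => hk (by
        have := (add_eq_zero.1 h).2
        exact this)
      rw [if_neg this, if_neg hk, smul_zero, map_zero]
  map_mul' := hasseAdd_mul

theorem coeff_coeff_hasse (f : MvPowerSeries (Fin n) A) (k m : Fin n →₀ ℕ) :
    MvPowerSeries.coeff m (MvPowerSeries.coeff k (hasse f)) =
      multichoose m k • MvPowerSeries.coeff (m + k) f := rfl

theorem coeff_zero_hasse (f : MvPowerSeries (Fin n) A) :
    MvPowerSeries.coeff 0 (hasse f) = f := by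
  ext m
  rw [coeff_coeff_hasse]
  simp [multichoose]

theorem map_coeff_hasse {B : Type*} [CommRing B] (l : A →+* B) (f : MvPowerSeries (Fin n) A)
    (k : Fin n →₀ ℕ) : MvPowerSeries.map l (MvPowerSeries.coeff k (hasse f)) =
      MvPowerSeries.coeff k (hasse (MvPowerSeries.map l f)) := by
  ext m
  rw [MvPowerSeries.coeff_map, coeff_coeff_hasse, coeff_coeff_hasse, MvPowerSeries.coeff_map,
    map_nsmul]

end Hasse

section Tensor

variable {n : ℕ} {L : Type*} [CommRing L]

/-- The power series ring `A⟦w⟧` of an `L`-algebra `A`, regarded as an `L`-algebra through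
`L → L⟦w⟧ → A⟦w⟧`, where the first map is the iterative derivation `θ`. -/
def Tw (_θ : IterDer n L) (A : Type*) : Type _ := MvPowerSeries (Fin n) A

instance (θ : IterDer n L) (A : Type*) [CommRing A] : CommRing (Tw θ A) :=
  inferInstanceAs (CommRing (MvPowerSeries (Fin n) A))

instance (θ : IterDer n L) (A : Type*) [CommRing A] [Algebra L A] : Algebra L (Tw θ A) :=
  RingHom.toAlgebra (((MvPowerSeries.map (algebraMap L A)).comp θ.toHom :
    L →+* MvPowerSeries (Fin n) A) : L →+* Tw θ A)

theorem Tw.algebraMap_eq (θ : IterDer n L) (A : Type*) [CommRing A] [Algebra L A] (a : L) :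
    algebraMap L (Tw θ A) a =
      (MvPowerSeries.map (algebraMap L A) (θ.toHom a) : MvPowerSeries (Fin n) A) := rfl

/-- The coefficientwise extension `A⟦w⟧ → B⟦w⟧` of `g : A → B`. -/
def Tw.map (θ : IterDer n L) {A B : Type*} [CommRing A] [Algebra L A] [CommRing B] [Algebra L B]
    (g : A →ₐ[L] B) : Tw θ A →ₐ[L] Tw θ B where
  toRingHom := (MvPowerSeries.map (g : A →+* B) :
    MvPowerSeries (Fin n) A →+* MvPowerSeries (Fin n) B)
  commutes' a := by
    change MvPowerSeries.map (g : A →+* B) (MvPowerSeries.map (algebraMap L A) (θ.toHom a)) =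
      MvPowerSeries.map (algebraMap L B) (θ.toHom a)
    ext k
    simp

/-- The variable `w_i` of `A⟦w⟧`. -/
def Tw.X (θ : IterDer n L) (A : Type*) [CommRing A] (i : Fin n) : Tw θ A :=
  (MvPowerSeries.X i : MvPowerSeries (Fin n) A)

/-- The ideal `(w)` of `A⟦w⟧`. -/
def Tw.ideal (θ : IterDer n L) (A : Type*) [CommRing A] : Ideal (Tw θ A) :=
  Ideal.span (Set.range (Tw.X θ A))

theorem Tw.map_mem (θ : IterDer n L) {A B : Type*} [CommRing A] [Algebra L A] [CommRing B]
    [Algebra L B] (g : A →ₐ[L] B) (b : Tw θ A) (hb : b ∈ Tw.ideal θ A) :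
    Tw.map θ g b ∈ Tw.ideal θ B := by
  have : Tw.ideal θ A ≤ (Tw.ideal θ B).comap (Tw.map θ g) := by
    refine Ideal.span_le.2 ?_
    rintro _ ⟨i, rfl⟩
    have h : Tw.map θ g (Tw.X θ A i) = Tw.X θ B i := MvPowerSeries.map_X (g : A →+* B) i
    change Tw.map θ g (Tw.X θ A i) ∈ Tw.ideal θ B
    exact h ▸ Ideal.subset_span ⟨i, rfl⟩
  exact this hb

/-- `S ⊗_L A⟦w⟧`, where `A⟦w⟧` is an `L`-algebra through `θ`. -/
abbrev Tens (θ : IterDer n L) (S A : Type*) [CommRing S] [Algebra L S] [CommRing A] [Algebra L A] :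
    Type _ := S ⊗[L] Tw θ A

variable (θ : IterDer n L) (S : Type*) [CommRing S] [Algebra L S]
  (A : Type*) [CommRing A] [Algebra L A]

/-- The ideal of `S ⊗_L A⟦w⟧` generated by `w`. -/
def wIdeal : Ideal (Tens θ S A) :=
  (Tw.ideal θ A).map (Algebra.TensorProduct.includeRight : Tw θ A →ₐ[L] Tens θ S A)

theorem wIdeal_fg : (wIdeal θ S A).FG :=
  Ideal.FG.map ⟨(Set.finite_range _).toFinset, by rw [Set.Finite.coe_toFinset]; rfl⟩ _

theorem tmul_mem_wIdeal {b : Tw θ A} (hb : b ∈ Tw.ideal θ A) :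
    (1 ⊗ₜ[L] b : Tens θ S A) ∈ wIdeal θ S A :=
  Ideal.mem_map_of_mem (Algebra.TensorProduct.includeRight : Tw θ A →ₐ[L] Tens θ S A) hb

/-- The completed tensor product `S ⊗̂_L A⟦w⟧`, the `(w)`-adic completion of `S ⊗_L A⟦w⟧`. -/
abbrev CTens : Type _ := AdicCompletion (wIdeal θ S A) (Tens θ S A)

/-- The canonical map `S ⊗_L A⟦w⟧ → S ⊗̂_L A⟦w⟧`. -/
def ofTens : Tens θ S A →ₐ[L] CTens θ S A where
  toRingHom := algebraMap (Tens θ S A) (CTens θ S A)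
  commutes' _ := rfl

/-- The image of `s ⊗ 1` in `S ⊗̂_L A⟦w⟧`. -/
def inS : S →ₐ[L] CTens θ S A :=
  (ofTens θ S A).comp Algebra.TensorProduct.includeLeft

/-- The image of `1 ⊗ b` in `S ⊗̂_L A⟦w⟧`. -/
def inW : Tw θ A →ₐ[L] CTens θ S A :=
  (ofTens θ S A).comp Algebra.TensorProduct.includeRight

theorem ofTens_tmul (s : S) (b : Tw θ A) : ofTens θ S A (s ⊗ₜ b) = inS θ S A s * inW θ S A b := by
  rw [inS, inW, AlgHom.comp_apply, AlgHom.comp_apply, ← map_mul]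
  congr 1
  rw [Algebra.TensorProduct.includeLeft_apply, Algebra.TensorProduct.includeRight_apply,
    Algebra.TensorProduct.tmul_mul_tmul, one_mul, mul_one]

theorem inW_mem {b : Tw θ A} (hb : b ∈ Tw.ideal θ A) :
    inW θ S A b ∈ (wIdeal θ S A).map (algebraMap (Tens θ S A) (CTens θ S A)) :=
  Ideal.mem_map_of_mem _ (tmul_mem_wIdeal θ S A hb)

variable {θ S A}
variable {S' : Type*} [CommRing S'] [Algebra L S'] {A' : Type*} [CommRing A'] [Algebra L A']

theorem hom_mem_of_inW (g : Tens θ S A →+* CTens θ S' A')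
    (hg : ∀ b ∈ Tw.ideal θ A, g (1 ⊗ₜ b) ∈
      (wIdeal θ S' A').map (algebraMap (Tens θ S' A') (CTens θ S' A'))) :
    ∀ t ∈ wIdeal θ S A, g t ∈
      (wIdeal θ S' A').map (algebraMap (Tens θ S' A') (CTens θ S' A')) := by
  have : wIdeal θ S A ≤ ((wIdeal θ S' A').map (algebraMap (Tens θ S' A') (CTens θ S' A'))).comap g := by
    refine Ideal.map_le_iff_le_comap.2 fun b hb => ?_
    exact hg b hb
  exact this

/-- Ring homomorphisms of completed tensor products that map `(w)` into `(w)` are continuous. -/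
theorem cont_of_inW (f : CTens θ S A →+* CTens θ S' A')
    (hf : ∀ b ∈ Tw.ideal θ A, f (inW θ S A b) ∈
      (wIdeal θ S' A').map (algebraMap (Tens θ S' A') (CTens θ S' A')))
    (m : ℕ) (x : CTens θ S A) (hx : AdicCompletion.evalₐ (wIdeal θ S A) m x = 0) :
    AdicCompletion.evalₐ (wIdeal θ S' A') m (f x) = 0 :=
  evalₐ_eq_zero_of_map_le (wIdeal_fg θ S A) f
    (hom_mem_of_inW (f.comp (algebraMap (Tens θ S A) (CTens θ S A))) hf) m x hx

/-- The homomorphism of completed tensor products given by `f` on `S` and by `g` on `A⟦w⟧`. -/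
def liftC (f : S →ₐ[L] CTens θ S' A') (g : A →ₐ[L] A') : CTens θ S A →+* CTens θ S' A' :=
  extendHom (Algebra.TensorProduct.lift f ((inW θ S' A').comp (Tw.map θ g))
      (fun _ _ => Commute.all _ _) : Tens θ S A →ₐ[L] CTens θ S' A').toRingHom
    (evalₐ_eq_zero_of_mem_pow _ (hom_mem_of_inW _ fun b hb => by
      have : (Algebra.TensorProduct.lift f ((inW θ S' A').comp (Tw.map θ g))
        (fun _ _ => Commute.all _ _) : Tens θ S A →ₐ[L] CTens θ S' A').toRingHom (1 ⊗ₜ[L] b) =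
          inW θ S' A' (Tw.map θ g b) := by simp
      rw [this]
      exact inW_mem θ S' A' (Tw.map_mem θ g b hb)))

theorem liftC_inS (f : S →ₐ[L] CTens θ S' A') (g : A →ₐ[L] A') (s : S) :
    liftC f g (inS θ S A s) = f s := by
  refine (extendHom_of _ _ _).trans ?_
  simp

theorem liftC_inW (f : S →ₐ[L] CTens θ S' A') (g : A →ₐ[L] A') (b : Tw θ A) :
    liftC f g (inW θ S A b) = inW θ S' A' (Tw.map θ g b) := by
  refine (extendHom_of _ _ _).trans ?_
  simp

/-- Additive maps that are continuous with a shift agree if they agree on `s ⊗ b`. -/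
theorem addHom_ext (c : ℕ) (f g : CTens θ S A →+ CTens θ S' A')
    (hf : ∀ m x, AdicCompletion.evalₐ (wIdeal θ S A) (m + c) x = 0 →
      AdicCompletion.evalₐ (wIdeal θ S' A') m (f x) = 0)
    (hg : ∀ m x, AdicCompletion.evalₐ (wIdeal θ S A) (m + c) x = 0 →
      AdicCompletion.evalₐ (wIdeal θ S' A') m (g x) = 0)
    (h : ∀ s b, f (inS θ S A s * inW θ S A b) = g (inS θ S A s * inW θ S A b)) : f = g := by
  refine eq_of_eq_on_of c f g hf hg fun t => ?_
  change f (ofTens θ S A t) = g (ofTens θ S A t)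
  induction t using TensorProduct.induction_on with
  | zero => rw [map_zero, map_zero, map_zero]
  | add x y hx hy => rw [map_add, map_add, map_add, hx, hy]
  | tmul s b => rw [ofTens_tmul, h]

/-- Ring homomorphisms agree if they agree on `s ⊗ 1` and on `1 ⊗ b`. -/
theorem ringHom_ext (f g : CTens θ S A →+* CTens θ S' A')
    (hf : ∀ b ∈ Tw.ideal θ A, f (inW θ S A b) ∈
      (wIdeal θ S' A').map (algebraMap (Tens θ S' A') (CTens θ S' A')))
    (hS : ∀ s, f (inS θ S A s) = g (inS θ S A s))
    (hW : ∀ b, f (inW θ S A b) = g (inW θ S A b)) : f = g := by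
  have : f.toAddMonoidHom = g.toAddMonoidHom :=
    addHom_ext 0 f.toAddMonoidHom g.toAddMonoidHom (fun m x hx => cont_of_inW f hf m x hx)
      (fun m x hx => cont_of_inW g (fun b hb => hW b ▸ hf b hb) m x hx) (fun s b => by
        change f _ = g _
        rw [map_mul, map_mul, hS, hW])
  refine RingHom.ext fun x => ?_
  exact DFunLike.congr_fun this x

end Tensor

section Operators

variable {n : ℕ} {L : Type*} [CommRing L] {θ : IterDer n L}
  {S : Type*} [CommRing S] [Algebra L S] {A : Type*} [CommRing A] [Algebra L A]
  {S' : Type*} [CommRing S'] [Algebra L S'] {A' : Type*} [CommRing A'] [Algebra L A']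

/-- The map `S ⊗̂_L A⟦w⟧ → S' ⊗̂_L A'⟦w⟧` induced by `f : S → S'` and `g : A → A'`. -/
def mapC (θ : IterDer n L) (f : S →ₐ[L] S') (g : A →ₐ[L] A') : CTens θ S A →+* CTens θ S' A' :=
  liftC ((inS θ S' A').comp f) g

theorem mapC_inS (f : S →ₐ[L] S') (g : A →ₐ[L] A') (s : S) :
    mapC θ f g (inS θ S A s) = inS θ S' A' (f s) := liftC_inS _ _ _

theorem mapC_inW (f : S →ₐ[L] S') (g : A →ₐ[L] A') (b : Tw θ A) :
    mapC θ f g (inW θ S A b) = inW θ S' A' (Tw.map θ g b) := liftC_inW _ _ _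

theorem mapC_cont (f : S →ₐ[L] S') (g : A →ₐ[L] A') (m : ℕ) (x : CTens θ S A)
    (hx : AdicCompletion.evalₐ (wIdeal θ S A) m x = 0) :
    AdicCompletion.evalₐ (wIdeal θ S' A') m (mapC θ f g x) = 0 :=
  cont_of_inW _ (fun b hb => by
    rw [mapC_inW]
    exact inW_mem θ S' A' (Tw.map_mem θ g b hb)) m x hx

/-! #### Operators acting on the first factor -/

/-- The operator `T ⊗ id` on `S ⊗_L A⟦w⟧`. -/
def opTens (θ : IterDer n L) (A : Type*) [CommRing A] [Algebra L A] (T : S →ₗ[L] S) :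
    Tens θ S A →+ Tens θ S A :=
  (LinearMap.rTensor (Tw θ A) T).toAddMonoidHom

theorem opTens_tmul (T : S →ₗ[L] S) (s : S) (b : Tw θ A) :
    opTens θ A T (s ⊗ₜ b) = T s ⊗ₜ b := LinearMap.rTensor_tmul _ _ _ _

theorem opTens_mul (T : S →ₗ[L] S) (x : Tens θ S A) (b : Tw θ A) :
    opTens θ A T (x * 1 ⊗ₜ b) = opTens θ A T x * 1 ⊗ₜ b := by
  induction x using TensorProduct.induction_on with
  | zero => rw [zero_mul, map_zero, zero_mul]
  | add x y hx hy => rw [add_mul, map_add, map_add, hx, hy, add_mul]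
  | tmul s c => rw [Algebra.TensorProduct.tmul_mul_tmul, opTens_tmul, opTens_tmul,
      Algebra.TensorProduct.tmul_mul_tmul, mul_one, mul_one]

theorem opTens_pow (T : S →ₗ[L] S) (m : ℕ) (x : Tens θ S A) (hx : x ∈ wIdeal θ S A ^ (m + 0)) :
    opTens θ A T x ∈ wIdeal θ S A ^ m := by
  have key : ∀ t : Tens θ S A, opTens θ A T (t * x) ∈ wIdeal θ S A ^ m := by
    rw [add_zero, wIdeal, ← Ideal.map_pow] at hx
    refine Submodule.span_induction
      (p := fun x _ => ∀ t : Tens θ S A, opTens θ A T (t * x) ∈ wIdeal θ S A ^ m)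
      ?_ ?_ ?_ ?_ hx
    · rintro _ ⟨b, hb, rfl⟩ t
      change opTens θ A T (t * 1 ⊗ₜ b) ∈ _
      rw [opTens_mul]
      refine Ideal.mul_mem_left _ _ ?_
      rw [wIdeal, ← Ideal.map_pow]
      exact Ideal.mem_map_of_mem
        (Algebra.TensorProduct.includeRight : Tw θ A →ₐ[L] Tens θ S A) hb
    · intro t
      rw [mul_zero, map_zero]
      exact zero_mem _
    · intro x y _ _ hx hy t
      rw [mul_add, map_add]
      exact add_mem (hx t) (hy t)
    · intro a x _ hx t
      rw [smul_eq_mul, ← mul_assoc]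
      exact hx (t * a)
  simpa using key 1

/-- The continuous extension of `T ⊗ id` to `S ⊗̂_L A⟦w⟧`. -/
def opC (θ : IterDer n L) (A : Type*) [CommRing A] [Algebra L A] (T : S →ₗ[L] S) :
    CTens θ S A →+ CTens θ S A :=
  extendAdd 0 (opTens θ A T) (opTens_pow T)

theorem opC_ofTens (T : S →ₗ[L] S) (t : Tens θ S A) :
    opC θ A T (ofTens θ S A t) = ofTens θ S A (opTens θ A T t) := extendAdd_of _ _ _ _

theorem opC_inS (T : S →ₗ[L] S) (s : S) : opC θ A T (inS θ S A s) = inS θ S A (T s) := by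
  refine (opC_ofTens T _).trans (congrArg _ ?_)
  exact opTens_tmul T s 1

theorem opC_cont (T : S →ₗ[L] S) (m : ℕ) (x : CTens θ S A)
    (hx : AdicCompletion.evalₐ (wIdeal θ S A) (m + 0) x = 0) :
    AdicCompletion.evalₐ (wIdeal θ S A) m (opC θ A T x) = 0 := extendAdd_cont _ _ _ _ _ hx

theorem mul_cont (c : ℕ) (y : CTens θ S A) (m : ℕ) (x : CTens θ S A)
    (hx : AdicCompletion.evalₐ (wIdeal θ S A) (m + c) x = 0) :
    AdicCompletion.evalₐ (wIdeal θ S A) m (x * y) = 0 := by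
  rw [map_mul, ← factorPow_evalₐ (Nat.le_add_right m c), hx, map_zero, zero_mul]

theorem opC_mul (T : S →ₗ[L] S) (x : CTens θ S A) (b : Tw θ A) :
    opC θ A T (x * inW θ S A b) = opC θ A T x * inW θ S A b := by
  have := eq_of_eq_on_of 0 ((opC θ A T).comp (AddMonoidHom.mulRight (inW θ S A b)))
    ((AddMonoidHom.mulRight (inW θ S A b)).comp (opC θ A T))
    (fun m x hx => opC_cont T m _ (mul_cont 0 _ (m + 0) x hx))
    (fun m x hx => mul_cont 0 _ m _ (opC_cont T (m + 0) x hx))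
    (fun t => by
      change opC θ A T (ofTens θ S A t * ofTens θ S A (1 ⊗ₜ b)) =
        opC θ A T (ofTens θ S A t) * ofTens θ S A (1 ⊗ₜ b)
      rw [← map_mul, opC_ofTens, opC_ofTens, opTens_mul, map_mul])
  exact DFunLike.congr_fun this x

theorem opC_mapC (T : S →ₗ[L] S) (g : A →ₐ[L] A') (x : CTens θ S A) :
    opC θ A' T (mapC θ (AlgHom.id L S) g x) = mapC θ (AlgHom.id L S) g (opC θ A T x) := by
  have := addHom_ext 0 ((opC θ A' T).comp (mapC θ (AlgHom.id L S) g).toAddMonoidHom)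
    ((mapC θ (AlgHom.id L S) g).toAddMonoidHom.comp (opC θ A T))
    (fun m x hx => opC_cont T m _ (mapC_cont _ _ _ _ hx))
    (fun m x hx => mapC_cont _ _ _ _ (opC_cont T m x hx))
    (fun s b => by
      change opC θ A' T (mapC θ (AlgHom.id L S) g _) = mapC θ (AlgHom.id L S) g (opC θ A T _)
      rw [map_mul, mapC_inS, mapC_inW, opC_mul, opC_inS, opC_mul, opC_inS, map_mul, mapC_inS,
        mapC_inW]
      rfl)
  exact DFunLike.congr_fun this x

/-! #### The iterative derivation on the tensor product -/

/-- `θS` extends `θ`. -/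
def Extends (θ : IterDer n L) (θS : IterDer n S) : Prop :=
  ∀ a, θS.toHom (algebraMap L S a) = MvPowerSeries.map (algebraMap L S) (θ.toHom a)

/-- `b ↦ 1 ⊗ b`, with source the plain ring `A⟦w⟧`. -/
def powerSeriesIncl (θ : IterDer n L) (S A : Type*) [CommRing S] [Algebra L S] [CommRing A]
    [Algebra L A] : MvPowerSeries (Fin n) A →+* Tens θ S A :=
  (Algebra.TensorProduct.includeRight : Tw θ A →ₐ[L] Tens θ S A).toRingHom

/-- The iterative derivation `θ_S ⊗ θ_w` on `S ⊗_L A⟦w⟧`. -/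
def thetaTens (θS : IterDer n S) (hS : Extends θ θS) (A : Type*) [CommRing A] [Algebra L A] :
    Tens θ S A →ₐ[L] Tw θ (Tens θ S A) :=
  Algebra.TensorProduct.lift
    { toRingHom := (((MvPowerSeries.map (algebraMap S (Tens θ S A))).comp θS.toHom :
        S →+* MvPowerSeries (Fin n) (Tens θ S A)) : S →+* Tw θ (Tens θ S A))
      commutes' := fun a => by
        change MvPowerSeries.map (algebraMap S (Tens θ S A)) (θS.toHom (algebraMap L S a)) =
          MvPowerSeries.map (algebraMap L (Tens θ S A)) (θ.toHom a)
        rw [hS]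
        ext k
        rw [MvPowerSeries.coeff_map, MvPowerSeries.coeff_map, MvPowerSeries.coeff_map]
        rfl }
    { toRingHom := (((MvPowerSeries.map (powerSeriesIncl θ S A)).comp hasse :
        MvPowerSeries (Fin n) A →+* MvPowerSeries (Fin n) (Tens θ S A)) :
          Tw θ A →+* Tw θ (Tens θ S A))
      commutes' := fun a => by
        change MvPowerSeries.map (powerSeriesIncl θ S A)
            (hasse (MvPowerSeries.map (algebraMap L A) (θ.toHom a))) =
          MvPowerSeries.map (algebraMap L (Tens θ S A)) (θ.toHom a)
        have key : ∀ k, MvPowerSeries.coeff k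
            (hasse (MvPowerSeries.map (algebraMap L A) (θ.toHom a))) =
            algebraMap L (Tw θ A) (MvPowerSeries.coeff k (θ.toHom a)) := fun k => by
          rw [Tw.algebraMap_eq]
          ext m
          rw [coeff_coeff_hasse, MvPowerSeries.coeff_map, MvPowerSeries.coeff_map, θ.iter,
            map_nsmul]
        ext k
        rw [MvPowerSeries.coeff_map, MvPowerSeries.coeff_map]
        refine (congrArg _ (key k)).trans ?_
        exact (Algebra.TensorProduct.includeRight : Tw θ A →ₐ[L] Tens θ S A).commutes _ }
    (fun _ _ => Commute.all _ _)

/-- The component `θ^(k)` on `S ⊗_L A⟦w⟧`. -/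
def thetaTensComp (θS : IterDer n S) (hS : Extends θ θS) (A : Type*) [CommRing A] [Algebra L A]
    (k : Fin n →₀ ℕ) : Tens θ S A →+ Tens θ S A :=
  (MvPowerSeries.coeff k : MvPowerSeries (Fin n) (Tens θ S A) →ₗ[Tens θ S A] _).toAddMonoidHom.comp
    (thetaTens θS hS A).toRingHom.toAddMonoidHom

theorem thetaTensComp_left (θS : IterDer n S) (hS : Extends θ θS) (k : Fin n →₀ ℕ) (s : S) :
    thetaTensComp θS hS A k (s ⊗ₜ 1) = θS.comp k s ⊗ₜ 1 := by
  have : thetaTens θS hS A (s ⊗ₜ 1) =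
      (MvPowerSeries.map (algebraMap S (Tens θ S A)) (θS.toHom s) :
        MvPowerSeries (Fin n) (Tens θ S A)) := by
    rw [thetaTens, Algebra.TensorProduct.lift_tmul, map_one, mul_one]
    rfl
  change MvPowerSeries.coeff k (thetaTens θS hS A (s ⊗ₜ 1) :
    MvPowerSeries (Fin n) (Tens θ S A)) = _
  rw [this, MvPowerSeries.coeff_map]
  rfl

/-- The component `θ_w^(k)` on `A⟦w⟧`. -/
def hasseComp (θ : IterDer n L) (A : Type*) [CommRing A] (k : Fin n →₀ ℕ) : Tw θ A →+ Tw θ A :=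
  ((MvPowerSeries.coeff k : MvPowerSeries (Fin n) (MvPowerSeries (Fin n) A) →ₗ[_] _
    ).toAddMonoidHom.comp (hasse (A := A)).toAddMonoidHom :
      MvPowerSeries (Fin n) A →+ MvPowerSeries (Fin n) A)

theorem hasseComp_map (g : A →ₐ[L] A') (k : Fin n →₀ ℕ) (b : Tw θ A) :
    Tw.map θ g (hasseComp θ A k b) = hasseComp θ A' k (Tw.map θ g b) :=
  map_coeff_hasse (g : A →+* A') b k

theorem thetaTensComp_right (θS : IterDer n S) (hS : Extends θ θS) (k : Fin n →₀ ℕ) (b : Tw θ A) :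
    thetaTensComp θS hS A k (1 ⊗ₜ b) = 1 ⊗ₜ hasseComp θ A k b := by
  have : thetaTens θS hS A (1 ⊗ₜ b) =
      (MvPowerSeries.map (powerSeriesIncl θ S A) (hasse (b : MvPowerSeries (Fin n) A)) :
        MvPowerSeries (Fin n) (Tens θ S A)) := by
    rw [thetaTens, Algebra.TensorProduct.lift_tmul, map_one, one_mul]
    rfl
  change MvPowerSeries.coeff k (thetaTens θS hS A (1 ⊗ₜ b) :
    MvPowerSeries (Fin n) (Tens θ S A)) = _
  rw [this]
  refine (MvPowerSeries.coeff_map _ _ _).trans ?_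
  rfl

theorem thetaTensComp_mul (θS : IterDer n S) (hS : Extends θ θS) (k : Fin n →₀ ℕ)
    (x y : Tens θ S A) : thetaTensComp θS hS A k (x * y) =
      ∑ p ∈ Finset.HasAntidiagonal.antidiagonal k,
        thetaTensComp θS hS A p.1 x * thetaTensComp θS hS A p.2 y := by
  have : thetaTens θS hS A (x * y) = (thetaTens θS hS A x * thetaTens θS hS A y) := map_mul _ _ _
  change MvPowerSeries.coeff k (thetaTens θS hS A (x * y) :
    MvPowerSeries (Fin n) (Tens θ S A)) = _
  rw [this]
  exact MvPowerSeries.coeff_mul _ _ _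

theorem thetaTensComp_mem (θS : IterDer n S) (hS : Extends θ θS) (m : ℕ) :
    ∀ (x : Tens θ S A), x ∈ wIdeal θ S A ^ m → ∀ k : Fin n →₀ ℕ,
      thetaTensComp θS hS A k x ∈ wIdeal θ S A ^ (m - k.degree) := by
  have mulmem : ∀ (a b : ℕ) (x y : Tens θ S A),
      (∀ k : Fin n →₀ ℕ, thetaTensComp θS hS A k x ∈ wIdeal θ S A ^ (a - k.degree)) →
      (∀ k : Fin n →₀ ℕ, thetaTensComp θS hS A k y ∈ wIdeal θ S A ^ (b - k.degree)) →
      ∀ k : Fin n →₀ ℕ, thetaTensComp θS hS A k (x * y) ∈ wIdeal θ S A ^ (a + b - k.degree) := by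
    intro a b x y hx hy k
    rw [thetaTensComp_mul]
    refine sum_mem fun p hp => ?_
    rw [Finset.HasAntidiagonal.mem_antidiagonal] at hp
    have hd : k.degree = p.1.degree + p.2.degree := by rw [← hp, map_add]
    have := Ideal.mul_mem_mul (hx p.1) (hy p.2)
    rw [← pow_add] at this
    exact Ideal.pow_le_pow_right (by omega) this
  have one : ∀ x ∈ wIdeal θ S A, ∀ k : Fin n →₀ ℕ,
      thetaTensComp θS hS A k x ∈ wIdeal θ S A ^ (1 - k.degree) := by
    intro x hx
    refine Submodule.span_induction
      (p := fun x _ => ∀ k : Fin n →₀ ℕ,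
        thetaTensComp θS hS A k x ∈ wIdeal θ S A ^ (1 - k.degree)) ?_ ?_ ?_ ?_ hx
    · rintro _ ⟨b, hb, rfl⟩ k
      change thetaTensComp θS hS A k (1 ⊗ₜ b) ∈ _
      rw [thetaTensComp_right]
      by_cases hk : k = 0
      · subst hk
        have : hasseComp θ A 0 b = b := coeff_zero_hasse b
        rw [this, map_zero, Nat.sub_zero, pow_one]
        exact tmul_mem_wIdeal θ S A hb
      · have : 1 - k.degree = 0 := by
          have : k.degree ≠ 0 := by rwa [Ne, Finsupp.degree_eq_zero_iff]
          omega
        rw [this, pow_zero, Ideal.one_eq_top]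
        trivial
    · intro k
      rw [map_zero]
      exact zero_mem _
    · intro x y _ _ hx hy k
      rw [map_add]
      exact add_mem (hx k) (hy k)
    · intro a x _ hx k
      have := mulmem 0 1 a x (fun k => by
        rw [Nat.zero_sub, pow_zero, Ideal.one_eq_top]
        trivial) hx k
      rwa [zero_add] at this
  induction m with
  | zero =>
    intro x _ k
    rw [Nat.zero_sub, pow_zero, Ideal.one_eq_top]
    trivial
  | succ m ih =>
    intro x hx
    rw [pow_succ] at hx
    refine Submodule.mul_induction_on hx ?_ ?_
    · intro a ha b hb k
      exact mulmem m 1 a b (ih a ha) (one b hb) k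
    · intro x y hx hy k
      rw [map_add]
      exact add_mem (hx k) (hy k)

/-- The continuous extension of `θ^(k)` to `S ⊗̂_L A⟦w⟧`. -/
def thetaC (θS : IterDer n S) (hS : Extends θ θS) (A : Type*) [CommRing A] [Algebra L A]
    (k : Fin n →₀ ℕ) : CTens θ S A →+ CTens θ S A :=
  extendAdd k.degree (thetaTensComp θS hS A k) (fun m x hx => by
    have := thetaTensComp_mem θS hS (m + k.degree) x hx k
    rwa [Nat.add_sub_cancel] at this)

theorem thetaC_ofTens (θS : IterDer n S) (hS : Extends θ θS) (k : Fin n →₀ ℕ) (t : Tens θ S A) :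
    thetaC θS hS A k (ofTens θ S A t) = ofTens θ S A (thetaTensComp θS hS A k t) :=
  extendAdd_of _ _ _ _

theorem thetaC_inS (θS : IterDer n S) (hS : Extends θ θS) (k : Fin n →₀ ℕ) (s : S) :
    thetaC θS hS A k (inS θ S A s) = inS θ S A (θS.comp k s) :=
  (thetaC_ofTens θS hS k _).trans (congrArg _ (thetaTensComp_left θS hS k s))

theorem thetaC_inW (θS : IterDer n S) (hS : Extends θ θS) (k : Fin n →₀ ℕ) (b : Tw θ A) :
    thetaC θS hS A k (inW θ S A b) = inW θ S A (hasseComp θ A k b) :=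
  (thetaC_ofTens θS hS k _).trans (congrArg _ (thetaTensComp_right θS hS k b))

theorem thetaC_cont (θS : IterDer n S) (hS : Extends θ θS) (k : Fin n →₀ ℕ) (m : ℕ)
    (x : CTens θ S A) (hx : AdicCompletion.evalₐ (wIdeal θ S A) (m + k.degree) x = 0) :
    AdicCompletion.evalₐ (wIdeal θ S A) m (thetaC θS hS A k x) = 0 :=
  extendAdd_cont _ _ _ _ _ hx

theorem evalₐ_mono {m m' : ℕ} (h : m ≤ m') {x : CTens θ S A}
    (hx : AdicCompletion.evalₐ (wIdeal θ S A) m' x = 0) :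
    AdicCompletion.evalₐ (wIdeal θ S A) m x = 0 := by
  rw [← factorPow_evalₐ h, hx, map_zero]

theorem thetaC_mul (θS : IterDer n S) (hS : Extends θ θS) (k : Fin n →₀ ℕ) (x : CTens θ S A)
    (b : Tw θ A) : thetaC θS hS A k (x * inW θ S A b) =
      ∑ p ∈ Finset.HasAntidiagonal.antidiagonal k,
        thetaC θS hS A p.1 x * inW θ S A (hasseComp θ A p.2 b) := by
  have := eq_of_eq_on_of k.degree
    ((thetaC θS hS A k).comp (AddMonoidHom.mulRight (inW θ S A b)))
    (∑ p ∈ Finset.HasAntidiagonal.antidiagonal k,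
      (AddMonoidHom.mulRight (inW θ S A (hasseComp θ A p.2 b))).comp (thetaC θS hS A p.1))
    (fun m x hx => thetaC_cont θS hS k m _ (mul_cont 0 _ (m + k.degree) x hx))
    (fun m x hx => by
      rw [AddMonoidHom.finsetSum_apply, map_sum]
      refine Finset.sum_eq_zero fun p hp => ?_
      rw [Finset.HasAntidiagonal.mem_antidiagonal] at hp
      have hd : k.degree = p.1.degree + p.2.degree := by rw [← hp, map_add]
      exact mul_cont 0 _ m _ (thetaC_cont θS hS p.1 (m + 0) x (evalₐ_mono (by omega) hx)))
    (fun t => by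
      rw [AddMonoidHom.finsetSum_apply]
      change thetaC θS hS A k (ofTens θ S A t * ofTens θ S A (1 ⊗ₜ b)) =
        ∑ p ∈ Finset.HasAntidiagonal.antidiagonal k, thetaC θS hS A p.1 (ofTens θ S A t) *
          ofTens θ S A (1 ⊗ₜ hasseComp θ A p.2 b)
      rw [← map_mul, thetaC_ofTens, thetaTensComp_mul, map_sum]
      refine Finset.sum_congr rfl fun p _ => ?_
      rw [map_mul, thetaC_ofTens, thetaTensComp_right])
  have h := DFunLike.congr_fun this x
  rw [AddMonoidHom.finsetSum_apply] at h
  exact h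

theorem thetaC_mapC (θS : IterDer n S) (hS : Extends θ θS) (k : Fin n →₀ ℕ) (g : A →ₐ[L] A')
    (x : CTens θ S A) : thetaC θS hS A' k (mapC θ (AlgHom.id L S) g x) =
      mapC θ (AlgHom.id L S) g (thetaC θS hS A k x) := by
  have := addHom_ext k.degree
    ((thetaC θS hS A' k).comp (mapC θ (AlgHom.id L S) g).toAddMonoidHom)
    ((mapC θ (AlgHom.id L S) g).toAddMonoidHom.comp (thetaC θS hS A k))
    (fun m x hx => thetaC_cont θS hS k m _ (mapC_cont _ _ _ _ hx))
    (fun m x hx => mapC_cont _ _ _ _ (thetaC_cont θS hS k m x hx))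
    (fun s b => by
      change thetaC θS hS A' k (mapC θ (AlgHom.id L S) g _) =
        mapC θ (AlgHom.id L S) g (thetaC θS hS A k _)
      rw [thetaC_mul, map_mul, mapC_inS, mapC_inW, thetaC_mul, map_sum]
      refine Finset.sum_congr rfl fun p _ => ?_
      rw [map_mul, thetaC_inS, thetaC_inS, mapC_inS, mapC_inW, hasseComp_map]
      rfl)
  exact DFunLike.congr_fun this x

end Operators

section Ume

universe uL uS v

variable {n : ℕ} {L : Type*} [CommRing L] {θ : IterDer n L}
  {S : Type*} [CommRing S] [Algebra L S] {θS : IterDer n S} (hS : Extends θ θS)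
  {Δ : Type*} (T : Δ → S →ₗ[L] S)
  {S₀ : Type*} [CommRing S₀] [Algebra L S₀] (i : S₀ →ₐ[L] S)

/-- The conditions on an automorphism `φ` of the ring `S ⊗̂_L A⟦w⟧` to belong to the group `Ume(A)`:
it commutes with the operators `T d ⊗̂ id` and with the iterative derivation `θ_S ⊗̂ θ_w`, it fixes
all elements of the image of `S₀ ⊗̂_L A⟦w⟧`, and it induces the identity modulo the nilradical
of `A`. -/
structure IsUmeAut (A : Type*) [CommRing A] [Algebra L A] (φ : CTens θ S A ≃+* CTens θ S A) :
    Prop where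
  op : ∀ d x, φ (opC θ A (T d) x) = opC θ A (T d) (φ x)
  theta : ∀ k x, φ (thetaC θS hS A k x) = thetaC θS hS A k (φ x)
  fix : ∀ y : CTens θ S₀ A, φ (mapC θ i (AlgHom.id L A) y) = mapC θ i (AlgHom.id L A) y
  red : ∀ x, mapC θ (AlgHom.id L S) (Ideal.Quotient.mkₐ L (nilradical A)) (φ x) =
    mapC θ (AlgHom.id L S) (Ideal.Quotient.mkₐ L (nilradical A)) x

/-- The group of automorphisms of `S ⊗̂_L A⟦w⟧` satisfying `IsUmeAut`. -/
def umeGroup (A : Type*) [CommRing A] [Algebra L A] : Subgroup (RingAut (CTens θ S A)) where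
  carrier := {φ | IsUmeAut hS T i A φ}
  one_mem' := ⟨fun _ _ => rfl, fun _ _ => rfl, fun _ => rfl, fun _ => rfl⟩
  mul_mem' {φ ψ} hφ hψ := by
    refine ⟨fun d x => ?_, fun k x => ?_, fun y => ?_, fun x => ?_⟩
    · rw [RingAut.mul_apply, RingAut.mul_apply, hψ.op, hφ.op]
    · rw [RingAut.mul_apply, RingAut.mul_apply, hψ.theta, hφ.theta]
    · rw [RingAut.mul_apply, hψ.fix, hφ.fix]
    · rw [RingAut.mul_apply, hφ.red, hψ.red]
  inv_mem' {φ} hφ := by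
    have h1 : ∀ x, φ (φ⁻¹ x) = x := fun x => RingEquiv.apply_symm_apply φ x
    have h2 : ∀ x, φ⁻¹ (φ x) = x := fun x => RingEquiv.symm_apply_apply φ x
    refine ⟨fun d x => ?_, fun k x => ?_, fun y => ?_, fun x => ?_⟩
    · apply φ.injective
      rw [h1, hφ.op, h1]
    · apply φ.injective
      rw [h1, hφ.theta, h1]
    · apply φ.injective
      rw [h1, hφ.fix]
    · rw [← hφ.red, h1]

variable {hS T i}

theorem isUme {A : Type*} [CommRing A] [Algebra L A] (φ : umeGroup hS T i A) :
    IsUmeAut hS T i A φ.1 := φ.2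

variable {A : Type*} [CommRing A] [Algebra L A] {B : Type*} [CommRing B] [Algebra L B]
  {E : Type*} [CommRing E] [Algebra L E]

theorem map_id (b : Tw θ A) : Tw.map θ (AlgHom.id L A) b = b := by
  refine MvPowerSeries.ext fun k => ?_
  exact MvPowerSeries.coeff_map _ _ _

theorem IsUmeAut.fixW {φ : CTens θ S A ≃+* CTens θ S A} (hφ : IsUmeAut hS T i A φ) (b : Tw θ A) :
    φ (inW θ S A b) = inW θ S A b := by
  have := hφ.fix (inW θ S₀ A b)
  rwa [mapC_inW, map_id] at this

theorem IsUmeAut.fixS {φ : CTens θ S A ≃+* CTens θ S A} (hφ : IsUmeAut hS T i A φ) (s : S₀) :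
    φ (inS θ S A (i s)) = inS θ S A (i s) := by
  have := hφ.fix (inS θ S₀ A s)
  rwa [mapC_inS] at this

theorem map_comp (l : A →ₐ[L] B) (l' : B →ₐ[L] E) (b : Tw θ A) :
    Tw.map θ l' (Tw.map θ l b) = Tw.map θ (l'.comp l) b := by
  refine MvPowerSeries.ext fun k => ?_
  exact (MvPowerSeries.coeff_map _ _ _).trans
    ((congrArg l' (MvPowerSeries.coeff_map _ _ _)).trans
      (MvPowerSeries.coeff_map (l'.comp l : A →+* E) k b).symm)

theorem mapC_comp (l : A →ₐ[L] B) (l' : B →ₐ[L] E) (x : CTens θ S A) :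
    mapC θ (AlgHom.id L S) l' (mapC θ (AlgHom.id L S) l x) =
      mapC θ (AlgHom.id L S) (l'.comp l) x := by
  have := ringHom_ext ((mapC θ (AlgHom.id L S) l').comp (mapC θ (AlgHom.id L S) l))
    (mapC θ (AlgHom.id L S) (l'.comp l))
    (fun b hb => by
      rw [RingHom.comp_apply, mapC_inW, mapC_inW]
      exact inW_mem θ S E (Tw.map_mem θ _ _ (Tw.map_mem θ _ _ hb)))
    (fun s => by rw [RingHom.comp_apply, mapC_inS, mapC_inS, mapC_inS]; rfl)
    (fun b => by rw [RingHom.comp_apply, mapC_inW, mapC_inW, mapC_inW, map_comp])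
  exact DFunLike.congr_fun this x

theorem mapC_id (x : CTens θ S A) : mapC θ (AlgHom.id L S) (AlgHom.id L A) x = x := by
  have := ringHom_ext (mapC θ (AlgHom.id L S) (AlgHom.id L A)) (RingHom.id (CTens θ S A))
    (fun b hb => by
      rw [mapC_inW, map_id]
      exact inW_mem θ S A hb)
    (fun s => by rw [mapC_inS]; rfl)
    (fun b => by rw [mapC_inW, map_id]; rfl)
  exact DFunLike.congr_fun this x

/-- A ring endomorphism of `S ⊗̂_L B⟦w⟧` over `B⟦w⟧` is determined by its restriction to
`S ⊗̂_L A⟦w⟧`. -/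
theorem baseChange_unique (l : A →ₐ[L] B) (f g : CTens θ S B →+* CTens θ S B)
    (hf : ∀ b, f (inW θ S B b) = inW θ S B b) (hg : ∀ b, g (inW θ S B b) = inW θ S B b)
    (h : ∀ x, f (mapC θ (AlgHom.id L S) l x) = g (mapC θ (AlgHom.id L S) l x)) : f = g :=
  ringHom_ext f g (fun b hb => by rw [hf]; exact inW_mem θ S B hb)
    (fun s => by
      have := h (inS θ S A s)
      rwa [mapC_inS] at this)
    (fun b => (hf b).trans (hg b).symm)

/-- The homomorphism `φ ⊗̂_{A⟦w⟧} id_{B⟦w⟧}`: on `s ⊗ 1` it is given by `φ`, and it fixes `1 ⊗ b`. -/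
def baseChangeHom (l : A →ₐ[L] B) (φ : CTens θ S A ≃+* CTens θ S A) (hφ : IsUmeAut hS T i A φ) :
    CTens θ S B →+* CTens θ S B :=
  liftC
    { toRingHom := (mapC θ (AlgHom.id L S) l).comp (φ.toRingHom.comp (inS θ S A).toRingHom)
      commutes' := fun a => by
        change mapC θ (AlgHom.id L S) l (φ (inS θ S A (algebraMap L S a))) = _
        rw [AlgHom.commutes, ← (inW θ S A).commutes, hφ.fixW, mapC_inW, AlgHom.commutes,
          AlgHom.commutes] }
    (AlgHom.id L B)

theorem baseChangeHom_inS (l : A →ₐ[L] B) (φ : CTens θ S A ≃+* CTens θ S A)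
    (hφ : IsUmeAut hS T i A φ) (s : S) :
    baseChangeHom l φ hφ (inS θ S B s) = mapC θ (AlgHom.id L S) l (φ (inS θ S A s)) :=
  liftC_inS _ _ _

theorem baseChangeHom_inW (l : A →ₐ[L] B) (φ : CTens θ S A ≃+* CTens θ S A)
    (hφ : IsUmeAut hS T i A φ) (b : Tw θ B) :
    baseChangeHom l φ hφ (inW θ S B b) = inW θ S B b := by
  refine (liftC_inW _ _ _).trans ?_
  rw [map_id]

theorem baseChangeHom_mapC (l : A →ₐ[L] B) (φ : CTens θ S A ≃+* CTens θ S A)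
    (hφ : IsUmeAut hS T i A φ) (x : CTens θ S A) :
    baseChangeHom l φ hφ (mapC θ (AlgHom.id L S) l x) = mapC θ (AlgHom.id L S) l (φ x) := by
  have := ringHom_ext ((baseChangeHom l φ hφ).comp (mapC θ (AlgHom.id L S) l))
    ((mapC θ (AlgHom.id L S) l).comp φ.toRingHom)
    (fun b hb => by
      rw [RingHom.comp_apply, mapC_inW, baseChangeHom_inW]
      exact inW_mem θ S B (Tw.map_mem θ _ _ hb))
    (fun s => by
      rw [RingHom.comp_apply, mapC_inS]
      exact baseChangeHom_inS l φ hφ s)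
    (fun b => by
      rw [RingHom.comp_apply, mapC_inW, baseChangeHom_inW]
      change _ = mapC θ (AlgHom.id L S) l (φ (inW θ S A b))
      rw [hφ.fixW, mapC_inW])
  exact DFunLike.congr_fun this x

theorem baseChangeHom_inv (l : A →ₐ[L] B) (φ ψ : CTens θ S A ≃+* CTens θ S A)
    (hφ : IsUmeAut hS T i A φ) (hψ : IsUmeAut hS T i A ψ) (h : ∀ x, φ (ψ x) = x) :
    (baseChangeHom l φ hφ).comp (baseChangeHom l ψ hψ) = RingHom.id _ :=
  baseChange_unique l _ _
    (fun b => by rw [RingHom.comp_apply, baseChangeHom_inW, baseChangeHom_inW])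
    (fun b => rfl)
    (fun x => by rw [RingHom.comp_apply, baseChangeHom_mapC, baseChangeHom_mapC, h]; rfl)

/-- The automorphism `φ ⊗̂_{A⟦w⟧} id_{B⟦w⟧}`. -/
def baseChangeAut (l : A →ₐ[L] B) (φ : umeGroup hS T i A) : RingAut (CTens θ S B) :=
  RingEquiv.ofRingHom (baseChangeHom l φ.1 (isUme φ)) (baseChangeHom l (φ⁻¹).1 (isUme φ⁻¹))
    (baseChangeHom_inv l _ _ _ _ fun x => RingEquiv.apply_symm_apply φ.1 x)
    (baseChangeHom_inv l _ _ _ _ fun x => RingEquiv.symm_apply_apply φ.1 x)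

theorem baseChangeAut_apply (l : A →ₐ[L] B) (φ : umeGroup hS T i A) (x : CTens θ S B) :
    baseChangeAut l φ x = baseChangeHom l φ.1 (isUme φ) x := rfl

theorem isUmeAut_baseChangeAut (l : A →ₐ[L] B) (φ : umeGroup hS T i A) :
    IsUmeAut hS T i B (baseChangeAut l φ) := by
  have hφ : IsUmeAut hS T i A φ.1 := isUme φ
  set f := baseChangeHom l φ.1 (isUme φ) with hf
  have fcont := cont_of_inW f (fun b hb => by
    rw [hf, baseChangeHom_inW]
    exact inW_mem θ S B hb)
  have fS : ∀ s, f (inS θ S B s) = mapC θ (AlgHom.id L S) l (φ.1 (inS θ S A s)) :=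
    baseChangeHom_inS l φ.1 (isUme φ)
  have fW : ∀ b, f (inW θ S B b) = inW θ S B b := baseChangeHom_inW l φ.1 (isUme φ)
  refine ⟨fun d x => ?_, fun k x => ?_, fun y => ?_, fun x => ?_⟩
  · have := addHom_ext 0 (f.toAddMonoidHom.comp (opC θ B (T d)))
      ((opC θ B (T d)).comp f.toAddMonoidHom)
      (fun m x hx => fcont m _ (opC_cont (T d) m x hx))
      (fun m x hx => opC_cont (T d) m _ (fcont (m + 0) x hx))
      (fun s b => by
        change f (opC θ B (T d) _) = opC θ B (T d) (f _)
        rw [opC_mul, opC_inS, map_mul, map_mul, fW, opC_mul, fS, fS, opC_mapC, ← hφ.op, opC_inS])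
    exact DFunLike.congr_fun this x
  · have := addHom_ext k.degree (f.toAddMonoidHom.comp (thetaC θS hS B k))
      ((thetaC θS hS B k).comp f.toAddMonoidHom)
      (fun m x hx => fcont m _ (thetaC_cont θS hS k m x hx))
      (fun m x hx => thetaC_cont θS hS k m _ (fcont (m + k.degree) x hx))
      (fun s b => by
        change f (thetaC θS hS B k _) = thetaC θS hS B k (f _)
        rw [thetaC_mul, map_sum, map_mul, fW, thetaC_mul]
        refine Finset.sum_congr rfl fun p _ => ?_
        rw [map_mul, fW, thetaC_inS, fS, fS, thetaC_mapC, ← hφ.theta, thetaC_inS])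
    exact DFunLike.congr_fun this x
  · have := ringHom_ext (f.comp (mapC θ i (AlgHom.id L B))) (mapC θ i (AlgHom.id L B))
      (fun b hb => by
        rw [RingHom.comp_apply, mapC_inW, fW]
        exact inW_mem θ S B (Tw.map_mem θ _ _ hb))
      (fun s => by rw [RingHom.comp_apply, mapC_inS, fS, hφ.fixS, mapC_inS]; rfl)
      (fun b => by rw [RingHom.comp_apply, mapC_inW, fW])
    exact DFunLike.congr_fun this y
  · let lb : (A ⧸ nilradical A) →ₐ[L] (B ⧸ nilradical B) :=
      Ideal.Quotient.liftₐ (nilradical A) ((Ideal.Quotient.mkₐ L (nilradical B)).comp l)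
        (fun a ha => Ideal.Quotient.eq_zero_iff_mem.2
          (mem_nilradical.2 ((mem_nilradical.1 ha).map l)))
    have hlb : lb.comp (Ideal.Quotient.mkₐ L (nilradical A)) =
        (Ideal.Quotient.mkₐ L (nilradical B)).comp l := AlgHom.ext fun a => rfl
    have := ringHom_ext
      ((mapC θ (AlgHom.id L S) (Ideal.Quotient.mkₐ L (nilradical B))).comp f)
      (mapC θ (AlgHom.id L S) (Ideal.Quotient.mkₐ L (nilradical B)))
      (fun b hb => by
        rw [RingHom.comp_apply, fW, mapC_inW]
        exact inW_mem θ S _ (Tw.map_mem θ _ _ hb))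
      (fun s => by
        rw [RingHom.comp_apply, fS, mapC_comp, ← hlb, ← mapC_comp, hφ.red, mapC_inS, mapC_inS,
          mapC_inS]
        rfl)
      (fun b => by rw [RingHom.comp_apply, fW])
    exact DFunLike.congr_fun this x

/-- The map `Ume(A) → Ume(B)`, `φ ↦ φ ⊗̂_{A⟦w⟧} id_{B⟦w⟧}`. -/
def umeMap (l : A →ₐ[L] B) : umeGroup hS T i A →* umeGroup hS T i B :=
  MonoidHom.mk' (fun φ => ⟨baseChangeAut l φ, isUmeAut_baseChangeAut l φ⟩) (fun φ ψ => by
    refine Subtype.ext (RingEquiv.ext fun x => ?_)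
    have := baseChange_unique l (baseChangeHom l (φ * ψ).1 (isUme (φ * ψ)))
      ((baseChangeHom l φ.1 (isUme φ)).comp (baseChangeHom l ψ.1 (isUme ψ)))
      (fun b => baseChangeHom_inW l _ _ b)
      (fun b => by rw [RingHom.comp_apply, baseChangeHom_inW, baseChangeHom_inW])
      (fun x => by
        rw [RingHom.comp_apply, baseChangeHom_mapC, baseChangeHom_mapC, baseChangeHom_mapC]
        rfl)
    exact DFunLike.congr_fun this x)

theorem umeMap_id (φ : umeGroup hS T i A) : umeMap (AlgHom.id L A) φ = φ := by
  refine Subtype.ext (RingEquiv.ext fun x => ?_)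
  have := baseChange_unique (AlgHom.id L A) (baseChangeHom (AlgHom.id L A) φ.1 (isUme φ))
    φ.1.toRingHom (fun b => baseChangeHom_inW _ _ _ b) (fun b => IsUmeAut.fixW (isUme φ) b)
    (fun x => by
      rw [baseChangeHom_mapC, mapC_id, mapC_id]
      rfl)
  exact DFunLike.congr_fun this x

theorem umeMap_comp (l : A →ₐ[L] B) (l' : B →ₐ[L] E) (φ : umeGroup hS T i A) :
    umeMap (l'.comp l) φ = umeMap l' (umeMap l φ) := by
  refine Subtype.ext (RingEquiv.ext fun x => ?_)
  have := baseChange_unique (l'.comp l) (baseChangeHom (l'.comp l) φ.1 (isUme φ))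
    (baseChangeHom l' (umeMap l φ).1 (isUme (umeMap l φ)))
    (fun b => baseChangeHom_inW _ _ _ b) (fun b => baseChangeHom_inW _ _ _ b)
    (fun x => by
      rw [baseChangeHom_mapC, ← mapC_comp, ← mapC_comp, baseChangeHom_mapC]
      congr 1
      exact (baseChangeHom_mapC l φ.1 (isUme φ) x).symm)
  exact DFunLike.congr_fun this x

variable (hS T i)

open CategoryTheory in
/-- The group functor `A ↦ Ume(A)` on commutative `L`-algebras. -/
def umeFunctor {n : ℕ} {L : Type uL} [CommRing L] {θ : IterDer n L}
    {S : Type uS} [CommRing S] [Algebra L S] {θS : IterDer n S} (hS : Extends θ θS)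
    {Δ : Type*} (T : Δ → S →ₗ[L] S) {S₀ : Type*} [CommRing S₀] [Algebra L S₀] (i : S₀ →ₐ[L] S) :
    CommAlgCat.{v} L ⥤ GrpCat.{max uS v} where
  obj A := GrpCat.of (umeGroup hS T i A)
  map l := GrpCat.ofHom (umeMap l.hom)
  map_id A := by
    refine GrpCat.hom_ext (MonoidHom.ext fun φ => ?_)
    exact umeMap_id φ
  map_comp l l' := by
    refine GrpCat.hom_ext (MonoidHom.ext fun φ => ?_)
    exact umeMap_comp l.hom l'.hom φ

end Ume

/-! ### The smash product `D¹ # C G` -/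

section Smash

variable (C G D1 : Type*) [Field C] [Monoid G] [Ring D1] [Bialgebra C D1]
  [MulSemiringAction G D1] [SMulCommClass G C D1]

/-- The monoid `G` acts on the bialgebra `D1` by coalgebra endomorphisms. Together with
`MulSemiringAction G D1` and `SMulCommClass G C D1` this says that `D1` is a `C G`-module bialgebra. -/
class IsCoalgAction : Prop where
  counit_smul : ∀ (g : G) (d : D1), Coalgebra.counit (R := C) (g • d) = Coalgebra.counit (R := C) d
  comul_smul : ∀ (g : G) (d : D1), Coalgebra.comul (R := C) (g • d) =
    TensorProduct.map (DistribSMul.toLinearMap C D1 g) (DistribSMul.toLinearMap C D1 g)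
      (Coalgebra.comul d)

/-- The smash product `D1 # C G`: the free left `D1`-module on `G`, with `d # g = single g d` and
multiplication `(d # g) (e # h) = d (g • e) # g h`. -/
abbrev Smash : Type _ := SkewMonoidAlgebra D1 G

end Smash

namespace Smash

open SkewMonoidAlgebra LinearMap Coalgebra

section Coalg

variable {C G D1 : Type*} [Field C] [Ring D1] [Bialgebra C D1]

instance instCoalgebraStruct : CoalgebraStruct C (Smash G D1) where
  comul := (Finsupp.lsum C fun g => TensorProduct.map (lsingle C g) (lsingle C g) ∘ₗ comul) ∘ₗ
    (SkewMonoidAlgebra.coeffLinearEquiv : Smash G D1 ≃ₗ[C] (G →₀ D1)).toLinearMap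
  counit := (Finsupp.lsum C fun _ => counit) ∘ₗ (SkewMonoidAlgebra.coeffLinearEquiv : Smash G D1 ≃ₗ[C] (G →₀ D1)).toLinearMap

theorem comul_single (g : G) (d : D1) : comul (R := C) (single g d : Smash G D1) =
    TensorProduct.map (lsingle C g) (lsingle C g) (comul d) :=
  Finsupp.lsum_single C _ _ _

theorem counit_single (g : G) (d : D1) :
    counit (R := C) (single g d : Smash G D1) = counit (R := C) d :=
  Finsupp.lsum_single C _ _ _

theorem comul_comp_lsingle (g : G) :
    comul ∘ₗ (lsingle C g : D1 →ₗ[C] Smash G D1) =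
      TensorProduct.map (lsingle C g) (lsingle C g) ∘ₗ comul :=
  LinearMap.ext fun d => comul_single g d

theorem counit_comp_lsingle (g : G) :
    counit ∘ₗ (lsingle C g : D1 →ₗ[C] Smash G D1) = counit :=
  LinearMap.ext fun d => counit_single g d

instance instCoalgebra : Coalgebra C (Smash G D1) where
  rTensor_counit_comp_comul := by
    refine lhom_ext' fun g => ?_
    rw [comp_assoc, comul_comp_lsingle, ← comp_assoc, rTensor_comp_map, counit_comp_lsingle,
      ← lTensor_comp_rTensor, comp_assoc, rTensor_counit_comp_comul, lTensor_comp_mk]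
  lTensor_counit_comp_comul := by
    refine lhom_ext' fun g => ?_
    rw [comp_assoc, comul_comp_lsingle, ← comp_assoc, lTensor_comp_map, counit_comp_lsingle,
      ← rTensor_comp_lTensor, comp_assoc, lTensor_counit_comp_comul, rTensor_comp_flip_mk]
  coassoc := by
    refine lhom_ext' fun i => ?_
    simp_rw [comp_assoc, comul_comp_lsingle, ← comp_assoc, lTensor_comp_map, comul_comp_lsingle,
      comp_assoc, ← comp_assoc comul, rTensor_comp_map, comul_comp_lsingle, ← map_comp_rTensor,
      ← map_comp_lTensor, comp_assoc, ← coassoc, ← comp_assoc comul, ← comp_assoc,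
        TensorProduct.map_map_comp_assoc_eq]

instance [IsCocomm C D1] : IsCocomm C (Smash G D1) where
  comm_comp_comul := by
    refine lhom_ext fun g d => ?_
    change TensorProduct.comm C _ _ (comul (single g d)) = comul (single g d)
    rw [comul_single, ← TensorProduct.map_comm, comm_comul]

end Coalg

variable {C G D1 : Type*} [Field C] [Monoid G] [Ring D1] [Bialgebra C D1]
  [MulSemiringAction G D1] [SMulCommClass G C D1]

instance instBialgebra [IsCoalgAction C G D1] : Bialgebra C (Smash G D1) :=
  Bialgebra.mk' C (Smash G D1)
    (by rw [one_def]; exact (counit_single _ _).trans Bialgebra.counit_one)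
    (by
      intro a b
      have : (LinearMap.mul C (Smash G D1)).compr₂ counit =
          (LinearMap.mul C C).compl₁₂ counit (counit (A := Smash G D1)) := by
        refine lhom_ext fun g d => lhom_ext fun h e => ?_
        change counit (R := C) (single g d * single h e : Smash G D1) =
          counit (single g d) * counit (single h e)
        rw [single_mul_single, counit_single, counit_single, counit_single, Bialgebra.counit_mul,
          IsCoalgAction.counit_smul]
      exact LinearMap.congr_fun₂ this a b)
    (by
      rw [one_def]
      refine (comul_single _ _).trans ?_
      rw [Bialgebra.comul_one, Algebra.TensorProduct.one_def]
      rfl)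
    (by
      intro a b
      have : (LinearMap.mul C (Smash G D1)).compr₂ comul =
          (LinearMap.mul C (Smash G D1 ⊗[C] Smash G D1)).compl₁₂ comul
            (comul (A := Smash G D1)) := by
        refine lhom_ext fun g d => lhom_ext fun h e => ?_
        change comul (R := C) (single g d * single h e : Smash G D1) =
          comul (single g d) * comul (single h e)
        rw [single_mul_single, comul_single, comul_single, comul_single, Bialgebra.comul_mul,
          IsCoalgAction.comul_smul]
        rw [← (Coalgebra.Repr.arbitrary C d).eq, ← (Coalgebra.Repr.arbitrary C e).eq]
        simp only [_root_.map_sum, TensorProduct.map_tmul, Finset.sum_mul_sum,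
          Algebra.TensorProduct.tmul_mul_tmul, lsingle_apply, single_mul_single]
        rfl
      exact LinearMap.congr_fun₂ this a b)

end Smash

section BirkhoffWitt

universe u

open Classical in
/-- The `C`-coalgebra `D1` is isomorphic to the cofree pointed irreducible cocommutative coalgebra
`B(U)` on a vector space `U`: for a basis of `U` indexed by `ι`, the coalgebra `B(U)` has a basis
`(b α)` of divided power monomials indexed by the multi-indices `α : ι →₀ ℕ`, with
`Δ (b α) = ∑ b β ⊗ b γ`, the sum being over all `β + γ = α`, and `ε (b α) = δ_{α, 0}`. -/
def IsBirkhoffWitt (C : Type*) (D1 : Type u) [Field C] [AddCommGroup D1] [Module C D1]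
    [Coalgebra C D1] : Prop :=
  ∃ (ι : Type u) (b : Module.Basis (ι →₀ ℕ) C D1),
    (∀ α, Coalgebra.comul (R := C) (b α) =
      ∑ p ∈ Finset.HasAntidiagonal.antidiagonal α, b p.1 ⊗ₜ[C] b p.2) ∧
    ∀ α, Coalgebra.counit (R := C) (b α) = if α = 0 then 1 else 0

end BirkhoffWitt

/-! ### Module algebras -/

section ModuleAlgebra

/-- A `D`-module algebra structure on the commutative `C`-algebra `R`, for a `C`-bialgebra `D`: an
action of the algebra `D` on the `C`-module `R` with `d (a b) = ∑ (d₁ a) (d₂ b)` and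
`d 1 = ε(d)`. -/
structure ModuleAlgebra (C D R : Type*) [Field C] [Ring D] [Bialgebra C D] [CommRing R]
    [Algebra C R] where
  act : D →ₐ[C] Module.End C R
  act_mul : ∀ (d : D) (a b : R), act d (a * b) =
    LinearMap.mul' C R (TensorProduct.map ((LinearMap.applyₗ a).comp act.toLinearMap)
      ((LinearMap.applyₗ b).comp act.toLinearMap) (Coalgebra.comul d))
  act_one : ∀ d : D, act d 1 = algebraMap C R (Coalgebra.counit d)

variable {C D R : Type*} [Field C] [Ring D] [Bialgebra C D] [CommRing R] [Algebra C R]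

/-- A simple module algebra: it is nonzero and has no `D`-stable ideals except `0` and itself. -/
def ModuleAlgebra.IsSimple (Ψ : ModuleAlgebra C D R) : Prop :=
  Nontrivial R ∧ ∀ I : Ideal R, (∀ d, ∀ a ∈ I, Ψ.act d a ∈ I) → I = ⊥ ∨ I = ⊤

/-- The subalgebra `K` is stable under the action of `D`. -/
def ModuleAlgebra.IsStable (Ψ : ModuleAlgebra C D R) (K : Subalgebra C R) : Prop :=
  ∀ d, ∀ a ∈ K, Ψ.act d a ∈ K

/-- The module algebra structure on a `D`-stable subalgebra. -/
def ModuleAlgebra.restrict (Ψ : ModuleAlgebra C D R) (K : Subalgebra C R) (hK : Ψ.IsStable K) :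
    ModuleAlgebra C D K where
  act := AlgHom.ofLinearMap
    { toFun := fun d => (Ψ.act d).restrict (p := K.toSubmodule) (q := K.toSubmodule) (hK d)
      map_add' := fun d e => LinearMap.ext fun a => Subtype.ext (by
        change Ψ.act (d + e) a = Ψ.act d a + Ψ.act e a
        rw [map_add]; rfl)
      map_smul' := fun c d => LinearMap.ext fun a => Subtype.ext (by
        change Ψ.act (c • d) a = c • Ψ.act d a
        rw [map_smul]; rfl) }
    (LinearMap.ext fun a => Subtype.ext (by
      change Ψ.act 1 a = a
      rw [map_one]; rfl))
    (fun d e => LinearMap.ext fun a => Subtype.ext (by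
      change Ψ.act (d * e) a = Ψ.act d (Ψ.act e a)
      rw [map_mul]; rfl))
  act_mul d a b := Subtype.ext (by
    change Ψ.act d (a * b) = _
    rw [Ψ.act_mul, ← (Coalgebra.Repr.arbitrary C d).eq]
    simp only [map_sum, TensorProduct.map_tmul, LinearMap.mul'_apply,
      AddSubmonoidClass.coe_finsetSum]
    rfl)
  act_one d := Subtype.ext (Ψ.act_one d)

/-- The convolution algebra `Hom_C(D, R)`. It is an `R`-algebra through
`ρ₀ : a ↦ (d ↦ ε(d) a)`. -/
abbrev Conv (C D R : Type*) [Field C] [Ring D] [Bialgebra C D] [CommRing R] [Algebra C R] :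
    Type _ := WithConv (D →ₗ[C] R)

/-- The map `ρ : R → Hom_C(D, R)`, `ρ(a)(d) = d a`. -/
def ModuleAlgebra.rho (Ψ : ModuleAlgebra C D R) (a : R) : Conv C D R :=
  WithConv.toConv ((LinearMap.applyₗ a).comp Ψ.act.toLinearMap)

end ModuleAlgebra

section Hull

set_option linter.unusedSectionVars false

variable {C D L : Type*} [Field C] [Ring D] [Bialgebra C D] [CommRing L] [Algebra C L]

theorem Conv.mul_apply (f g : Conv C D L) (d : D) {ι : Type*} (r : Coalgebra.Repr C d ι) :
    (f * g).ofConv d = ∑ i ∈ r.index, f.ofConv (r.left i) * g.ofConv (r.right i) :=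
  Coalgebra.Repr.convMul_apply r f g

theorem Conv.algebraMap_apply (a : L) (d : D) :
    (algebraMap L (Conv C D L) a).ofConv d = a * algebraMap C L (Coalgebra.counit d) := rfl

variable [Coalgebra.IsCocomm C D]

/-- The `D`-module algebra structure `Ψ_int` on `Hom_C(D, L)`: `(d f)(e) = f(e d)`. The operator of
an element `d` is `L`-linear with respect to `ρ₀`. -/
def psiInt (d : D) : Conv C D L →ₗ[L] Conv C D L where
  toFun f := WithConv.toConv (f.ofConv.comp (LinearMap.mulRight C d))
  map_add' _ _ := rfl
  map_smul' _ _ := rfl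

theorem psiInt_apply (d e : D) (f : Conv C D L) : (psiInt d f).ofConv e = f.ofConv (e * d) := rfl

theorem psiInt_mul (d : D) {ι : Type*} (r : Coalgebra.Repr C d ι) (f g : Conv C D L) :
    psiInt d (f * g) = ∑ i ∈ r.index, psiInt (r.left i) f * psiInt (r.right i) g := by
  refine WithConv.ofConv_injective (LinearMap.ext fun e => ?_)
  have s := Coalgebra.Repr.arbitrary C e
  rw [psiInt_apply, WithConv.ofConv_sum, LinearMap.sum_apply]
  simp_rw [Conv.mul_apply _ _ e s, psiInt_apply]
  change LinearMap.mul' C L (TensorProduct.map f.ofConv g.ofConv (Coalgebra.comul (e * d))) = _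
  rw [Bialgebra.comul_mul, ← s.eq, ← r.eq, Finset.sum_mul_sum, Finset.sum_comm]
  simp only [map_sum, Algebra.TensorProduct.tmul_mul_tmul, TensorProduct.map_tmul,
    LinearMap.mul'_apply]

theorem psiInt_algebraMap (d : D) (a : L) : psiInt d (algebraMap L (Conv C D L) a) =
    algebraMap L (Conv C D L) (a * algebraMap C L (Coalgebra.counit d)) := by
  refine WithConv.ofConv_injective (LinearMap.ext fun e => ?_)
  rw [psiInt_apply, Conv.algebraMap_apply, Conv.algebraMap_apply, Bialgebra.counit_mul, map_mul]
  ring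

theorem psiInt_rho (Ψ : ModuleAlgebra C D L) (d : D) (a : L) :
    psiInt d (Ψ.rho a) = Ψ.rho (Ψ.act d a) := by
  refine WithConv.ofConv_injective (LinearMap.ext fun e => ?_)
  change Ψ.act (e * d) a = Ψ.act e (Ψ.act d a)
  rw [map_mul]
  rfl

variable {n : ℕ}

/-- The iterative derivation is `C`-linear. -/
def IterDer.IsLinear (C : Type*) [Field C] [Algebra C L] (θ : IterDer n L) : Prop :=
  ∀ k (c : C) a, θ.comp k (c • a) = c • θ.comp k a

theorem IterDer.comp_mul {R : Type*} [CommRing R] (θ : IterDer n R) (k : Fin n →₀ ℕ) (a b : R) :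
    θ.comp k (a * b) = ∑ p ∈ Finset.HasAntidiagonal.antidiagonal k, θ.comp p.1 a * θ.comp p.2 b := by
  change MvPowerSeries.coeff k (θ.toHom (a * b)) = _
  rw [map_mul, MvPowerSeries.coeff_mul]
  rfl

/-- An iterative derivation from its components. -/
def IterDer.ofComp {R : Type*} [CommRing R] (c : (Fin n →₀ ℕ) → R →+ R) (h0 : ∀ a, c 0 a = a)
    (h1 : ∀ k, k ≠ 0 → c k 1 = 0)
    (hmul : ∀ k a b, c k (a * b) =
      ∑ p ∈ Finset.HasAntidiagonal.antidiagonal k, c p.1 a * c p.2 b)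
    (hiter : ∀ m k a, c m (c k a) = multichoose m k • c (m + k) a) : IterDer n R where
  toHom :=
    { toFun := fun a => (fun k => c k a : MvPowerSeries (Fin n) R)
      map_zero' := MvPowerSeries.ext fun k => map_zero (c k)
      map_add' := fun a b => MvPowerSeries.ext fun k => map_add (c k) a b
      map_one' := MvPowerSeries.ext fun k => by
        classical
        rw [MvPowerSeries.coeff_one]
        change c k 1 = _
        split_ifs with hk
        · rw [hk, h0]
        · exact h1 k hk
      map_mul' := fun a b => MvPowerSeries.ext fun k =>
        (hmul k a b).trans (MvPowerSeries.coeff_mul k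
          (fun k => c k a : MvPowerSeries (Fin n) R) (fun k => c k b)).symm }
  coeff_zero := h0
  iter := hiter

theorem IterDer.comp_one {R : Type*} [CommRing R] (θ : IterDer n R) (k : Fin n →₀ ℕ)
    (hk : k ≠ 0) : θ.comp k 1 = 0 := by
  classical
  change MvPowerSeries.coeff k (θ.toHom 1) = _
  rw [map_one, MvPowerSeries.coeff_one, if_neg hk]

/-- The additive map `f ↦ θ^(k) ∘ f` on `Hom_C(D, L)`. -/
def convComp (θ : IterDer n L) (hθ : θ.IsLinear C) (k : Fin n →₀ ℕ) :
    Conv C D L →+ Conv C D L where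
  toFun f := WithConv.toConv
    { toFun := fun d => θ.comp k (f.ofConv d)
      map_add' := fun d e => by rw [map_add, map_add]
      map_smul' := fun c d => by rw [map_smul, hθ]; rfl }
  map_zero' := WithConv.ofConv_injective (LinearMap.ext fun d => (θ.comp k).map_zero)
  map_add' f g := WithConv.ofConv_injective (LinearMap.ext fun d =>
    (θ.comp k).map_add (f.ofConv d) (g.ofConv d))

theorem convComp_apply (θ : IterDer n L) (hθ : θ.IsLinear C) (k : Fin n →₀ ℕ) (f : Conv C D L)
    (d : D) : (convComp θ hθ k f).ofConv d = θ.comp k (f.ofConv d) := rfl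

theorem convComp_mul (θ : IterDer n L) (hθ : θ.IsLinear C) (k : Fin n →₀ ℕ) (f g : Conv C D L) :
    convComp θ hθ k (f * g) = ∑ p ∈ Finset.HasAntidiagonal.antidiagonal k,
      convComp θ hθ p.1 f * convComp θ hθ p.2 g := by
  refine WithConv.ofConv_injective (LinearMap.ext fun d => ?_)
  have s := Coalgebra.Repr.arbitrary C d
  rw [convComp_apply, WithConv.ofConv_sum, LinearMap.sum_apply]
  simp_rw [Conv.mul_apply _ _ d s, convComp_apply]
  rw [map_sum, Finset.sum_comm]
  exact Finset.sum_congr rfl fun i _ => θ.comp_mul k _ _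

theorem convComp_algebraMap (θ : IterDer n L) (hθ : θ.IsLinear C) (k : Fin n →₀ ℕ) (a : L) :
    convComp θ hθ k (algebraMap L (Conv C D L) a) = algebraMap L (Conv C D L) (θ.comp k a) := by
  refine WithConv.ofConv_injective (LinearMap.ext fun d => ?_)
  rw [convComp_apply, Conv.algebraMap_apply, Conv.algebraMap_apply, mul_comm, ← Algebra.smul_def,
    hθ, Algebra.smul_def, mul_comm]

theorem convComp_psiInt (θ : IterDer n L) (hθ : θ.IsLinear C) (k : Fin n →₀ ℕ) (d : D)
    (f : Conv C D L) : convComp θ hθ k (psiInt d f) = psiInt d (convComp θ hθ k f) := rfl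

/-- The `n`-variate iterative derivation on `Hom_C(D, L)` induced by `θ`. -/
def convTheta (D : Type*) [Ring D] [Bialgebra C D] [Coalgebra.IsCocomm C D]
    (θ : IterDer n L) (hθ : θ.IsLinear C) : IterDer n (Conv C D L) :=
  IterDer.ofComp (convComp θ hθ)
    (fun f => WithConv.ofConv_injective (LinearMap.ext fun d => θ.coeff_zero (f.ofConv d)))
    (fun k hk => by
      have h1 : (1 : Conv C D L) = algebraMap L (Conv C D L) 1 := (map_one _).symm
      rw [h1, convComp_algebraMap, θ.comp_one k hk, map_zero])
    (convComp_mul θ hθ)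
    (fun m k f => WithConv.ofConv_injective (LinearMap.ext fun d => by
      rw [WithConv.ofConv_smul]
      exact θ.iter m k (f.ofConv d)))

theorem convTheta_comp (θ : IterDer n L) (hθ : θ.IsLinear C) (k : Fin n →₀ ℕ) (f : Conv C D L) :
    (convTheta D θ hθ).comp k f = convComp θ hθ k f := rfl

variable (Ψ : ModuleAlgebra C D L) (θ : IterDer n L) (hθ : θ.IsLinear C)

/-- The algebra `𝓛 = ρ₀(L){ρ(L)}_θ`: the smallest subalgebra of `Hom_C(D, L)` that contains `ρ₀(L)`
and `ρ(L)` and is stable under the iterative derivation `θ`. -/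
def hullL : Subalgebra L (Conv C D L) :=
  sInf {S | Set.range Ψ.rho ⊆ S ∧ ∀ k, ∀ f ∈ S, (convTheta D θ hθ).comp k f ∈ S}

/-- The algebra `𝓚 = ρ₀(L)[ρ(K)]`. -/
def hullK (K : Subalgebra C L) : Subalgebra L (Conv C D L) :=
  Algebra.adjoin L (Ψ.rho '' K)

theorem rho_mem_hullL (a : L) : Ψ.rho a ∈ hullL Ψ θ hθ :=
  Algebra.mem_sInf.2 fun _ hS => hS.1 ⟨a, rfl⟩

theorem theta_mem_hullL (k : Fin n →₀ ℕ) {f : Conv C D L} (hf : f ∈ hullL Ψ θ hθ) :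
    (convTheta D θ hθ).comp k f ∈ hullL Ψ θ hθ :=
  Algebra.mem_sInf.2 fun S hS => hS.2 k f (Algebra.mem_sInf.1 hf S hS)

theorem psiInt_mem_hullL (d : D) {f : Conv C D L} (hf : f ∈ hullL Ψ θ hθ) :
    psiInt d f ∈ hullL Ψ θ hθ := by
  let S : Subalgebra L (Conv C D L) :=
    { carrier := {f | ∀ d : D, psiInt d f ∈ hullL Ψ θ hθ}
      mul_mem' := fun {f g} hf hg d => by
        have r := Coalgebra.Repr.arbitrary C d
        rw [psiInt_mul d r]
        exact sum_mem fun i _ => mul_mem (hf _) (hg _)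
      add_mem' := fun {f g} hf hg d => by
        rw [map_add]
        exact add_mem (hf d) (hg d)
      algebraMap_mem' := fun a d => by
        rw [psiInt_algebraMap]
        exact Subalgebra.algebraMap_mem _ _ }
  have hS : hullL Ψ θ hθ ≤ S := sInf_le ⟨by
      rintro _ ⟨a, rfl⟩ d
      rw [psiInt_rho]
      exact rho_mem_hullL Ψ θ hθ _, fun k f hf d => by
      have : psiInt d ((convTheta D θ hθ).comp k f) = (convTheta D θ hθ).comp k (psiInt d f) := rfl
      rw [this]
      exact theta_mem_hullL Ψ θ hθ k (hf d)⟩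
  exact hS hf d

theorem hullK_le_hullL (K : Subalgebra C L) : hullK Ψ K ≤ hullL Ψ θ hθ := by
  refine Algebra.adjoin_le ?_
  rintro _ ⟨a, _, rfl⟩
  exact rho_mem_hullL Ψ θ hθ a

/-- The restriction of an iterative derivation to a stable subalgebra. -/
def IterDer.restrict {R : Type*} [CommRing R] [Algebra L R] (η : IterDer n R) (S : Subalgebra L R)
    (hS : ∀ k, ∀ f ∈ S, η.comp k f ∈ S) : IterDer n S :=
  IterDer.ofComp
    (fun k =>
      { toFun := fun f => ⟨η.comp k (f : R), hS k f f.2⟩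
        map_zero' := Subtype.ext (map_zero (η.comp k))
        map_add' := fun f g => Subtype.ext (map_add (η.comp k) (f : R) (g : R)) })
    (fun f => Subtype.ext (η.coeff_zero f))
    (fun k hk => Subtype.ext (η.comp_one k hk))
    (fun k f g => Subtype.ext (by
      rw [AddSubmonoidClass.coe_finsetSum]
      exact η.comp_mul k f g))
    (fun m k f => Subtype.ext (by
      refine (η.iter m k f).trans ?_
      rw [AddSubmonoidClass.coe_nsmul]
      rfl))

/-- The iterative derivation on `𝓛`. -/
def hullTheta : IterDer n (hullL Ψ θ hθ) :=
  (convTheta D θ hθ).restrict (hullL Ψ θ hθ) fun k _ hf => theta_mem_hullL Ψ θ hθ k hf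

theorem hullTheta_extends : Extends θ (hullTheta Ψ θ hθ) := fun a => by
  ext1 k
  rw [MvPowerSeries.coeff_map]
  exact Subtype.ext (convComp_algebraMap θ hθ k a)

/-- The operator of `d` on `𝓛`. -/
def hullOp (d : D) : hullL Ψ θ hθ →ₗ[L] hullL Ψ θ hθ :=
  (psiInt d).restrict (p := (hullL Ψ θ hθ).toSubmodule) (q := (hullL Ψ θ hθ).toSubmodule)
    fun _ hf => psiInt_mem_hullL Ψ θ hθ d hf

end Hull

section Functor

universe uC uD uL v

open CategoryTheory

/-- The Umemura functor `Ume(L | K)`. Its value at a commutative `L`-algebra `A` is the group of the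
automorphisms of `𝓛 ⊗̂_L A⟦w⟧` that commute with `Ψ_int ⊗̂ Ψ₀` and with `θ ⊗̂ θ_w`, that fix the image
of `𝓚 ⊗̂_L A⟦w⟧` elementwise and that induce the identity modulo the nilradical of `A`. (Such an
automorphism is automatically linear over `C`, and over `L` and `A⟦w⟧`, as it fixes the image of
`𝓚 ⊗̂_L A⟦w⟧`.) -/
def Ume {C : Type uC} {D : Type uD} {L : Type uL} [Field C] [Ring D] [Bialgebra C D]
    [Coalgebra.IsCocomm C D] [CommRing L] [Algebra C L] (Ψ : ModuleAlgebra C D L)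
    (K : Subalgebra C L) {n : ℕ} (θ : IterDer n L) (hθ : θ.IsLinear C) :
    CommAlgCat.{v} L ⥤ GrpCat.{max uD uL v} :=
  umeFunctor (hullTheta_extends Ψ θ hθ) (hullOp Ψ θ hθ)
    (Subalgebra.inclusion (hullK_le_hullL Ψ θ hθ K))

end Functor

/-! ### Separating transcendence bases and the associated iterative derivation -/

section Separating

/-- The family `x` is a separating transcendence basis of the field extension `E | F`. -/
def IsSeparatingBasis (F E : Type*) [Field F] [Field E] [Algebra F E] {ι : Type*} (x : ι → E) :
    Prop :=
  IsTranscendenceBasis F x ∧ Algebra.IsSeparable (IntermediateField.adjoin F (Set.range x)) E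

variable {C L : Type*} [Field C] [CommRing L] [Algebra C L] {n : ℕ}

/-- `θ` is an iterative derivation over `K` with `θ(u_i) = u_i + t_i`. -/
structure IterDer.IsAssociated (θ : IterDer n L) (K : Subalgebra C L) (u : Fin n → L) : Prop where
  eq_C : ∀ a ∈ K, θ.toHom a = MvPowerSeries.C a
  shift : ∀ i, θ.toHom (u i) = MvPowerSeries.C (u i) + MvPowerSeries.X i

theorem IterDer.IsAssociated.isLinear {θ : IterDer n L} {K : Subalgebra C L} {u : Fin n → L}
    (hθ : θ.IsAssociated K u) : θ.IsLinear C := fun k c a => by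
  change MvPowerSeries.coeff k (θ.toHom (c • a)) = c • MvPowerSeries.coeff k (θ.toHom a)
  rw [Algebra.smul_def, map_mul, hθ.eq_C _ (K.algebraMap_mem c), MvPowerSeries.coeff_C_mul,
    Algebra.smul_def]

variable [IsArtinianRing L]

/-- For a prime ideal `Q` of the Artinian ring `L` and an Artinian subalgebra `K`: the extension of
residue fields `L / Q` over `K / (K ∩ Q)` is finitely generated, and the classes of `u₁, …, uₙ` are a
separating transcendence basis of it. -/
def IsSeparatingAt (K : Subalgebra C L) [IsArtinianRing K] (u : Fin n → L) (Q : Ideal L)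
    (hQ : Q.IsPrime) : Prop :=
  letI : Field (K ⧸ Q.comap (algebraMap K L)) :=
    @Ideal.Quotient.field _ _ _ (IsArtinianRing.isMaximal_of_isPrime _)
  letI : Field (L ⧸ Q) := @Ideal.Quotient.field _ _ Q (IsArtinianRing.isMaximal_of_isPrime Q)
  (⊤ : IntermediateField (K ⧸ Q.comap (algebraMap K L)) (L ⧸ Q)).FG ∧
    IsSeparatingBasis (K ⧸ Q.comap (algebraMap K L)) (L ⧸ Q) fun i => Ideal.Quotient.mk Q (u i)

end Separating

/-! ### Formal group schemes -/

section FormalScheme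

open CategoryTheory

/-- A weakly admissible topological ring: linearly topologized, complete and separated, with an open
ideal that consists of topologically nilpotent elements. -/
class IsWeaklyAdmissible (R : Type*) [CommRing R] [UniformSpace R] : Prop where
  uniformAddGroup : IsUniformAddGroup R
  topologicalRing : IsTopologicalRing R
  linear : IsLinearTopology R R
  complete : CompleteSpace R
  separated : T2Space R
  exists_open : ∃ I : Ideal R, IsOpen (I : Set R) ∧ ∀ x ∈ I, IsTopologicallyNilpotent x

/-- The `A`-valued points of the formal spectrum `Spf R` over `L`: the homomorphisms of `L`-algebras
`R → A` that are continuous for the discrete topology on `A`, i.e. have an open kernel. -/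
def SpfPoints (L R A : Type*) [CommRing L] [CommRing R] [Algebra L R] [TopologicalSpace R]
    [CommRing A] [Algebra L A] : Type _ :=
  {f : R →ₐ[L] A // IsOpen (RingHom.ker f : Set R)}

universe r uL v w

/-- The group functor `F` on commutative `L`-algebras is a formal group scheme over `L`: its
underlying functor to sets is isomorphic to the functor of points of the formal scheme `Spf R`, for a
weakly admissible topological `L`-algebra `R`. -/
def IsFormalGroupScheme {L : Type uL} [CommRing L] (F : CommAlgCat.{v} L ⥤ GrpCat.{w}) : Prop :=
  ∃ (R : Type r) (_ : CommRing R) (_ : Algebra L R) (_ : UniformSpace R),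
    IsWeaklyAdmissible R ∧
    ∃ e : ∀ A : CommAlgCat.{v} L, F.obj A ≃ SpfPoints L R A,
      ∀ (A B : CommAlgCat.{v} L) (l : A ⟶ B) (x : F.obj A),
        (e B ((F.map l).hom x)).1 = l.hom.comp (e A x).1

end FormalScheme

end Umemura

end

universe uC uG uD uL v

/-!
The theorem has two independent halves.

*The iterative derivation.* The nilradical of `L` is stable under the operators of `D`: the elements
of `G` act by ring endomorphisms, the divided power basis of `D¹` acts by the coefficients of a ring
homomorphism from `L` to a power series ring, and a nilpotent power series has nilpotent
coefficients. Hence the simple ring `L` is reduced (`isReduced_of_isSimple`), so it is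
a finite product of fields, and so is its Artinian subring `K`.
The hypothesis on `u` then says that each factor of `L` is separable algebraic over a field of
rational functions in `u` with coefficients in a factor of `K`, so that the map `K[X₁, …, Xₙ] → L`,
`Xᵢ ↦ uᵢ`, is formally étale (`formallyEtale_aeval`). Lifting along the quotients of `L⟦w⟧` by the
powers of `(w)` gives one and only one ring homomorphism `θ` over `K` with `θ(uᵢ) = uᵢ + wᵢ` that is
the identity modulo `(w)`, and the same uniqueness yields the iteration rule
(`existsUnique_iterDer`).

*Representability.* This half holds for every `L`-algebra `S` that is projective as an `L`-module,
in place of `𝓛`; over the semisimple ring `L` every module is projective. A linear form `l` on `S`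
and a multi-index `k` define a coordinate of `x ∈ S ⊗̂ A⟦w⟧`, the coefficient of `w^k` in
`(l ⊗̂ id)(x)`. As `S` is projective, the coordinates separate points, and elements descend along a
jointly injective pair `B → A₁`, `B → A₂` as soon as their coordinates come from common elements of `B`. An
element of `Ume(A)` is therefore the same as a homomorphism to `A`, of a certain kind, from the
polynomial ring `P` whose indeterminates stand for the coordinates of the images of the elements
`s ⊗ 1` under the automorphism and under its inverse. By descent (`exists_umeMap_eq_of_commonCoord`)
the kernels of these homomorphisms form a filter of ideals that also decides which homomorphisms
occur: the conditions on the automorphism pass to quotients of `A` and hold over `B` if they hold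
over `A₁` and `A₂`. So `Ume` is pro-represented by the quotients of `P` by these ideals, and `R` is
their inverse limit. It is weakly admissible because an element of `Ume(A)` has, up to nilpotent
elements, the coordinates of the identity: the kernel of the projection of `R` to the quotient that
belongs to the identity over `L` is an open ideal of topologically nilpotent elements.
-/

noncomputable section

namespace Umemura

/-! ### Power series -/

section PowerSeries

variable {σ R : Type*} [CommRing R]

theorem le_order_of_mem_pow {I : Ideal (MvPowerSeries σ R)}
    (hI : ∀ f ∈ I, MvPowerSeries.constantCoeff f = 0) (m : ℕ) {f : MvPowerSeries σ R}
    (hf : f ∈ I ^ m) : (m : ℕ∞) ≤ f.order := by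
  induction m generalizing f with
  | zero => exact zero_le
  | succ m ih =>
    rw [pow_succ] at hf
    refine Submodule.mul_induction_on hf (fun a ha b hb => ?_) (fun a b ha hb => ?_)
    · refine le_trans ?_ MvPowerSeries.le_order_mul
      push_cast
      exact add_le_add (ih ha) (MvPowerSeries.one_le_order_iff_constCoeff_eq_zero.2 (hI b hb))
    · exact le_trans (le_min ha hb) MvPowerSeries.min_order_le_add

theorem constantCoeff_eq_zero_of_mem_span_X {f : MvPowerSeries σ R}
    (hf : f ∈ Ideal.span (Set.range (MvPowerSeries.X : σ → MvPowerSeries σ R))) :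
    MvPowerSeries.constantCoeff f = 0 := by
  have : Ideal.span (Set.range (MvPowerSeries.X : σ → MvPowerSeries σ R)) ≤
      RingHom.ker (MvPowerSeries.constantCoeff (σ := σ) (R := R)) := by
    rw [Ideal.span_le]
    rintro _ ⟨i, rfl⟩
    exact MvPowerSeries.constantCoeff_X i
  exact this hf

theorem coeff_eq_zero_of_mem_span_X_pow {m : ℕ} {f : MvPowerSeries σ R}
    (hf : f ∈ Ideal.span (Set.range (MvPowerSeries.X : σ → MvPowerSeries σ R)) ^ m)
    {k : σ →₀ ℕ} (hk : k.degree < m) : MvPowerSeries.coeff k f = 0 :=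
  MvPowerSeries.coeff_of_lt_order (lt_of_lt_of_le (by exact_mod_cast hk)
    (le_order_of_mem_pow (fun _ h => constantCoeff_eq_zero_of_mem_span_X h) m hf))

/-- In finitely many variables, a power series without terms of degree less than `m` lies in the
`m`-th power of the ideal of the variables. -/
theorem mem_span_X_pow_of_coeff_eq_zero [Finite σ] (m : ℕ) (f : MvPowerSeries σ R)
    (h : ∀ k : σ →₀ ℕ, k.degree < m → MvPowerSeries.coeff k f = 0) :
    f ∈ Ideal.span (Set.range (MvPowerSeries.X : σ → MvPowerSeries σ R)) ^ m := by
  have h1 : MvPowerSeries.truncTotal m f = 0 := by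
    ext k
    by_cases hk : k.degree < m
    · rw [MvPowerSeries.coeff_truncTotal _ hk, h k hk, MvPolynomial.coeff_zero]
    · rw [MvPowerSeries.coeff_truncTotal_eq_zero _ (not_lt.1 hk), MvPolynomial.coeff_zero]
  let e := MvPowerSeries.toAdicCompletionAlgEquiv σ R
  have h2 : AdicCompletion.eval (MvPolynomial.idealOfVars σ R) (MvPolynomial σ R) m (e f) = 0 := by
    change Ideal.Quotient.mk _ (MvPowerSeries.truncTotal m f) = 0
    rw [h1, map_zero]
  have h3 : e f ∈ (MvPolynomial.idealOfVars σ R ^ m • ⊤ : Submodule (MvPolynomial σ R)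
      (AdicCompletion (MvPolynomial.idealOfVars σ R) (MvPolynomial σ R))) := by
    rw [AdicCompletion.pow_smul_top_eq_ker_eval (MvPolynomial.idealOfVars_fg σ R)]
    exact h2
  have h4 : ∀ x ∈ (MvPolynomial.idealOfVars σ R ^ m • ⊤ : Submodule (MvPolynomial σ R)
      (AdicCompletion (MvPolynomial.idealOfVars σ R) (MvPolynomial σ R))),
      e.symm x ∈ Ideal.span (Set.range (MvPowerSeries.X : σ → MvPowerSeries σ R)) ^ m := by
    intro x hx
    refine Submodule.smul_induction_on hx (fun r hr y _ => ?_) (fun x y hx hy => ?_)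
    · rw [map_smul, Algebra.smul_def]
      refine Ideal.mul_mem_right _ _ ?_
      have h5 := Ideal.mem_map_of_mem (algebraMap (MvPolynomial σ R) (MvPowerSeries σ R)) hr
      rw [Ideal.map_pow, MvPolynomial.idealOfVars, Ideal.map_span, ← Set.range_comp] at h5
      have h6 : (algebraMap (MvPolynomial σ R) (MvPowerSeries σ R)) ∘ MvPolynomial.X =
          MvPowerSeries.X := funext fun i => MvPolynomial.coe_X i
      rwa [h6] at h5
    · rw [map_add]
      exact add_mem hx hy
  have h5 := h4 _ h3
  rwa [AlgEquiv.symm_apply_apply] at h5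

end PowerSeries

/-! ### Formally étale algebras and iterative derivations -/

section Etale

variable {R L σ : Type*} [CommRing R] [CommRing L] [Algebra R L]

/-- A ring homomorphism into power series is determined by its constant term and its values on a
subring over which the source is formally unramified. -/
theorem ringHom_ext_of_constantCoeff [Algebra.FormallyUnramified R L] {A : Type*} [CommRing A]
    {f g : L →+* MvPowerSeries σ A}
    (h0 : ∀ a, MvPowerSeries.constantCoeff (f a) = MvPowerSeries.constantCoeff (g a))
    (hR : ∀ r, f (algebraMap R L r) = g (algebraMap R L r)) : f = g := by
  let : Algebra R (MvPowerSeries σ A) := (f.comp (algebraMap R L)).toAlgebra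
  let f' : L →ₐ[R] MvPowerSeries σ A := { f with commutes' := fun _ => rfl }
  let g' : L →ₐ[R] MvPowerSeries σ A := { g with commutes' := fun r => (hR r).symm }
  have key : f' = g' := by
    refine Algebra.FormallyUnramified.ext_of_iInf
      (I := RingHom.ker (MvPowerSeries.constantCoeff (σ := σ) (R := A))) ?_ fun a => ?_
    · refine eq_bot_iff.2 fun x hx => ?_
      rw [Ideal.mem_iInf] at hx
      rw [Ideal.mem_bot, ← MvPowerSeries.order_eq_top_iff, ENat.eq_top_iff_forall_ge]
      exact fun m => le_order_of_mem_pow (fun _ h => h) m (hx m)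
    · rw [Ideal.Quotient.eq, RingHom.mem_ker, map_sub]
      exact sub_eq_zero.2 (h0 a)
  ext1 a
  exact DFunLike.congr_fun key a

/-- Along a formally étale map `R → L`, homomorphisms `R → L⟦w⟧` with the right constant term extend
to `L`: the identity of `L` lifts successively to the quotients of `L⟦w⟧` by the powers of `(w)`. -/
theorem exists_ringHom_powerSeries [Finite σ] [Algebra.FormallyEtale R L]
    (g : R →+* MvPowerSeries σ L)
    (hg : ∀ r, MvPowerSeries.constantCoeff (g r) = algebraMap R L r) :
    ∃ h : L →+* MvPowerSeries σ L, (∀ r, h (algebraMap R L r) = g r) ∧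
      ∀ a, MvPowerSeries.constantCoeff (h a) = a := by
  let : Algebra R (MvPowerSeries σ L) := g.toAlgebra
  let I : Ideal (MvPowerSeries σ L) := Ideal.span (Set.range MvPowerSeries.X)
  let f : L →ₐ[R] MvPowerSeries σ L ⧸ I :=
    { (Ideal.Quotient.mk I).comp (MvPowerSeries.C (σ := σ) (R := L)) with
      commutes' := fun r => by
        change Ideal.Quotient.mk I (MvPowerSeries.C (algebraMap R L r)) = Ideal.Quotient.mk I (g r)
        rw [Ideal.Quotient.eq, ← pow_one I]
        refine mem_span_X_pow_of_coeff_eq_zero 1 _ fun k hk => ?_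
        obtain rfl : k = 0 := by
          rwa [Nat.lt_one_iff, Finsupp.degree_eq_zero_iff] at hk
        rw [map_sub, MvPowerSeries.coeff_zero_C, MvPowerSeries.coeff_zero_eq_constantCoeff_apply,
          hg, sub_self] }
  obtain ⟨h, hh⟩ := Algebra.FormallySmooth.exists_mkₐ_comp_eq_of_isAdicComplete (I := I) f
  refine ⟨h, fun r => h.commutes r, fun a => ?_⟩
  have h1 : Ideal.Quotient.mk I (h a) = Ideal.Quotient.mk I (MvPowerSeries.C a) :=
    DFunLike.congr_fun hh a
  rw [Ideal.Quotient.eq] at h1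
  have h2 := constantCoeff_eq_zero_of_mem_span_X h1
  rwa [map_sub, MvPowerSeries.constantCoeff_C, sub_eq_zero] at h2

variable {n : ℕ}

theorem hasse_C (a : L) : hasse (MvPowerSeries.C a : MvPowerSeries (Fin n) L) =
    MvPowerSeries.C (MvPowerSeries.C a) := by
  classical
  ext k m
  rw [coeff_coeff_hasse, MvPowerSeries.coeff_C, MvPowerSeries.coeff_C]
  by_cases hk : k = 0
  · subst hk
    simp [multichoose, MvPowerSeries.coeff_C]
  · rw [if_neg hk, if_neg (fun h => hk (add_eq_zero.1 h).2), smul_zero, map_zero]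

theorem hasse_X (i : Fin n) : hasse (MvPowerSeries.X i : MvPowerSeries (Fin n) L) =
    MvPowerSeries.C (MvPowerSeries.X i) + MvPowerSeries.X i := by
  classical
  ext k m
  rw [coeff_coeff_hasse, MvPowerSeries.coeff_X, map_add, MvPowerSeries.coeff_C,
    MvPowerSeries.coeff_X, map_add]
  by_cases hk : k = 0
  · subst hk
    have h0 : (0 : Fin n →₀ ℕ) ≠ Finsupp.single i 1 := fun h => by
      simpa using DFunLike.congr_fun h i
    simp [multichoose, MvPowerSeries.coeff_X, h0]
  · rw [if_neg hk, map_zero, zero_add]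
    by_cases hs : k = Finsupp.single i 1
    · subst hs
      rw [if_pos rfl, MvPowerSeries.coeff_one]
      by_cases hm : m = 0
      · subst hm
        simp [multichoose]
      · rw [if_neg hm, if_neg, smul_zero]
        exact fun h => hm (by simpa using h)
    · rw [if_neg hs, map_zero, if_neg, smul_zero]
      intro h
      have hle : k ≤ Finsupp.single i 1 := h ▸ le_add_self
      have hki : ∀ j, j ≠ i → k j = 0 := fun j hj => by
        have := hle j
        rw [Finsupp.single_apply, if_neg (Ne.symm hj)] at this
        omega
      have hi := hle i
      rw [Finsupp.single_apply, if_pos rfl] at hi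
      rcases Nat.le_one_iff_eq_zero_or_eq_one.1 hi with h1 | h1
      · exact hk (Finsupp.ext fun j => by
          by_cases hj : j = i
          · rw [hj, h1]; rfl
          · rw [hki j hj]; rfl)
      · exact hs (Finsupp.ext fun j => by
          by_cases hj : j = i
          · rw [hj, h1, Finsupp.single_apply, if_pos rfl]
          · rw [hki j hj, Finsupp.single_apply, if_neg (Ne.symm hj)])

/-- If `L` is formally étale over the polynomial ring `K[u₁, …, uₙ]`, there is a unique iterative
derivation of `L` over `K` that shifts the `u_i`. The iteration rule compares two lifts
`L → L⟦w⟧⟦t⟧` of `θ` along `t ↦ 0`. -/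
theorem existsUnique_iterDer (u : Fin n → L)
    (h : (MvPolynomial.aeval (R := R) u : MvPolynomial (Fin n) R →ₐ[R] L).toRingHom.FormallyEtale) :
    ∃! θ : IterDer n L,
      (∀ r, θ.toHom (algebraMap R L r) = MvPowerSeries.C (algebraMap R L r)) ∧
      ∀ i, θ.toHom (u i) = MvPowerSeries.C (u i) + MvPowerSeries.X i := by
  let : Algebra (MvPolynomial (Fin n) R) L :=
    (MvPolynomial.aeval (R := R) u : MvPolynomial (Fin n) R →ₐ[R] L).toRingHom.toAlgebra
  have : Algebra.FormallyEtale (MvPolynomial (Fin n) R) L := h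
  have hC : ∀ r, algebraMap (MvPolynomial (Fin n) R) L (MvPolynomial.C r) = algebraMap R L r :=
    fun r => MvPolynomial.aeval_C u r
  have hX : ∀ i, algebraMap (MvPolynomial (Fin n) R) L (MvPolynomial.X i) = u i :=
    fun i => MvPolynomial.aeval_X u i
  let g : MvPolynomial (Fin n) R →+* MvPowerSeries (Fin n) L :=
    MvPolynomial.eval₂Hom (MvPowerSeries.C.comp (algebraMap R L))
      fun i => MvPowerSeries.C (u i) + MvPowerSeries.X i
  have hg : ∀ r, MvPowerSeries.constantCoeff (g r) = algebraMap (MvPolynomial (Fin n) R) L r := by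
    intro r
    refine DFunLike.congr_fun (f := MvPowerSeries.constantCoeff.comp g)
      (MvPolynomial.ringHom_ext (fun a => ?_) fun i => ?_) r
    · simp [g, hC]
    · simp [g, hX]
  obtain ⟨f, hf, hf0⟩ := exists_ringHom_powerSeries g hg
  have hfC : ∀ r, f (algebraMap R L r) = MvPowerSeries.C (algebraMap R L r) := fun r => by
    rw [← hC, hf, hC]
    simp [g]
  have hfX : ∀ i, f (u i) = MvPowerSeries.C (u i) + MvPowerSeries.X i := fun i => by
    rw [← hX, hf, hX]
    simp [g]
  have hiter : (MvPowerSeries.map f).comp f = hasse.comp f := by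
    refine ringHom_ext_of_constantCoeff (R := MvPolynomial (Fin n) R) (fun a => ?_) fun r => ?_
    · rw [RingHom.comp_apply, RingHom.comp_apply, MvPowerSeries.constantCoeff_map, hf0]
      exact (coeff_zero_hasse (f a)).symm
    · refine DFunLike.congr_fun
        (f := ((MvPowerSeries.map f).comp f).comp (algebraMap (MvPolynomial (Fin n) R) L))
        (g := (hasse.comp f).comp (algebraMap (MvPolynomial (Fin n) R) L))
        (MvPolynomial.ringHom_ext (fun a => ?_) fun i => ?_) r
      · rw [RingHom.comp_apply, RingHom.comp_apply, RingHom.comp_apply, RingHom.comp_apply, hC, hfC,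
          MvPowerSeries.map_C, hfC, hasse_C]
      · rw [RingHom.comp_apply, RingHom.comp_apply, RingHom.comp_apply, RingHom.comp_apply, hX, hfX,
          map_add, MvPowerSeries.map_C, MvPowerSeries.map_X, hfX, map_add, map_add, hasse_C,
          hasse_X, add_assoc]
  refine ⟨⟨f, hf0, fun m k a => ?_⟩, ⟨hfC, hfX⟩, fun θ' hθ' => ?_⟩
  · have := congrArg (fun x => MvPowerSeries.coeff m (MvPowerSeries.coeff k x))
      (DFunLike.congr_fun hiter a)
    simpa [coeff_coeff_hasse] using this
  · have : θ'.toHom = f := by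
      refine ringHom_ext_of_constantCoeff (R := MvPolynomial (Fin n) R) (fun a => ?_) fun r => ?_
      · exact (θ'.coeff_zero a).trans (hf0 a).symm
      · refine DFunLike.congr_fun
          (f := θ'.toHom.comp (algebraMap (MvPolynomial (Fin n) R) L))
          (g := f.comp (algebraMap (MvPolynomial (Fin n) R) L))
          (MvPolynomial.ringHom_ext (fun a => ?_) fun i => ?_) r
        · rw [RingHom.comp_apply, RingHom.comp_apply, hC, hfC, hθ'.1]
        · rw [RingHom.comp_apply, RingHom.comp_apply, hX, hfX, hθ'.2]
    cases θ'
    congr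

end Etale

/-! ### Separating transcendence bases give formally étale algebras -/

section Separable

theorem formallyEtale_mvPolynomial_map {A B : Type*} (σ : Type*) [CommRing A] [CommRing B]
    [Algebra A B] [Algebra.FormallyEtale A B] :
    (MvPolynomial.map (σ := σ) (algebraMap A B)).FormallyEtale := by
  let _ : Algebra (MvPolynomial σ A) (MvPolynomial σ B) := MvPolynomial.algebraMvPolynomial
  have : Algebra.FormallyEtale (MvPolynomial σ A) (MvPolynomial σ B) :=
    .of_equiv (Algebra.IsPushout.equiv A (MvPolynomial σ A) B (MvPolynomial σ B))
  exact RingHom.formallyEtale_algebraMap.2 this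

/-- The polynomial ring in a separating transcendence basis maps to its fraction field, a
localization, and this field has the separable algebraic extension `E`. Both steps are formally
étale. -/
theorem formallyEtale_of_isSeparatingBasis {F E ι : Type*} [Field F] [Field E] [Algebra F E]
    {x : ι → E} (hx : IsSeparatingBasis F E x) :
    (MvPolynomial.aeval (R := F) x : MvPolynomial ι F →ₐ[F] E).toRingHom.FormallyEtale := by
  obtain ⟨⟨hind, -⟩, hsep⟩ := hx
  let M := IntermediateField.adjoin F (Set.range x)
  let e : FractionRing (MvPolynomial ι F) ≃ₐ[F] M := hind.aevalEquivField
  have h1 : (algebraMap (MvPolynomial ι F) (FractionRing (MvPolynomial ι F))).FormallyEtale :=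
    RingHom.formallyEtale_algebraMap.2
      (Algebra.FormallyEtale.of_isLocalization (nonZeroDivisors (MvPolynomial ι F)))
  have h2 : (e.toAlgHom.toRingHom).FormallyEtale := by
    let _ : Algebra (FractionRing (MvPolynomial ι F)) M := e.toAlgHom.toRingHom.toAlgebra
    exact Algebra.FormallyEtale.of_equiv (R := FractionRing (MvPolynomial ι F))
      (A := FractionRing (MvPolynomial ι F)) { e with commutes' := fun _ => rfl }
  have h3 : (algebraMap M E).FormallyEtale :=
    RingHom.formallyEtale_algebraMap.2 (Algebra.FormallyEtale.of_isSeparable M E)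
  have h4 := (h1.comp h2).comp h3
  have h5 : (MvPolynomial.aeval (R := F) x : MvPolynomial ι F →ₐ[F] E).toRingHom =
      (algebraMap M E).comp (e.toAlgHom.toRingHom.comp
        (algebraMap (MvPolynomial ι F) (FractionRing (MvPolynomial ι F)))) :=
    RingHom.ext fun p => (hind.aevalEquivField_algebraMap_apply_coe p).symm
  rw [h5]
  exact h4

/-- The residue fields of a reduced Artinian ring are formally étale over it, being factors of a
finite product decomposition. -/
theorem formallyEtale_quotient {K : Type*} [CommRing K] [IsArtinianRing K] [IsReduced K]
    (q : Ideal K) [q.IsMaximal] : Algebra.FormallyEtale K (K ⧸ q) := by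
  have h : Algebra.FormallyEtale K (∀ I : MaximalSpectrum K, K ⧸ I.asIdeal) :=
    .of_equiv (IsArtinianRing.equivPi K)
  exact (Algebra.FormallyEtale.pi_iff _).1 h ⟨q, inferInstance⟩

variable {C L : Type*} [Field C] [CommRing L] [Algebra C L] {n : ℕ} [IsArtinianRing L]

/-- The composition `K[X] → (K / (K ∩ Q))[X] → L / Q` is formally étale, the first map because the
residue fields of the reduced Artinian ring `K` are. -/
theorem formallyEtale_aeval_mk {K : Subalgebra C L} [IsArtinianRing K] [IsReduced K] {u : Fin n → L}
    {Q : Ideal L} {hQ : Q.IsPrime} (h : IsSeparatingAt K u Q hQ) :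
    ((Ideal.Quotient.mk Q).comp
      (MvPolynomial.aeval (R := K) u : MvPolynomial (Fin n) K →ₐ[K] L).toRingHom).FormallyEtale := by
  have hq : (Q.comap (algebraMap K L)).IsMaximal := IsArtinianRing.isMaximal_of_isPrime _
  let P := MvPolynomial (Fin n) (K ⧸ Q.comap (algebraMap K L))
  let f : P →+* L ⧸ Q :=
    (MvPolynomial.aeval fun i => Ideal.Quotient.mk Q (u i)).toRingHom
  have h0 := @formallyEtale_of_isSeparatingBasis (K ⧸ Q.comap (algebraMap K L)) (L ⧸ Q) (Fin n)
    (@Ideal.Quotient.field _ _ _ hq)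
    (@Ideal.Quotient.field _ _ Q (IsArtinianRing.isMaximal_of_isPrime Q)) _ _ h.2
  have h1 : RingHom.FormallyEtale (R := P) (S := L ⧸ Q) f := h0
  have h2 : Algebra.FormallyEtale K (K ⧸ Q.comap (algebraMap K L)) := formallyEtale_quotient _
  have h3 := (formallyEtale_mvPolynomial_map (A := K) (B := K ⧸ Q.comap (algebraMap K L))
    (Fin n)).comp h1
  let π : K →+* K ⧸ Q.comap (algebraMap K L) := algebraMap _ _
  have h4 : (Ideal.Quotient.mk Q).comp
      (MvPolynomial.aeval (R := K) u : MvPolynomial (Fin n) K →ₐ[K] L).toRingHom =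
      f.comp (MvPolynomial.map π) := by
    refine MvPolynomial.ringHom_ext (fun a => ?_) fun i => ?_
    · exact (congrArg (Ideal.Quotient.mk Q) (MvPolynomial.aeval_C u a)).trans
        ((congrArg f (MvPolynomial.map_C π a)).trans (MvPolynomial.aeval_C _ _)).symm
    · exact (congrArg (Ideal.Quotient.mk Q) (MvPolynomial.aeval_X u i)).trans
        ((congrArg f (MvPolynomial.map_X π i)).trans (MvPolynomial.aeval_X _ _)).symm
  rw [h4]
  exact h3

theorem formallyEtale_aeval [IsReduced L] {K : Subalgebra C L} [IsArtinianRing K] {u : Fin n → L}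
    (hu : ∀ (Q : Ideal L) (hQ : Q ∈ minimalPrimes L), IsSeparatingAt K u Q hQ.1.1) :
    (MvPolynomial.aeval (R := K) u : MvPolynomial (Fin n) K →ₐ[K] L).toRingHom.FormallyEtale := by
  have : IsReduced K := isReduced_of_injective K.val Subtype.val_injective
  let _ : Algebra (MvPolynomial (Fin n) K) L :=
    (MvPolynomial.aeval (R := K) u : MvPolynomial (Fin n) K →ₐ[K] L).toRingHom.toAlgebra
  have h1 : ∀ I : MaximalSpectrum L, Algebra.FormallyEtale (MvPolynomial (Fin n) K)
      (L ⧸ I.asIdeal) := fun I => by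
    have hI : I.asIdeal ∈ minimalPrimes L := by
      rw [Ring.KrullDimLE.minimalPrimes_eq_setOfPred_isPrime]
      exact I.isMaximal.isPrime
    have := formallyEtale_aeval_mk (hu _ hI)
    exact this
  exact Algebra.FormallyEtale.of_equiv
    ((IsArtinianRing.equivPi L).restrictScalars (MvPolynomial (Fin n) K)).symm

end Separable

/-! ### The nilradical of a module algebra -/

section Nilradical

variable {σ R : Type*} [CommRing R]

/-- Modulo every prime ideal of `R`, a nilpotent power series vanishes. -/
theorem isNilpotent_coeff_of_isNilpotent {f : MvPowerSeries σ R} (hf : IsNilpotent f) (k : σ →₀ ℕ) :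
    IsNilpotent (MvPowerSeries.coeff k f) := by
  rw [← mem_nilradical, nilradical_eq_sInf, Ideal.mem_sInf]
  intro Q hQ
  have : Q.IsPrime := hQ
  have h1 : MvPowerSeries.map (Ideal.Quotient.mk Q) f = 0 := (hf.map _).eq_zero
  rw [← Ideal.Quotient.eq_zero_iff_mem, ← MvPowerSeries.coeff_map, h1, map_zero]

variable {C G D1 L : Type*} [Field C] [Monoid G] [Ring D1] [HopfAlgebra C D1]
  [MulSemiringAction G D1] [SMulCommClass G C D1] [IsCoalgAction C G D1]
  [CommRing L] [Algebra C L]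

/-- A bialgebra element with the comultiplication of a divided power basis acts on nilpotent
elements by nilpotent elements: the basis acts through a ring homomorphism `L → L⟦t⟧`. -/
theorem isNilpotent_act_of_comul {D ι : Type*} [Ring D] [Bialgebra C D] (Ψ : ModuleAlgebra C D L)
    (b : (ι →₀ ℕ) → D)
    (hcomul : by classical exact ∀ α, Coalgebra.comul (R := C) (b α) =
      ∑ p ∈ Finset.HasAntidiagonal.antidiagonal α, b p.1 ⊗ₜ[C] b p.2)
    (hcounit : by classical exact ∀ α, Coalgebra.counit (R := C) (b α) = if α = 0 then 1 else 0)
    (α : ι →₀ ℕ) {a : L} (ha : IsNilpotent a) : IsNilpotent (Ψ.act (b α) a) := by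
  classical
  let f : L →+* MvPowerSeries ι L :=
    { toFun := fun a => (fun α => Ψ.act (b α) a : MvPowerSeries ι L)
      map_zero' := MvPowerSeries.ext fun α => map_zero (Ψ.act (b α))
      map_add' := fun x y => MvPowerSeries.ext fun α => map_add (Ψ.act (b α)) x y
      map_one' := MvPowerSeries.ext fun α => by
        rw [MvPowerSeries.coeff_one]
        refine (Ψ.act_one (b α)).trans ?_
        rw [hcounit]
        split_ifs
        · exact map_one _
        · exact map_zero _
      map_mul' := fun x y => MvPowerSeries.ext fun α => by
        refine Eq.trans ?_ (MvPowerSeries.coeff_mul α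
          (fun α => Ψ.act (b α) x : MvPowerSeries ι L) (fun α => Ψ.act (b α) y)).symm
        refine (Ψ.act_mul (b α) x y).trans ?_
        rw [hcomul, map_sum, map_sum]
        exact Finset.sum_congr (by congr) fun p _ => rfl }
  exact isNilpotent_coeff_of_isNilpotent (ha.map f) α

theorem isNilpotent_act_single (Ψ : ModuleAlgebra C (Smash G D1) L) (g : G) {a : L}
    (ha : IsNilpotent a) : IsNilpotent (Ψ.act (SkewMonoidAlgebra.single g 1) a) := by
  let f : L →+* L :=
    { toFun := Ψ.act (SkewMonoidAlgebra.single g 1)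
      map_zero' := map_zero _
      map_add' := map_add _
      map_one' := by
        rw [Ψ.act_one]
        rw [show Coalgebra.counit (R := C) (SkewMonoidAlgebra.single g 1 : Smash G D1) = 1 from
          (Smash.counit_single g 1).trans Bialgebra.counit_one, map_one]
      map_mul' := fun x y => by
        rw [Ψ.act_mul]
        rw [show Coalgebra.comul (R := C) (SkewMonoidAlgebra.single g 1 : Smash G D1) =
            SkewMonoidAlgebra.single g 1 ⊗ₜ SkewMonoidAlgebra.single g 1 by
          refine (Smash.comul_single g 1).trans ?_
          rw [Bialgebra.comul_one]
          rfl]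
        rfl }
  exact ha.map f

/-- A simple module algebra over `D¹ # C G`, with `D¹` of Birkhoff–Witt type, is reduced, because
its nilradical is a stable ideal. -/
theorem isReduced_of_isSimple (hD1 : IsBirkhoffWitt C D1) (Ψ : ModuleAlgebra C (Smash G D1) L)
    (hL : Ψ.IsSimple) : IsReduced L := by
  obtain ⟨ι, b, hcomul, hcounit⟩ := hD1
  have hb : ∀ (α : ι →₀ ℕ) (a : L), IsNilpotent a →
      IsNilpotent (Ψ.act (SkewMonoidAlgebra.single 1 (b α)) a) := fun α a ha => by
    refine isNilpotent_act_of_comul Ψ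
      (fun α => (SkewMonoidAlgebra.single 1 (b α) : Smash G D1)) (fun α => ?_) (fun α => ?_) α ha
    · refine (Smash.comul_single 1 (b α)).trans ?_
      rw [hcomul, map_sum]
      rfl
    · exact (Smash.counit_single 1 (b α)).trans (hcounit α)
  have hd : ∀ (d : D1) (a : L), IsNilpotent a →
      Ψ.act (SkewMonoidAlgebra.single 1 d) a ∈ nilradical L := fun d a ha => by
    change Ψ.act (SkewMonoidAlgebra.lsingle C 1 d) a ∈ nilradical L
    rw [← b.linearCombination_repr d, Finsupp.linearCombination_apply, Finsupp.sum, map_sum,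
      map_sum, LinearMap.sum_apply]
    refine sum_mem fun α _ => ?_
    rw [map_smul, map_smul, LinearMap.smul_apply, Algebra.smul_def]
    exact Ideal.mul_mem_left _ _ (mem_nilradical.2 (hb α a ha))
  have hstable : ∀ (d : Smash G D1), ∀ a ∈ nilradical L, Ψ.act d a ∈ nilradical L := by
    intro d a ha
    induction d using SkewMonoidAlgebra.induction_on with
    | zero =>
      rw [map_zero]
      exact zero_mem _
    | single g d =>
      have h : (SkewMonoidAlgebra.single g d : Smash G D1) =
          SkewMonoidAlgebra.single 1 d * SkewMonoidAlgebra.single g 1 := by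
        rw [SkewMonoidAlgebra.single_mul_single, one_mul, one_smul, mul_one]
      rw [h, map_mul]
      exact hd d _ (isNilpotent_act_single Ψ g (mem_nilradical.1 ha))
    | add d e hd he =>
      rw [map_add]
      exact add_mem hd he
  rcases hL.2 _ hstable with h | h
  · exact nilradical_eq_bot_iff.1 h
  · have := hL.1
    have h1 : (1 : L) ∈ nilradical L := h ▸ trivial
    exact absurd (mem_nilradical.1 h1) not_isNilpotent_one

end Nilradical

/-! ### Coordinates on the completed tensor product -/

section DualEval

variable {L : Type*} [CommRing L] {S M N : Type*} [AddCommGroup S] [Module L S]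
  [AddCommGroup M] [Module L M] [AddCommGroup N] [Module L N]

/-- The map `l ⊗ id : S ⊗ M → M` of a linear form `l` on `S`. -/
def dualEval (M : Type*) [AddCommGroup M] [Module L M] (l : S →ₗ[L] L) : S ⊗[L] M →ₗ[L] M :=
  (TensorProduct.lid L M).toLinearMap ∘ₗ LinearMap.rTensor M l

theorem dualEval_tmul (l : S →ₗ[L] L) (s : S) (m : M) : dualEval M l (s ⊗ₜ m) = l s • m := rfl

theorem dualEval_lTensor (l : S →ₗ[L] L) (f : M →ₗ[L] N) (t : S ⊗[L] M) :
    dualEval N l (LinearMap.lTensor S f t) = f (dualEval M l t) := by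
  induction t using TensorProduct.induction_on with
  | zero => simp
  | add x y hx hy => simp only [map_add, hx, hy]
  | tmul s m => rw [LinearMap.lTensor_tmul, dualEval_tmul, dualEval_tmul, map_smul]

/-- Linear forms on a projective module `S` separate the elements of `S ⊗ M`, because `S` embeds
into a free module as a direct summand. -/
theorem eq_zero_of_dualEval_eq_zero [Module.Projective L S] (t : S ⊗[L] M)
    (h : ∀ l : S →ₗ[L] L, dualEval M l t = 0) : t = 0 := by
  classical
  obtain ⟨σ, hσ⟩ := Module.projective_def'.1 (inferInstance : Module.Projective L S)
  have h1 : LinearMap.rTensor M σ t = 0 := by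
    rw [← LinearEquiv.map_eq_zero_iff (TensorProduct.finsuppScalarLeft L M S)]
    ext x
    rw [Finsupp.zero_apply, ← h (Finsupp.lapply x ∘ₗ σ)]
    clear h
    induction t using TensorProduct.induction_on with
    | zero => simp
    | add x y hx hy => simp only [map_add, Finsupp.add_apply, hx, hy]
    | tmul s m => simp [dualEval_tmul]
  have h2 := congrArg (LinearMap.rTensor M (Finsupp.linearCombination L (id : S → S))) h1
  rwa [map_zero, ← LinearMap.rTensor_comp_apply, hσ, LinearMap.rTensor_id,
    LinearMap.id_apply] at h2

theorem mem_range_lTensor_of_dualEval_mem [Module.Projective L S] (P : Submodule L M)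
    (t : S ⊗[L] M) (h : ∀ l : S →ₗ[L] L, dualEval M l t ∈ P) :
    t ∈ LinearMap.range (LinearMap.lTensor S P.subtype) := by
  rw [← lTensor_mkQ, LinearMap.mem_ker]
  refine eq_zero_of_dualEval_eq_zero _ fun l => ?_
  rw [dualEval_lTensor, Submodule.mkQ_apply, Submodule.Quotient.mk_eq_zero]
  exact h l

end DualEval

section Coord

variable {n : ℕ} {L : Type*} [CommRing L] {θ : IterDer n L}
  {S : Type*} [CommRing S] [Algebra L S] {A : Type*} [CommRing A]

/-- The coefficient of `w^k` of an element of `A⟦w⟧`. -/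
def Tw.coeff (θ : IterDer n L) (A : Type*) [CommRing A] (k : Fin n →₀ ℕ) : Tw θ A →+ A :=
  (MvPowerSeries.coeff k : MvPowerSeries (Fin n) A →ₗ[A] A).toAddMonoidHom

theorem Tw.mem_ideal_pow_iff (m : ℕ) (b : Tw θ A) :
    b ∈ Tw.ideal θ A ^ m ↔ ∀ k : Fin n →₀ ℕ, k.degree < m → Tw.coeff θ A k b = 0 :=
  ⟨fun hb _ hk => coeff_eq_zero_of_mem_span_X_pow (R := A) hb hk,
    fun h => mem_span_X_pow_of_coeff_eq_zero (R := A) m b h⟩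

variable [Algebra L A] {B : Type*} [CommRing B] [Algebra L B]

theorem Tw.coeff_map (g : A →ₐ[L] B) (k : Fin n →₀ ℕ) (b : Tw θ A) :
    Tw.coeff θ B k (Tw.map θ g b) = g (Tw.coeff θ A k b) :=
  MvPowerSeries.coeff_map (g : A →+* B) k b

theorem dualEval_mul (l : S →ₗ[L] L) (t : Tens θ S A) (b : Tw θ A) :
    dualEval (Tw θ A) l (t * 1 ⊗ₜ b) = dualEval (Tw θ A) l t * b := by
  induction t using TensorProduct.induction_on with
  | zero => rw [zero_mul, map_zero, zero_mul]
  | add x y hx hy => rw [add_mul, map_add, map_add, hx, hy, add_mul]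
  | tmul s c => rw [Algebra.TensorProduct.tmul_mul_tmul, dualEval_tmul, dualEval_tmul, mul_one,
      smul_mul_assoc]

theorem tmul_mem_wIdeal_pow {m : ℕ} (s : S) {b : Tw θ A} (hb : b ∈ Tw.ideal θ A ^ m) :
    (s ⊗ₜ[L] b : Tens θ S A) ∈ wIdeal θ S A ^ m := by
  have h : (s ⊗ₜ[L] b : Tens θ S A) = s ⊗ₜ 1 * 1 ⊗ₜ b := by
    rw [Algebra.TensorProduct.tmul_mul_tmul, mul_one, one_mul]
  rw [h, wIdeal, ← Ideal.map_pow]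
  exact Ideal.mul_mem_left _ _ (Ideal.mem_map_of_mem
    (Algebra.TensorProduct.includeRight : Tw θ A →ₐ[L] Tens θ S A) hb)

theorem dualEval_mem_ideal_pow (l : S →ₗ[L] L) {m : ℕ} {t : Tens θ S A}
    (ht : t ∈ wIdeal θ S A ^ m) : dualEval (Tw θ A) l t ∈ Tw.ideal θ A ^ m := by
  have key : ∀ c : Tens θ S A, dualEval (Tw θ A) l (c * t) ∈ Tw.ideal θ A ^ m := by
    rw [wIdeal, ← Ideal.map_pow] at ht
    refine Submodule.span_induction
      (p := fun t _ => ∀ c : Tens θ S A, dualEval (Tw θ A) l (c * t) ∈ Tw.ideal θ A ^ m)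
      ?_ ?_ ?_ ?_ ht
    · rintro _ ⟨b, hb, rfl⟩ c
      change dualEval (Tw θ A) l (c * 1 ⊗ₜ b) ∈ _
      rw [dualEval_mul]
      exact Ideal.mul_mem_left _ _ hb
    · intro c
      rw [mul_zero, map_zero]
      exact zero_mem _
    · intro x y _ _ hx hy c
      rw [mul_add, map_add]
      exact add_mem (hx c) (hy c)
    · intro a x _ hx c
      rw [smul_eq_mul, ← mul_assoc]
      exact hx (c * a)
  simpa using key 1

/-- The powers of the ideal `(w)` of `S ⊗ A⟦w⟧` are detected by the coefficients of the power series
`(l ⊗ id)(t)`. -/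
theorem mem_wIdeal_pow_iff [Module.Projective L S] (m : ℕ) (t : Tens θ S A) :
    t ∈ wIdeal θ S A ^ m ↔ ∀ (l : S →ₗ[L] L) (k : Fin n →₀ ℕ), k.degree < m →
      Tw.coeff θ A k (dualEval (Tw θ A) l t) = 0 := by
  refine ⟨fun ht l => (Tw.mem_ideal_pow_iff m _).1 (dualEval_mem_ideal_pow l ht), fun h => ?_⟩
  obtain ⟨t', rfl⟩ := mem_range_lTensor_of_dualEval_mem
    ((Tw.ideal θ A ^ m).restrictScalars L) t fun l => (Tw.mem_ideal_pow_iff m _).2 (h l)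
  clear h
  induction t' using TensorProduct.induction_on with
  | zero => rw [map_zero]; exact zero_mem _
  | add x y hx hy => rw [map_add]; exact add_mem hx hy
  | tmul s b => exact tmul_mem_wIdeal_pow s b.2

/-- The coefficient of `w^k` in `(l ⊗ id)(t)` depends only on the residue class of `t` modulo
`(w)^(|k| + 1)`. -/
def coordLevel (l : S →ₗ[L] L) (k : Fin n →₀ ℕ) :
    (Tens θ S A ⧸ wIdeal θ S A ^ (k.degree + 1)) →+ A :=
  QuotientAddGroup.lift (wIdeal θ S A ^ (k.degree + 1)).toAddSubgroup
    ((Tw.coeff θ A k).comp (dualEval (Tw θ A) l).toAddMonoidHom) fun _ ht =>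
      (Tw.mem_ideal_pow_iff _ _).1 (dualEval_mem_ideal_pow l ht) k (Nat.lt_succ_self _)

/-- The coordinate of an element of `S ⊗̂ A⟦w⟧` that belongs to a linear form `l` on `S` and a
multi-index `k`: the coefficient of `w^k` in its image under `l ⊗̂ id`. -/
def coord (l : S →ₗ[L] L) (k : Fin n →₀ ℕ) : CTens θ S A →+ A :=
  (coordLevel l k).comp (AdicCompletion.evalₐ (wIdeal θ S A) (k.degree + 1) :
    CTens θ S A →+* Tens θ S A ⧸ wIdeal θ S A ^ (k.degree + 1)).toAddMonoidHom

theorem coord_eq (l : S →ₗ[L] L) {k : Fin n →₀ ℕ} {m : ℕ} (hk : k.degree < m) {x : CTens θ S A}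
    {t : Tens θ S A} (ht : AdicCompletion.evalₐ (wIdeal θ S A) m x = Ideal.Quotient.mk _ t) :
    coord l k x = Tw.coeff θ A k (dualEval (Tw θ A) l t) := by
  have h : AdicCompletion.evalₐ (wIdeal θ S A) (k.degree + 1) x = Ideal.Quotient.mk _ t := by
    rw [← factorPow_evalₐ (Nat.succ_le_of_lt hk), ht]
    rfl
  change coordLevel l k (AdicCompletion.evalₐ (wIdeal θ S A) (k.degree + 1) x) = _
  rw [h]
  rfl

/-- If `S` is projective, the coordinates separate the elements of `S ⊗̂ A⟦w⟧`. -/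
theorem coord_ext [Module.Projective L S] {x y : CTens θ S A}
    (h : ∀ (l : S →ₗ[L] L) k, coord l k x = coord l k y) : x = y := by
  refine sub_eq_zero.1 (AdicCompletion.ext_evalₐ fun m => ?_)
  obtain ⟨t, ht⟩ := Ideal.Quotient.mk_surjective
    (AdicCompletion.evalₐ (wIdeal θ S A) m (x - y))
  rw [map_zero, ← ht, Ideal.Quotient.eq_zero_iff_mem, mem_wIdeal_pow_iff]
  intro l k hk
  rw [← coord_eq l hk ht.symm, map_sub, h, sub_self]

/-- The map `S ⊗ A⟦w⟧ → S ⊗ B⟦w⟧` induced by `g : A → B`. -/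
def tensMap (θ : IterDer n L) (S : Type*) [CommRing S] [Algebra L S] (g : A →ₐ[L] B) :
    Tens θ S A →ₗ[L] Tens θ S B :=
  LinearMap.lTensor S (Tw.map θ g).toLinearMap

theorem mapC_ofTens (g : A →ₐ[L] B) (t : Tens θ S A) :
    mapC θ (AlgHom.id L S) g (ofTens θ S A t) = ofTens θ S B (tensMap θ S g t) := by
  induction t using TensorProduct.induction_on with
  | zero => simp only [map_zero]
  | add x y hx hy => simp only [map_add, hx, hy]
  | tmul s b =>
    rw [ofTens_tmul, map_mul, mapC_inS, mapC_inW, tensMap, LinearMap.lTensor_tmul, ofTens_tmul]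
    rfl

theorem evalₐ_mapC (g : A →ₐ[L] B) {m : ℕ} {x : CTens θ S A} {t : Tens θ S A}
    (ht : AdicCompletion.evalₐ (wIdeal θ S A) m x = Ideal.Quotient.mk _ t) :
    AdicCompletion.evalₐ (wIdeal θ S B) m (mapC θ (AlgHom.id L S) g x) =
      Ideal.Quotient.mk _ (tensMap θ S g t) := by
  have h1 : AdicCompletion.evalₐ (wIdeal θ S A) m (x - ofTens θ S A t) = 0 := by
    rw [map_sub, ht, sub_eq_zero]
    exact (AdicCompletion.evalₐ_of _ m t).symm
  have h2 := mapC_cont (AlgHom.id L S) g m _ h1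
  rw [map_sub, map_sub, sub_eq_zero, mapC_ofTens] at h2
  exact h2.trans (AdicCompletion.evalₐ_of _ m _)

theorem coord_mapC (l : S →ₗ[L] L) (k : Fin n →₀ ℕ) (g : A →ₐ[L] B) (x : CTens θ S A) :
    coord l k (mapC θ (AlgHom.id L S) g x) = g (coord l k x) := by
  obtain ⟨t, ht⟩ := Ideal.Quotient.mk_surjective
    (AdicCompletion.evalₐ (wIdeal θ S A) (k.degree + 1) x)
  rw [coord_eq l (Nat.lt_succ_self _) (evalₐ_mapC g ht.symm),
    coord_eq l (Nat.lt_succ_self _) ht.symm, tensMap, dualEval_lTensor]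
  exact Tw.coeff_map g k _

end Coord

section Descent

variable {n : ℕ} {L : Type*} [CommRing L] {θ : IterDer n L}
  {S : Type*} [CommRing S] [Algebra L S] {B : Type*} [CommRing B] [Algebra L B]
  {A₁ : Type*} [CommRing A₁] [Algebra L A₁] {A₂ : Type*} [CommRing A₂] [Algebra L A₂]
  {g₁ : B →ₐ[L] A₁} {g₂ : B →ₐ[L] A₂}

/-- The level `m` of the descent of elements. The two given elements are represented by one element
of `S ⊗ (A₁⟦w⟧ × A₂⟦w⟧)`, and its images under the linear forms on `S` lie in a submodule `P`;
projectivity of `S` puts the element itself into `S ⊗ P`. -/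
theorem exists_tens_of_coord [Module.Projective L S] {x₁ : CTens θ S A₁} {x₂ : CTens θ S A₂}
    (h : ∀ (l : S →ₗ[L] L) k, ∃ b, coord l k x₁ = g₁ b ∧ coord l k x₂ = g₂ b) (m : ℕ) :
    ∃ t : Tens θ S B,
      AdicCompletion.evalₐ (wIdeal θ S A₁) m x₁ = Ideal.Quotient.mk _ (tensMap θ S g₁ t) ∧
      AdicCompletion.evalₐ (wIdeal θ S A₂) m x₂ = Ideal.Quotient.mk _ (tensMap θ S g₂ t) := by
  obtain ⟨t₁, ht₁⟩ := Ideal.Quotient.mk_surjective (AdicCompletion.evalₐ (wIdeal θ S A₁) m x₁)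
  obtain ⟨t₂, ht₂⟩ := Ideal.Quotient.mk_surjective (AdicCompletion.evalₐ (wIdeal θ S A₂) m x₂)
  -- The pairs of power series that come from `B⟦w⟧` up to terms of degree at least `m`.
  let f : Tw θ B →ₗ[L] Tw θ A₁ × Tw θ A₂ := (Tw.map θ g₁).toLinearMap.prod (Tw.map θ g₂).toLinearMap
  let P : Submodule L (Tw θ A₁ × Tw θ A₂) := LinearMap.range f ⊔
    ((Tw.ideal θ A₁ ^ m).restrictScalars L).prod ((Tw.ideal θ A₂ ^ m).restrictScalars L)
  let t : S ⊗[L] (Tw θ A₁ × Tw θ A₂) :=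
    LinearMap.lTensor S (LinearMap.inl L (Tw θ A₁) (Tw θ A₂)) t₁ +
      LinearMap.lTensor S (LinearMap.inr L (Tw θ A₁) (Tw θ A₂)) t₂
  have hfst : LinearMap.lTensor S (LinearMap.fst L (Tw θ A₁) (Tw θ A₂)) t = t₁ := by
    rw [map_add, ← LinearMap.lTensor_comp_apply, ← LinearMap.lTensor_comp_apply,
      LinearMap.fst_comp_inl, LinearMap.fst_comp_inr, LinearMap.lTensor_id, LinearMap.lTensor_zero]
    exact add_zero _
  have hsnd : LinearMap.lTensor S (LinearMap.snd L (Tw θ A₁) (Tw θ A₂)) t = t₂ := by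
    rw [map_add, ← LinearMap.lTensor_comp_apply, ← LinearMap.lTensor_comp_apply,
      LinearMap.snd_comp_inl, LinearMap.snd_comp_inr, LinearMap.lTensor_id, LinearMap.lTensor_zero]
    exact zero_add _
  have ht : ∀ l : S →ₗ[L] L, dualEval _ l t ∈ P := by
    intro l
    choose b hb₁ hb₂ using h l
    let β : Tw θ B := (fun k => b k : MvPowerSeries (Fin n) B)
    have hβ : ∀ k, Tw.coeff θ B k β = b k := fun k => rfl
    have e : dualEval _ l t = f β + (dualEval _ l t - f β) := (add_sub_cancel _ _).symm
    rw [e]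
    refine add_mem (Submodule.mem_sup_left ⟨β, rfl⟩) (Submodule.mem_sup_right ⟨?_, ?_⟩)
    · refine (Tw.mem_ideal_pow_iff m _).2 fun k hk => ?_
      have e1 : (dualEval _ l t - f β).1 = dualEval _ l t₁ - Tw.map θ g₁ β := by
        rw [← hfst, dualEval_lTensor]
        rfl
      rw [e1, map_sub, Tw.coeff_map, hβ, ← hb₁, coord_eq l hk ht₁.symm, sub_self]
    · refine (Tw.mem_ideal_pow_iff m _).2 fun k hk => ?_
      have e2 : (dualEval _ l t - f β).2 = dualEval _ l t₂ - Tw.map θ g₂ β := by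
        rw [← hsnd, dualEval_lTensor]
        rfl
      rw [e2, map_sub, Tw.coeff_map, hβ, ← hb₂, coord_eq l hk ht₂.symm, sub_self]
  obtain ⟨t', ht'⟩ := mem_range_lTensor_of_dualEval_mem P t ht
  have key : ∀ t' : S ⊗[L] P, ∃ c : Tens θ S B,
      LinearMap.lTensor S (LinearMap.fst L (Tw θ A₁) (Tw θ A₂)) (LinearMap.lTensor S P.subtype t') -
        tensMap θ S g₁ c ∈ wIdeal θ S A₁ ^ m ∧
      LinearMap.lTensor S (LinearMap.snd L (Tw θ A₁) (Tw θ A₂)) (LinearMap.lTensor S P.subtype t') -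
        tensMap θ S g₂ c ∈ wIdeal θ S A₂ ^ m := by
    intro t'
    induction t' using TensorProduct.induction_on with
    | zero => exact ⟨0, by simp, by simp⟩
    | add x y hx hy =>
      obtain ⟨c, hc₁, hc₂⟩ := hx
      obtain ⟨d, hd₁, hd₂⟩ := hy
      refine ⟨c + d, ?_, ?_⟩
      · simp only [map_add]
        rw [add_sub_add_comm]
        exact add_mem hc₁ hd₁
      · simp only [map_add]
        rw [add_sub_add_comm]
        exact add_mem hc₂ hd₂
    | tmul s p =>
      obtain ⟨p, hp⟩ := p
      obtain ⟨_, ⟨β, rfl⟩, r, hr, rfl⟩ := Submodule.mem_sup.1 hp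
      refine ⟨s ⊗ₜ β, ?_, ?_⟩
      · have : s ⊗ₜ[L] (Tw.map θ g₁ β + r.1) - s ⊗ₜ[L] (Tw.map θ g₁ β) = s ⊗ₜ r.1 := by
          rw [TensorProduct.tmul_add, add_sub_cancel_left]
        exact this ▸ tmul_mem_wIdeal_pow s hr.1
      · have : s ⊗ₜ[L] (Tw.map θ g₂ β + r.2) - s ⊗ₜ[L] (Tw.map θ g₂ β) = s ⊗ₜ r.2 := by
          rw [TensorProduct.tmul_add, add_sub_cancel_left]
        exact this ▸ tmul_mem_wIdeal_pow s hr.2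
  obtain ⟨c, hc₁, hc₂⟩ := key t'
  rw [ht', hfst, ← Ideal.Quotient.eq] at hc₁
  rw [ht', hsnd, ← Ideal.Quotient.eq] at hc₂
  exact ⟨c, ht₁.symm.trans hc₁, ht₂.symm.trans hc₂⟩

variable (hg : ∀ b, g₁ b = 0 → g₂ b = 0 → b = 0)

include hg in
theorem mapC_jointly_injective [Module.Projective L S] {x y : CTens θ S B}
    (h₁ : mapC θ (AlgHom.id L S) g₁ x = mapC θ (AlgHom.id L S) g₁ y)
    (h₂ : mapC θ (AlgHom.id L S) g₂ x = mapC θ (AlgHom.id L S) g₂ y) : x = y := by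
  refine coord_ext fun l k => sub_eq_zero.1 (hg _ ?_ ?_)
  · rw [map_sub, ← coord_mapC, ← coord_mapC, h₁, sub_self]
  · rw [map_sub, ← coord_mapC, ← coord_mapC, h₂, sub_self]

include hg in
/-- Elements of `S ⊗̂ A₁⟦w⟧` and `S ⊗̂ A₂⟦w⟧` descend to `S ⊗̂ B⟦w⟧`, for a jointly injective pair
`B → A₁`, `B → A₂`, as soon as their coordinates come from common elements of `B`. -/
theorem exists_mapC_eq_of_coord [Module.Projective L S] {x₁ : CTens θ S A₁} {x₂ : CTens θ S A₂}
    (h : ∀ (l : S →ₗ[L] L) k, ∃ b, coord l k x₁ = g₁ b ∧ coord l k x₂ = g₂ b) :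
    ∃ x : CTens θ S B,
      mapC θ (AlgHom.id L S) g₁ x = x₁ ∧ mapC θ (AlgHom.id L S) g₂ x = x₂ := by
  choose t ht₁ ht₂ using exists_tens_of_coord (θ := θ) h
  have hcoeff : ∀ (l : S →ₗ[L] L) (k : Fin n →₀ ℕ) (c : Tens θ S B),
      Tw.coeff θ A₁ k (dualEval _ l (tensMap θ S g₁ c)) = g₁ (Tw.coeff θ B k (dualEval _ l c)) ∧
      Tw.coeff θ A₂ k (dualEval _ l (tensMap θ S g₂ c)) = g₂ (Tw.coeff θ B k (dualEval _ l c)) :=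
    fun l k c => ⟨by rw [tensMap, dualEval_lTensor]; exact Tw.coeff_map g₁ k _,
      by rw [tensMap, dualEval_lTensor]; exact Tw.coeff_map g₂ k _⟩
  have hcompat : ∀ {m m' : ℕ} (hm : m ≤ m'), Ideal.Quotient.factorPow (wIdeal θ S B) hm
      (Ideal.Quotient.mk _ (t m')) = Ideal.Quotient.mk _ (t m) := by
    intro m m' hm
    change Ideal.Quotient.mk _ (t m') = Ideal.Quotient.mk _ (t m)
    rw [Ideal.Quotient.eq, mem_wIdeal_pow_iff]
    intro l k hk
    refine hg _ ?_ ?_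
    · rw [← (hcoeff l k _).1, map_sub, map_sub, map_sub,
        ← coord_eq l (lt_of_lt_of_le hk hm) (ht₁ m'), ← coord_eq l hk (ht₁ m), sub_self]
    · rw [← (hcoeff l k _).2, map_sub, map_sub, map_sub,
        ← coord_eq l (lt_of_lt_of_le hk hm) (ht₂ m'), ← coord_eq l hk (ht₂ m), sub_self]
  let x : CTens θ S B := ofFamily (fun m => Ideal.Quotient.mk _ (t m)) hcompat
  have hx : ∀ m, AdicCompletion.evalₐ (wIdeal θ S B) m x = Ideal.Quotient.mk _ (t m) :=
    evalₐ_ofFamily _ hcompat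
  exact ⟨x, AdicCompletion.ext_evalₐ fun m => (evalₐ_mapC g₁ (hx m)).trans (ht₁ m).symm,
    AdicCompletion.ext_evalₐ fun m => (evalₐ_mapC g₂ (hx m)).trans (ht₂ m).symm⟩

end Descent

/-! ### Descent of automorphisms -/

section UmeDescent

variable {n : ℕ} {L : Type*} [CommRing L] {θ : IterDer n L}
  {S : Type*} [CommRing S] [Algebra L S] {θS : IterDer n S} {hS : Extends θ θS}
  {Δ : Type*} {T : Δ → S →ₗ[L] S} {S₀ : Type*} [CommRing S₀] [Algebra L S₀] {i : S₀ →ₐ[L] S}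
  {B : Type*} [CommRing B] [Algebra L B]
  {A₁ : Type*} [CommRing A₁] [Algebra L A₁] {A₂ : Type*} [CommRing A₂] [Algebra L A₂]
  {g₁ : B →ₐ[L] A₁} {g₂ : B →ₐ[L] A₂}

theorem IsUmeAut.apply_algebraMap {A : Type*} [CommRing A] [Algebra L A]
    {φ : CTens θ S A ≃+* CTens θ S A} (hφ : IsUmeAut hS T i A φ) (a : L) :
    φ (algebraMap L (CTens θ S A) a) = algebraMap L (CTens θ S A) a := by
  rw [← (inW θ S A).commutes, hφ.fixW]

theorem mapC_algebraMap {A : Type*} [CommRing A] [Algebra L A] (g : B →ₐ[L] A) (a : L) :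
    mapC θ (AlgHom.id L S) g (algebraMap L (CTens θ S B) a) = algebraMap L (CTens θ S A) a := by
  rw [← (inW θ S B).commutes, mapC_inW, AlgHom.commutes, AlgHom.commutes]

theorem mapC_fix {A : Type*} [CommRing A] [Algebra L A] (g : B →ₐ[L] A) (y : CTens θ S₀ B) :
    mapC θ (AlgHom.id L S) g (mapC θ i (AlgHom.id L B) y) =
      mapC θ i (AlgHom.id L A) (mapC θ (AlgHom.id L S₀) g y) := by
  have := ringHom_ext ((mapC θ (AlgHom.id L S) g).comp (mapC θ i (AlgHom.id L B)))
    ((mapC θ i (AlgHom.id L A)).comp (mapC θ (AlgHom.id L S₀) g))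
    (fun b hb => by
      rw [RingHom.comp_apply, mapC_inW, mapC_inW]
      exact inW_mem θ S A (Tw.map_mem θ _ _ (Tw.map_mem θ _ _ hb)))
    (fun s => by
      rw [RingHom.comp_apply, RingHom.comp_apply, mapC_inS, mapC_inS, mapC_inS, mapC_inS]
      rfl)
    (fun b => by
      rw [RingHom.comp_apply, RingHom.comp_apply, mapC_inW, mapC_inW, mapC_inW, mapC_inW, map_id,
        map_id])
  exact DFunLike.congr_fun this y

/-- The coordinates of the images of `s ⊗ 1` under `φ₁` and `φ₂` come from common elements. -/
def CommonCoord (g₁ : B →ₐ[L] A₁) (g₂ : B →ₐ[L] A₂) (φ₁ : CTens θ S A₁ ≃+* CTens θ S A₁)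
    (φ₂ : CTens θ S A₂ ≃+* CTens θ S A₂) : Prop :=
  ∀ (s : S) (l : S →ₗ[L] L) (k : Fin n →₀ ℕ),
    ∃ b, coord l k (φ₁ (inS θ S A₁ s)) = g₁ b ∧ coord l k (φ₂ (inS θ S A₂ s)) = g₂ b

variable (hg : ∀ b, g₁ b = 0 → g₂ b = 0 → b = 0)

include hg in
/-- The descent of the ring homomorphisms underlying two automorphisms: the elements `φ₁ (s ⊗ 1)`
and `φ₂ (s ⊗ 1)` descend, and the result is extended to the completion by continuity and
`A⟦w⟧`-linearity. -/
theorem exists_ringHom_of_commonCoord [Module.Projective L S]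
    {φ₁ : CTens θ S A₁ ≃+* CTens θ S A₁} (hφ₁ : IsUmeAut hS T i A₁ φ₁)
    {φ₂ : CTens θ S A₂ ≃+* CTens θ S A₂} (hφ₂ : IsUmeAut hS T i A₂ φ₂)
    (h : CommonCoord g₁ g₂ φ₁ φ₂) :
    ∃ f : CTens θ S B →+* CTens θ S B, (∀ b, f (inW θ S B b) = inW θ S B b) ∧
      ∀ x, mapC θ (AlgHom.id L S) g₁ (f x) = φ₁ (mapC θ (AlgHom.id L S) g₁ x) ∧
        mapC θ (AlgHom.id L S) g₂ (f x) = φ₂ (mapC θ (AlgHom.id L S) g₂ x) := by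
  choose σ hσ₁ hσ₂ using fun s => exists_mapC_eq_of_coord hg (h s)
  let τ : S →ₐ[L] CTens θ S B :=
    { toFun := σ
      map_zero' := mapC_jointly_injective hg
        (by rw [hσ₁, map_zero, map_zero, map_zero]) (by rw [hσ₂, map_zero, map_zero, map_zero])
      map_one' := mapC_jointly_injective hg
        (by rw [hσ₁, map_one, map_one, map_one]) (by rw [hσ₂, map_one, map_one, map_one])
      map_add' := fun s s' => mapC_jointly_injective hg
        (by rw [hσ₁, map_add, map_add, map_add, hσ₁, hσ₁])
        (by rw [hσ₂, map_add, map_add, map_add, hσ₂, hσ₂])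
      map_mul' := fun s s' => mapC_jointly_injective hg
        (by rw [hσ₁, map_mul, map_mul, map_mul, hσ₁, hσ₁])
        (by rw [hσ₂, map_mul, map_mul, map_mul, hσ₂, hσ₂])
      commutes' := fun a => mapC_jointly_injective hg
        (by rw [hσ₁, AlgHom.commutes, hφ₁.apply_algebraMap, mapC_algebraMap])
        (by rw [hσ₂, AlgHom.commutes, hφ₂.apply_algebraMap, mapC_algebraMap]) }
  let f : CTens θ S B →+* CTens θ S B := liftC τ (AlgHom.id L B)
  have fS : ∀ s, f (inS θ S B s) = σ s := liftC_inS τ _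
  have fW : ∀ b, f (inW θ S B b) = inW θ S B b := fun b =>
    (liftC_inW τ _ b).trans (by rw [map_id])
  have h1 := ringHom_ext ((mapC θ (AlgHom.id L S) g₁).comp f)
    (φ₁.toRingHom.comp (mapC θ (AlgHom.id L S) g₁))
    (fun b hb => by
      rw [RingHom.comp_apply, fW, mapC_inW]
      exact inW_mem θ S A₁ (Tw.map_mem θ _ _ hb))
    (fun s => by
      rw [RingHom.comp_apply, RingHom.comp_apply, fS, hσ₁, mapC_inS]
      rfl)
    (fun b => by
      rw [RingHom.comp_apply, RingHom.comp_apply, fW, mapC_inW]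
      exact (hφ₁.fixW _).symm)
  have h2 := ringHom_ext ((mapC θ (AlgHom.id L S) g₂).comp f)
    (φ₂.toRingHom.comp (mapC θ (AlgHom.id L S) g₂))
    (fun b hb => by
      rw [RingHom.comp_apply, fW, mapC_inW]
      exact inW_mem θ S A₂ (Tw.map_mem θ _ _ hb))
    (fun s => by
      rw [RingHom.comp_apply, RingHom.comp_apply, fS, hσ₂, mapC_inS]
      rfl)
    (fun b => by
      rw [RingHom.comp_apply, RingHom.comp_apply, fW, mapC_inW]
      exact (hφ₂.fixW _).symm)
  exact ⟨f, fW, fun x => ⟨DFunLike.congr_fun h1 x, DFunLike.congr_fun h2 x⟩⟩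

theorem IsUmeAut.isNilpotent_coord_sub {A : Type*} [CommRing A] [Algebra L A]
    {φ : CTens θ S A ≃+* CTens θ S A} (hφ : IsUmeAut hS T i A φ) (l : S →ₗ[L] L)
    (k : Fin n →₀ ℕ) (x : CTens θ S A) : IsNilpotent (coord l k (φ x) - coord l k x) := by
  rw [← mem_nilradical, ← Ideal.Quotient.eq]
  have := congrArg (coord l k) (hφ.red x)
  rwa [coord_mapC, coord_mapC] at this

theorem umeMap_apply_mapC {A : Type*} [CommRing A] [Algebra L A] (g : B →ₐ[L] A)
    (φ : umeGroup hS T i B) (x : CTens θ S B) :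
    (umeMap g φ).1 (mapC θ (AlgHom.id L S) g x) = mapC θ (AlgHom.id L S) g (φ.1 x) :=
  baseChangeHom_mapC g φ.1 (isUme φ) x

theorem umeGroup_ext {A : Type*} [CommRing A] [Algebra L A] {φ ψ : umeGroup hS T i A}
    (h : ∀ s, φ.1 (inS θ S A s) = ψ.1 (inS θ S A s)) : φ = ψ := by
  refine Subtype.ext (RingEquiv.ext fun x => ?_)
  have := ringHom_ext (φ.1 : CTens θ S A ≃+* CTens θ S A).toRingHom
    (ψ.1 : CTens θ S A ≃+* CTens θ S A).toRingHom
    (fun b hb => by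
      change φ.1 (inW θ S A b) ∈ _
      rw [(isUme φ).fixW]
      exact inW_mem θ S A hb)
    h (fun b => ((isUme φ).fixW b).trans ((isUme ψ).fixW b).symm)
  exact DFunLike.congr_fun this x

include hg in
/-- For a jointly injective pair `B → A₁`, `B → A₂`, two elements of `Ume(A₁)` and `Ume(A₂)` descend
to `Ume(B)` if the coordinates of these automorphisms and of their inverses come from common
elements of `B`. -/
theorem exists_umeMap_eq_of_commonCoord [Module.Projective L S] (φ₁ : umeGroup hS T i A₁)
    (φ₂ : umeGroup hS T i A₂) (h : CommonCoord g₁ g₂ φ₁.1 φ₂.1)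
    (h' : CommonCoord g₁ g₂ (φ₁⁻¹).1 (φ₂⁻¹).1) :
    ∃ φ : umeGroup hS T i B, umeMap g₁ φ = φ₁ ∧ umeMap g₂ φ = φ₂ := by
  obtain ⟨f, fW, hf⟩ := exists_ringHom_of_commonCoord hg (isUme φ₁) (isUme φ₂) h
  obtain ⟨f', fW', hf'⟩ := exists_ringHom_of_commonCoord hg (isUme φ₁⁻¹) (isUme φ₂⁻¹) h'
  have e1 : ∀ x, φ₁.1 ((φ₁⁻¹).1 x) = x := fun x => RingEquiv.apply_symm_apply φ₁.1 x
  have e2 : ∀ x, φ₂.1 ((φ₂⁻¹).1 x) = x := fun x => RingEquiv.apply_symm_apply φ₂.1 x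
  have e1' : ∀ x, (φ₁⁻¹).1 (φ₁.1 x) = x := fun x => RingEquiv.symm_apply_apply φ₁.1 x
  have e2' : ∀ x, (φ₂⁻¹).1 (φ₂.1 x) = x := fun x => RingEquiv.symm_apply_apply φ₂.1 x
  let φ : CTens θ S B ≃+* CTens θ S B := RingEquiv.ofRingHom f f'
    (RingHom.ext fun x => mapC_jointly_injective hg
      (((hf _).1.trans (congrArg φ₁.1 (hf' x).1)).trans (e1 _))
      (((hf _).2.trans (congrArg φ₂.1 (hf' x).2)).trans (e2 _)))
    (RingHom.ext fun x => mapC_jointly_injective hg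
      (((hf' _).1.trans (congrArg (φ₁⁻¹).1 (hf x).1)).trans (e1' _))
      (((hf' _).2.trans (congrArg (φ₂⁻¹).1 (hf x).2)).trans (e2' _)))
  have hφ₁ : ∀ x, mapC θ (AlgHom.id L S) g₁ (φ x) = φ₁.1 (mapC θ (AlgHom.id L S) g₁ x) :=
    fun x => (hf x).1
  have hφ₂ : ∀ x, mapC θ (AlgHom.id L S) g₂ (φ x) = φ₂.1 (mapC θ (AlgHom.id L S) g₂ x) :=
    fun x => (hf x).2
  have hφ : IsUmeAut hS T i B φ := by
    refine ⟨fun d x => ?_, fun k x => ?_, fun y => ?_, fun x => ?_⟩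
    · exact mapC_jointly_injective hg
        (by rw [hφ₁, ← opC_mapC, ← opC_mapC, (isUme φ₁).op, hφ₁])
        (by rw [hφ₂, ← opC_mapC, ← opC_mapC, (isUme φ₂).op, hφ₂])
    · exact mapC_jointly_injective hg
        (by rw [hφ₁, ← thetaC_mapC, ← thetaC_mapC, (isUme φ₁).theta, hφ₁])
        (by rw [hφ₂, ← thetaC_mapC, ← thetaC_mapC, (isUme φ₂).theta, hφ₂])
    · exact mapC_jointly_injective hg (by rw [hφ₁, mapC_fix, (isUme φ₁).fix])
        (by rw [hφ₂, mapC_fix, (isUme φ₂).fix])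
    · refine coord_ext fun l k => ?_
      rw [coord_mapC, coord_mapC]
      refine Ideal.Quotient.eq.2 (mem_nilradical.2 ?_)
      obtain ⟨N₁, hN₁⟩ := (isUme φ₁).isNilpotent_coord_sub l k (mapC θ (AlgHom.id L S) g₁ x)
      obtain ⟨N₂, hN₂⟩ := (isUme φ₂).isNilpotent_coord_sub l k (mapC θ (AlgHom.id L S) g₂ x)
      rw [← hφ₁, coord_mapC, coord_mapC, ← map_sub, ← map_pow] at hN₁
      rw [← hφ₂, coord_mapC, coord_mapC, ← map_sub, ← map_pow] at hN₂
      refine ⟨N₁ + N₂, hg _ ?_ ?_⟩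
      · rw [pow_add, map_mul, hN₁, zero_mul]
      · rw [pow_add, map_mul, hN₂, mul_zero]
  refine ⟨⟨φ, hφ⟩, umeGroup_ext fun s => ?_, umeGroup_ext fun s => ?_⟩
  · have := umeMap_apply_mapC g₁ (⟨φ, hφ⟩ : umeGroup hS T i B) (inS θ S B s)
    rw [hφ₁, mapC_inS] at this
    exact this
  · have := umeMap_apply_mapC g₂ (⟨φ, hφ⟩ : umeGroup hS T i B) (inS θ S B s)
    rw [hφ₂, mapC_inS] at this
    exact this

end UmeDescent

/-! ### Weakly admissible rings from filters of ideals -/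

section IdealLimit

variable {L P : Type*} [CommRing L] [CommRing P] [Algebra L P] (𝒥 : Set (Ideal P))

/-- The inverse limit of the quotients of `P` by the ideals in `𝒥`, as a subalgebra of their
product. -/
def idealLimitSubalgebra : Subalgebra L (∀ J : 𝒥, P ⧸ J.1) where
  carrier := {x | ∀ (J J' : 𝒥) (h : J.1 ≤ J'.1), Ideal.Quotient.factor h (x J) = x J'}
  mul_mem' {x y} hx hy J J' h := by
    rw [Pi.mul_apply, map_mul, hx, hy, Pi.mul_apply]
  add_mem' {x y} hx hy J J' h := by
    rw [Pi.add_apply, map_add, hx, hy, Pi.add_apply]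
  algebraMap_mem' _ _ _ _ := rfl

variable (L) in
/-- The inverse limit of the quotients of `P` by the ideals in `𝒥`, with the limit of the discrete
topologies. -/
def IdealLimit : Type _ := idealLimitSubalgebra (L := L) 𝒥

instance : CommRing (IdealLimit L 𝒥) := inferInstanceAs (CommRing (idealLimitSubalgebra 𝒥))

instance : Algebra L (IdealLimit L 𝒥) := inferInstanceAs (Algebra L (idealLimitSubalgebra 𝒥))

instance : UniformSpace (IdealLimit L 𝒥) :=
  let _ : ∀ J : 𝒥, UniformSpace (P ⧸ J.1) := fun _ => ⊥
  inferInstanceAs (UniformSpace (idealLimitSubalgebra (L := L) 𝒥))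

namespace IdealLimit

/-- The projection to the quotient by an ideal in `𝒥`. -/
def proj (J : 𝒥) : IdealLimit L 𝒥 →ₐ[L] P ⧸ J.1 :=
  (Pi.evalAlgHom L (fun J : 𝒥 => P ⧸ J.1) J).comp (idealLimitSubalgebra 𝒥).val

/-- The canonical map from `P` to the inverse limit of its quotients. -/
def of : P →ₐ[L] IdealLimit L 𝒥 :=
  (AlgHom.pi fun J : 𝒥 => Ideal.Quotient.mkₐ L J.1).codRestrict
    (idealLimitSubalgebra 𝒥) fun _ _ _ _ => rfl

variable {𝒥}

theorem proj_of (J : 𝒥) (p : P) : proj 𝒥 J (of (L := L) 𝒥 p) = Ideal.Quotient.mk J.1 p := rfl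

theorem factor_proj {J J' : 𝒥} (h : J.1 ≤ J'.1) (x : IdealLimit L 𝒥) :
    Ideal.Quotient.factor h (proj 𝒥 J x) = proj 𝒥 J' x := x.2 J J' h

variable (hinf : ∀ J ∈ 𝒥, ∀ J' ∈ 𝒥, J ⊓ J' ∈ 𝒥) {J₀ : Ideal P} (hJ₀ : J₀ ∈ 𝒥)

include hinf hJ₀ in
theorem hasBasis_nhds_zero : (nhds (0 : IdealLimit L 𝒥)).HasBasis (fun _ : 𝒥 => True)
    fun J => (RingHom.ker (proj (L := L) 𝒥 J) : Set (IdealLimit L 𝒥)) := by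
  let _ : ∀ J : 𝒥, UniformSpace (P ⧸ J.1) := fun _ => ⊥
  have : ∀ J : 𝒥, DiscreteTopology (P ⧸ J.1) := fun _ => ⟨rfl⟩
  have h : nhds (0 : IdealLimit L 𝒥) =
      ⨅ J : 𝒥, Filter.principal (RingHom.ker (proj (L := L) 𝒥 J) : Set (IdealLimit L 𝒥)) := by
    have h1 : nhds (0 : IdealLimit L 𝒥) = Filter.comap
        (Subtype.val : idealLimitSubalgebra (L := L) 𝒥 → ∀ J : 𝒥, P ⧸ J.1) (nhds 0) :=
      nhds_induced _ _
    rw [h1, nhds_pi, Filter.pi, Filter.comap_iInf]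
    refine iInf_congr fun J => ?_
    rw [Filter.comap_comap, nhds_discrete, ← Filter.principal_singleton, Filter.comap_principal]
    rfl
  rw [h]
  have : Nonempty 𝒥 := ⟨⟨J₀, hJ₀⟩⟩
  refine Filter.hasBasis_iInf_principal fun J J' => ⟨⟨J.1 ⊓ J'.1, hinf _ J.2 _ J'.2⟩, ?_, ?_⟩
  · intro x hx
    refine (factor_proj (J := ⟨J.1 ⊓ J'.1, hinf _ J.2 _ J'.2⟩) (J' := J)
      inf_le_left x).symm.trans ?_
    rw [show proj 𝒥 _ x = 0 from hx, map_zero]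
  · intro x hx
    refine (factor_proj (J := ⟨J.1 ⊓ J'.1, hinf _ J.2 _ J'.2⟩) (J' := J')
      inf_le_right x).symm.trans ?_
    rw [show proj 𝒥 _ x = 0 from hx, map_zero]

instance isUniformAddGroup : IsUniformAddGroup (IdealLimit L 𝒥) := by
  let _ : ∀ J : 𝒥, UniformSpace (P ⧸ J.1) := fun _ => ⊥
  have : ∀ J : 𝒥, DiscreteUniformity (P ⧸ J.1) := fun _ => ⟨rfl⟩
  have : ∀ J : 𝒥, IsUniformAddGroup (P ⧸ J.1) := fun J =>
    ⟨DiscreteUniformity.uniformContinuous _ _⟩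
  exact inferInstanceAs
    (IsUniformAddGroup (idealLimitSubalgebra (L := L) 𝒥).toSubmodule.toAddSubgroup)

instance isTopologicalRing : IsTopologicalRing (IdealLimit L 𝒥) := by
  let _ : ∀ J : 𝒥, UniformSpace (P ⧸ J.1) := fun _ => ⊥
  have : ∀ J : 𝒥, DiscreteTopology (P ⧸ J.1) := fun _ => ⟨rfl⟩
  exact inferInstanceAs (IsTopologicalRing (idealLimitSubalgebra (L := L) 𝒥).toSubring)

instance completeSpace : CompleteSpace (IdealLimit L 𝒥) := by
  let _ : ∀ J : 𝒥, UniformSpace (P ⧸ J.1) := fun _ => ⊥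
  have : ∀ J : 𝒥, DiscreteUniformity (P ⧸ J.1) := fun _ => ⟨rfl⟩
  refine IsClosed.completeSpace_coe
    (s := (idealLimitSubalgebra (L := L) 𝒥 : Set (∀ J : 𝒥, P ⧸ J.1))) (hs := ?_)
  have h : (idealLimitSubalgebra (L := L) 𝒥 : Set (∀ J : 𝒥, P ⧸ J.1)) =
      ⋂ (J : 𝒥) (J' : 𝒥) (h : J.1 ≤ J'.1), {x | Ideal.Quotient.factor h (x J) = x J'} := by
    ext x
    simp only [Set.mem_iInter]
    rfl
  rw [h]
  exact isClosed_iInter fun J => isClosed_iInter fun J' => isClosed_iInter fun h =>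
    isClosed_eq (continuous_of_discreteTopology.comp (continuous_apply J)) (continuous_apply J')

instance t2Space : T2Space (IdealLimit L 𝒥) := by
  let _ : ∀ J : 𝒥, UniformSpace (P ⧸ J.1) := fun _ => ⊥
  have : ∀ J : 𝒥, DiscreteTopology (P ⧸ J.1) := fun _ => ⟨rfl⟩
  exact inferInstanceAs (T2Space (idealLimitSubalgebra (L := L) 𝒥))

include hinf hJ₀ in
theorem isOpen_ker_proj (J : 𝒥) :
    IsOpen (RingHom.ker (proj (L := L) 𝒥 J) : Set (IdealLimit L 𝒥)) :=
  (RingHom.ker (proj (L := L) 𝒥 J)).toAddSubgroup.isOpen_of_mem_nhds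
    ((hasBasis_nhds_zero hinf hJ₀).mem_of_mem trivial)

/-- If all elements of some `J₀ ∈ 𝒥` are nilpotent modulo all ideals in the filter basis `𝒥`, then
the inverse limit is weakly admissible: the kernel of the projection to `P ⧸ J₀` consists of
topologically nilpotent elements. -/
theorem isWeaklyAdmissible (hinf : ∀ J ∈ 𝒥, ∀ J' ∈ 𝒥, J ⊓ J' ∈ 𝒥) (hJ₀ : J₀ ∈ 𝒥)
    (hnil : ∀ p ∈ J₀, ∀ J ∈ 𝒥, ∃ N : ℕ, p ^ N ∈ J) : IsWeaklyAdmissible (IdealLimit L 𝒥) where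
  uniformAddGroup := inferInstance
  topologicalRing := inferInstance
  linear := IsLinearTopology.mk_of_hasBasis _ (hasBasis_nhds_zero hinf hJ₀)
  complete := inferInstance
  separated := inferInstance
  exists_open := by
    refine ⟨RingHom.ker (proj (L := L) 𝒥 ⟨J₀, hJ₀⟩), isOpen_ker_proj hinf hJ₀ _, fun x hx => ?_⟩
    refine (hasBasis_nhds_zero hinf hJ₀).tendsto_right_iff.2 fun J _ => ?_
    obtain ⟨p, hp⟩ := Ideal.Quotient.mk_surjective (proj 𝒥 ⟨J.1 ⊓ J₀, hinf _ J.2 _ hJ₀⟩ x)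
    have h1 : proj 𝒥 J x = Ideal.Quotient.mk J.1 p := by
      rw [← factor_proj (J := ⟨J.1 ⊓ J₀, hinf _ J.2 _ hJ₀⟩) inf_le_left x, ← hp]
      rfl
    have h2 : proj 𝒥 ⟨J₀, hJ₀⟩ x = Ideal.Quotient.mk J₀ p := by
      rw [← factor_proj (J := ⟨J.1 ⊓ J₀, hinf _ J.2 _ hJ₀⟩) inf_le_right x, ← hp]
      rfl
    have hp0 : p ∈ J₀ := Ideal.Quotient.eq_zero_iff_mem.1 (h2.symm.trans hx)
    obtain ⟨N, hN⟩ := hnil p hp0 J.1 J.2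
    filter_upwards [Filter.eventually_ge_atTop N] with m hm
    change proj 𝒥 J (x ^ m) = 0
    rw [map_pow, h1, ← map_pow, Ideal.Quotient.eq_zero_iff_mem]
    exact Ideal.mem_of_dvd _ (pow_dvd_pow p hm) hN

/-- The points of `Spf (lim P ⧸ J)` are the homomorphisms on `P` whose kernel belongs to the filter
of ideals `𝒥`. -/
def pointsEquiv (hinf : ∀ J ∈ 𝒥, ∀ J' ∈ 𝒥, J ⊓ J' ∈ 𝒥) (hJ₀ : J₀ ∈ 𝒥)
    (hup : ∀ J ∈ 𝒥, ∀ J', J ≤ J' → J' ∈ 𝒥) (A : Type*) [CommRing A] [Algebra L A] :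
    {f : P →ₐ[L] A // RingHom.ker f ∈ 𝒥} ≃ SpfPoints L (IdealLimit L 𝒥) A where
  toFun f := ⟨(Ideal.kerLiftAlg f.1).comp (proj 𝒥 ⟨RingHom.ker f.1, f.2⟩),
    AddSubgroup.isOpen_mono
      (H₁ := (RingHom.ker (proj (L := L) 𝒥 ⟨RingHom.ker f.1, f.2⟩)).toAddSubgroup)
      (H₂ := (RingHom.ker ((Ideal.kerLiftAlg f.1).comp
        (proj 𝒥 ⟨RingHom.ker f.1, f.2⟩))).toAddSubgroup)
      (fun x hx => by
        change Ideal.kerLiftAlg f.1 (proj 𝒥 ⟨RingHom.ker f.1, f.2⟩ x) = 0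
        rw [show proj 𝒥 ⟨RingHom.ker f.1, f.2⟩ x = 0 from hx, map_zero])
      (isOpen_ker_proj hinf hJ₀ _)⟩
  invFun h := ⟨h.1.comp (of 𝒥), by
    obtain ⟨J, -, hJ⟩ := (hasBasis_nhds_zero hinf hJ₀).mem_iff.1
      (h.2.mem_nhds (zero_mem (RingHom.ker h.1)))
    exact hup _ J.2 _ fun p hp => hJ (Ideal.Quotient.eq_zero_iff_mem.2 hp)⟩
  left_inv f := Subtype.ext (AlgHom.ext fun p => rfl)
  right_inv h := by
    refine Subtype.ext (AlgHom.ext fun x => ?_)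
    obtain ⟨J, -, hJ⟩ := (hasBasis_nhds_zero hinf hJ₀).mem_iff.1
      (h.2.mem_nhds (zero_mem (RingHom.ker h.1)))
    have hle : J.1 ≤ RingHom.ker (h.1.comp (of 𝒥)) :=
      fun p hp => hJ (Ideal.Quotient.eq_zero_iff_mem.2 hp)
    obtain ⟨p, hp⟩ := Ideal.Quotient.mk_surjective (proj 𝒥 J x)
    have h1 : h.1 (x - of 𝒥 p) = 0 := hJ (by
      change proj 𝒥 J (x - of 𝒥 p) = 0
      rw [map_sub, proj_of, hp, sub_self])
    rw [map_sub, sub_eq_zero] at h1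
    rw [h1]
    change Ideal.kerLiftAlg (h.1.comp (of 𝒥)) (proj 𝒥 ⟨_, hup _ J.2 _ hle⟩ x) = _
    rw [← factor_proj hle x, ← hp]
    rfl

theorem pointsEquiv_comp (hinf : ∀ J ∈ 𝒥, ∀ J' ∈ 𝒥, J ⊓ J' ∈ 𝒥) (hJ₀ : J₀ ∈ 𝒥)
    (hup : ∀ J ∈ 𝒥, ∀ J', J ≤ J' → J' ∈ 𝒥) {A B : Type*} [CommRing A] [Algebra L A]
    [CommRing B] [Algebra L B] (l : A →ₐ[L] B) (f : {f : P →ₐ[L] A // RingHom.ker f ∈ 𝒥})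
    (f' : {f : P →ₐ[L] B // RingHom.ker f ∈ 𝒥}) (hf : f'.1 = l.comp f.1) :
    (pointsEquiv hinf hJ₀ hup B f').1 = l.comp (pointsEquiv hinf hJ₀ hup A f).1 := by
  let h : SpfPoints L (IdealLimit L 𝒥) B := ⟨l.comp (pointsEquiv hinf hJ₀ hup A f).1,
    AddSubgroup.isOpen_mono
      (H₁ := (RingHom.ker (pointsEquiv hinf hJ₀ hup A f).1).toAddSubgroup)
      (H₂ := (RingHom.ker (l.comp (pointsEquiv hinf hJ₀ hup A f).1)).toAddSubgroup)
      (fun x hx => by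
        change l ((pointsEquiv hinf hJ₀ hup A f).1 x) = 0
        rw [show (pointsEquiv hinf hJ₀ hup A f).1 x = 0 from hx, map_zero])
      (pointsEquiv hinf hJ₀ hup A f).2⟩
  have : f' = (pointsEquiv hinf hJ₀ hup B).symm h := Subtype.ext hf
  rw [this, Equiv.apply_symm_apply]

end IdealLimit

end IdealLimit

/-! ### Representability -/

section Representability

universe uS

variable {n : ℕ} {L : Type uL} [CommRing L] {θ : IterDer n L}
  {S : Type uS} [CommRing S] [Algebra L S] {θS : IterDer n S} {hS : Extends θ θS}
  {Δ : Type*} {T : Δ → S →ₗ[L] S} {S₀ : Type*} [CommRing S₀] [Algebra L S₀] {i : S₀ →ₐ[L] S}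

/-- The polynomial ring over `L` with a pair of indeterminates for each `s : S`, each linear form on
`S` and each multi-index. They stand for the coordinates of the image of `s ⊗ 1` under an
automorphism (`true`) and under its inverse (`false`). -/
abbrev CoordRing (n : ℕ) (L : Type uL) [CommRing L] (S : Type uS) [CommRing S] [Algebra L S] :
    Type (max uS uL) :=
  MvPolynomial (Bool × S × (S →ₗ[L] L) × (Fin n →₀ ℕ)) L

section

variable {A : Type*} [CommRing A] [Algebra L A] {B : Type*} [CommRing B] [Algebra L B]

/-- The homomorphism from the coordinate ring to `A` that sends the indeterminates to the
coordinates of an element of `Ume(A)` and of its inverse. -/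
def umeCoord (φ : umeGroup hS T i A) : CoordRing n L S →ₐ[L] A :=
  MvPolynomial.aeval fun v =>
    coord v.2.2.1 v.2.2.2 ((cond v.1 φ φ⁻¹).1 (inS θ S A v.2.1))

theorem umeCoord_X_true (φ : umeGroup hS T i A) (s : S) (l : S →ₗ[L] L) (k : Fin n →₀ ℕ) :
    umeCoord φ (MvPolynomial.X (true, s, l, k)) = coord l k (φ.1 (inS θ S A s)) :=
  MvPolynomial.aeval_X _ _

theorem umeCoord_X_false (φ : umeGroup hS T i A) (s : S) (l : S →ₗ[L] L) (k : Fin n →₀ ℕ) :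
    umeCoord φ (MvPolynomial.X (false, s, l, k)) = coord l k ((φ⁻¹).1 (inS θ S A s)) :=
  MvPolynomial.aeval_X _ _

theorem coord_umeMap (g : A →ₐ[L] B) (φ : umeGroup hS T i A) (s : S) (l : S →ₗ[L] L)
    (k : Fin n →₀ ℕ) :
    coord l k ((umeMap g φ).1 (inS θ S B s)) = g (coord l k (φ.1 (inS θ S A s))) := by
  have := umeMap_apply_mapC g φ (inS θ S A s)
  rw [mapC_inS] at this
  rw [← coord_mapC, ← this]
  rfl

theorem umeCoord_umeMap (g : A →ₐ[L] B) (φ : umeGroup hS T i A) :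
    umeCoord (umeMap g φ) = g.comp (umeCoord φ) := by
  refine MvPolynomial.algHom_ext fun ⟨b, s, l, k⟩ => ?_
  rw [AlgHom.comp_apply]
  cases b
  · rw [umeCoord_X_false, umeCoord_X_false, ← map_inv, coord_umeMap]
  · rw [umeCoord_X_true, umeCoord_X_true, coord_umeMap]

theorem umeCoord_injective [Module.Projective L S] :
    Function.Injective (umeCoord : umeGroup hS T i A → _) := fun φ ψ h =>
  umeGroup_ext fun s => coord_ext fun l k => by
    rw [← umeCoord_X_true, ← umeCoord_X_true, h]

/-- Modulo nilpotent elements, all elements of `Ume(A)` have the coordinates of the identity. -/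
theorem isNilpotent_umeCoord (φ : umeGroup hS T i A) {p : CoordRing n L S}
    (hp : umeCoord (1 : umeGroup hS T i L) p = 0) : IsNilpotent (umeCoord φ p) := by
  have key : ∀ ψ : umeGroup hS T i A, ∀ s l k,
      Ideal.Quotient.mk (nilradical A) (coord l k (ψ.1 (inS θ S A s))) =
        algebraMap L (A ⧸ nilradical A) (coord l k (inS θ S L s)) := fun ψ s l k => by
    have h1 := (isUme ψ).isNilpotent_coord_sub l k (inS θ S A s)
    rw [← mem_nilradical, ← Ideal.Quotient.eq] at h1
    have h2 := coord_mapC (θ := θ) l k (Algebra.ofId L A) (inS θ S L s)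
    rw [mapC_inS] at h2
    rw [h1]
    exact congrArg (Ideal.Quotient.mk (nilradical A)) h2
  have h : (Ideal.Quotient.mkₐ L (nilradical A)).comp (umeCoord φ) =
      (Algebra.ofId L (A ⧸ nilradical A)).comp (umeCoord (1 : umeGroup hS T i L)) := by
    refine MvPolynomial.algHom_ext fun ⟨b, s, l, k⟩ => ?_
    rw [AlgHom.comp_apply, AlgHom.comp_apply]
    cases b
    · rw [umeCoord_X_false, umeCoord_X_false, inv_one]
      exact key φ⁻¹ s l k
    · rw [umeCoord_X_true, umeCoord_X_true]
      exact key φ s l k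
  have := DFunLike.congr_fun h p
  rw [AlgHom.comp_apply, AlgHom.comp_apply, hp, map_zero] at this
  exact mem_nilradical.1 (Ideal.Quotient.eq_zero_iff_mem.1 this)

end

variable (hS T i) in
/-- The ideals `J` of the coordinate ring for which the residue classes of the indeterminates are
the coordinates of an automorphism over the quotient by `J`. -/
def umeIdeals : Set (Ideal (CoordRing n L S)) :=
  {J | ∃ φ : umeGroup hS T i (CoordRing n L S ⧸ J), umeCoord φ = Ideal.Quotient.mkₐ L J}

/-- Elements of `Ume(A₁)` and `Ume(A₂)` descend to the image of the coordinate ring in `A₁ × A₂`. -/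
theorem inf_ker_umeCoord_mem [Module.Projective L S] {A₁ : Type*} [CommRing A₁] [Algebra L A₁]
    {A₂ : Type*} [CommRing A₂] [Algebra L A₂] (φ₁ : umeGroup hS T i A₁)
    (φ₂ : umeGroup hS T i A₂) :
    RingHom.ker (umeCoord φ₁) ⊓ RingHom.ker (umeCoord φ₂) ∈ umeIdeals hS T i := by
  set J : Ideal (CoordRing n L S) := RingHom.ker (umeCoord φ₁) ⊓ RingHom.ker (umeCoord φ₂) with hJ
  let g₁ : CoordRing n L S ⧸ J →ₐ[L] A₁ := Ideal.Quotient.liftₐ J (umeCoord φ₁) fun _ h => h.1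
  let g₂ : CoordRing n L S ⧸ J →ₐ[L] A₂ := Ideal.Quotient.liftₐ J (umeCoord φ₂) fun _ h => h.2
  have hg : ∀ b, g₁ b = 0 → g₂ b = 0 → b = 0 := fun b h1 h2 => by
    obtain ⟨p, rfl⟩ := Ideal.Quotient.mk_surjective b
    exact Ideal.Quotient.eq_zero_iff_mem.2 ⟨h1, h2⟩
  obtain ⟨φ, e₁, e₂⟩ := exists_umeMap_eq_of_commonCoord hg φ₁ φ₂
    (fun s l k => ⟨Ideal.Quotient.mk J (MvPolynomial.X (true, s, l, k)),
      (umeCoord_X_true φ₁ s l k).symm, (umeCoord_X_true φ₂ s l k).symm⟩)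
    (fun s l k => ⟨Ideal.Quotient.mk J (MvPolynomial.X (false, s, l, k)),
      (umeCoord_X_false φ₁ s l k).symm, (umeCoord_X_false φ₂ s l k).symm⟩)
  refine ⟨φ, AlgHom.ext fun p => sub_eq_zero.1 (hg _ ?_ ?_)⟩
  · rw [map_sub, ← AlgHom.comp_apply g₁, ← umeCoord_umeMap, e₁]
    exact sub_self _
  · rw [map_sub, ← AlgHom.comp_apply g₂, ← umeCoord_umeMap, e₂]
    exact sub_self _

theorem ker_umeCoord_mem [Module.Projective L S] {A : Type*} [CommRing A] [Algebra L A]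
    (φ : umeGroup hS T i A) : RingHom.ker (umeCoord φ) ∈ umeIdeals hS T i := by
  have := inf_ker_umeCoord_mem φ φ
  rwa [inf_idem] at this

theorem exists_umeCoord_eq {A : Type*} [CommRing A] [Algebra L A]
    {J : Ideal (CoordRing n L S)} (hJ : J ∈ umeIdeals hS T i) (f : CoordRing n L S →ₐ[L] A)
    (hf : J ≤ RingHom.ker f) : ∃ φ : umeGroup hS T i A, umeCoord φ = f := by
  obtain ⟨φ, hφ⟩ := hJ
  exact ⟨umeMap (Ideal.Quotient.liftₐ J f hf) φ, by
    rw [umeCoord_umeMap, hφ]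
    exact AlgHom.ext fun _ => rfl⟩

theorem umeIdeals_of_le [Module.Projective L S] {J J' : Ideal (CoordRing n L S)}
    (hJ : J ∈ umeIdeals hS T i) (h : J ≤ J') : J' ∈ umeIdeals hS T i :=
  exists_umeCoord_eq hJ (Ideal.Quotient.mkₐ L J')
    fun _ hp => Ideal.Quotient.eq_zero_iff_mem.2 (h hp)

theorem ker_eq_of_mem_umeIdeals {J : Ideal (CoordRing n L S)}
    {φ : umeGroup hS T i (CoordRing n L S ⧸ J)} (hφ : umeCoord φ = Ideal.Quotient.mkₐ L J) :
    RingHom.ker (umeCoord φ) = J := by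
  rw [hφ]
  exact Ideal.Quotient.mkₐ_ker L J

theorem inf_mem_umeIdeals [Module.Projective L S] (J : Ideal (CoordRing n L S))
    (hJ : J ∈ umeIdeals hS T i) (J' : Ideal (CoordRing n L S)) (hJ' : J' ∈ umeIdeals hS T i) :
    J ⊓ J' ∈ umeIdeals hS T i := by
  obtain ⟨φ, hφ⟩ := hJ
  obtain ⟨φ', hφ'⟩ := hJ'
  have := inf_ker_umeCoord_mem φ φ'
  rwa [ker_eq_of_mem_umeIdeals hφ, ker_eq_of_mem_umeIdeals hφ'] at this

/-- The elements of `Ume(A)` are the homomorphisms on the coordinate ring with kernel in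
`umeIdeals`. -/
def umeEquiv [Module.Projective L S] (A : Type*) [CommRing A] [Algebra L A] :
    umeGroup hS T i A ≃
      {f : CoordRing n L S →ₐ[L] A // RingHom.ker f ∈ umeIdeals hS T i} :=
  Equiv.ofBijective (fun φ => ⟨umeCoord φ, ker_umeCoord_mem φ⟩)
    ⟨fun _ _ h => umeCoord_injective (congrArg Subtype.val h), fun f => by
      obtain ⟨φ, hφ⟩ := exists_umeCoord_eq f.2 f.1 le_rfl
      exact ⟨φ, Subtype.ext hφ⟩⟩

open CategoryTheory in
/-- The Umemura functor is pro-represented by the quotients of the coordinate ring by the ideals in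
`umeIdeals`. -/
theorem isFormalGroupScheme_umeFunctor [Module.Projective L S] :
    IsFormalGroupScheme.{max uS uL} (umeFunctor hS T i : CommAlgCat.{v} L ⥤ GrpCat) := by
  have hJ₀ : RingHom.ker (umeCoord (1 : umeGroup hS T i L)) ∈ umeIdeals hS T i :=
    ker_umeCoord_mem _
  have hup : ∀ J ∈ umeIdeals hS T i, ∀ J', J ≤ J' → J' ∈ umeIdeals hS T i :=
    fun _ h _ => umeIdeals_of_le h
  refine ⟨IdealLimit L (umeIdeals hS T i), inferInstance, inferInstance, inferInstance,
    IdealLimit.isWeaklyAdmissible inf_mem_umeIdeals hJ₀ ?_,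
    fun A => (umeEquiv A).trans
      (IdealLimit.pointsEquiv inf_mem_umeIdeals hJ₀ hup A),
    fun A B l x => ?_⟩
  · rintro p hp J ⟨φ, hφ⟩
    obtain ⟨N, hN⟩ := isNilpotent_umeCoord φ hp
    refine ⟨N, ?_⟩
    rwa [← map_pow, hφ, Ideal.Quotient.mkₐ_eq_mk, Ideal.Quotient.eq_zero_iff_mem] at hN
  · exact IdealLimit.pointsEquiv_comp inf_mem_umeIdeals hJ₀ hup l.hom _ _ (umeCoord_umeMap l.hom x)

end Representability

end Umemura

end

theorem mainTheorem5 {C : Type uC} {G : Type uG} {D1 : Type uD} {L : Type uL}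
    [Field C] [Monoid G] [Ring D1] [HopfAlgebra C D1] [Coalgebra.IsCocomm C D1]
    (hD1 : Umemura.IsBirkhoffWitt C D1)
    [MulSemiringAction G D1] [SMulCommClass G C D1] [Umemura.IsCoalgAction C G D1]
    [CommRing L] [Algebra C L] (Ψ : Umemura.ModuleAlgebra C (Umemura.Smash G D1) L)
    (K : Subalgebra C L) (hK : Ψ.IsStable K)
    [IsArtinianRing L] [IsArtinianRing K]
    (hLsimple : Ψ.IsSimple) (hKsimple : (Ψ.restrict K hK).IsSimple)
    (hG : ∀ g : G, Function.Injective (Ψ.act (SkewMonoidAlgebra.single g 1)))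
    (n : ℕ) (u : Fin n → L)
    (hu : ∀ (Q : Ideal L) (hQ : Q ∈ minimalPrimes L), Umemura.IsSeparatingAt K u Q hQ.1.1) :
    ∃ (θ : Umemura.IterDer n L) (hθ : θ.IsAssociated K u),
      (∀ θ' : Umemura.IterDer n L, θ'.IsAssociated K u → θ' = θ) ∧
      Umemura.IsFormalGroupScheme.{max uG uD uL}
        (Umemura.Ume.{uC, max uG uD, uL, v} Ψ K θ hθ.isLinear) := by
  have hred : IsReduced L := Umemura.isReduced_of_isSimple hD1 Ψ hLsimple
  have : IsSemisimpleRing L := IsArtinianRing.isSemisimpleRing_of_isReduced L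
  obtain ⟨θ, ⟨hθK, hθu⟩, huniq⟩ :=
    Umemura.existsUnique_iterDer (R := K) u
      (Umemura.formallyEtale_aeval hu)
  have hθ : θ.IsAssociated K u := ⟨fun a ha => hθK ⟨a, ha⟩, hθu⟩
  have : Module.Projective L (Umemura.hullL Ψ θ hθ.isLinear) :=
    Module.projective_of_isSemisimpleRing L _
  exact ⟨θ, hθ, fun θ' hθ' => huniq θ' ⟨fun a => hθ'.eq_C a a.2, hθ'.shift⟩,
    Umemura.isFormalGroupScheme_umeFunctor⟩
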